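/- Let $0<\beta<1$, let $\mathbb D$ be the unit disc in $\mathbb R^2\simeq\mathbb C$ with boundary $\mathbb S^1$, outer normal $\nu$ and counterclockwise tangent $\tau$, and write $u\wedge v=u_1v_2-u_2v_1$ for $u,v\in\mathbb C$. For $a\in\mathbb D$ and a sufficiently regular $g:\mathbb S^1\to\mathbb S^1$ of degree $1$, let $\Phi_{a,g}$ be the solution of $$\Delta\Phi_{a,g}=2\pi\delta_a\ \text{in }\mathbb D,\qquad \frac{\partial\Phi_{a,g}}{\partial\nu}=g\wedge\frac{\partial g}{\partial\tau}\ \text{on }\mathbb S^1,\qquad \int_{\mathbb S^1}\Phi_{a,g}=0,$$ let $R_{a,g}(x)=\Phi_{a,g}(x)-\log|x-a|$ (extended continuously to $x=a$), and let $$W(a,g)=\frac12\int_{\mathbb S^1}\Phi_{a,g}\Big(g\wedge\frac{\partial g}{\partial\tau}\Big)-\pi R_{a,g}(a)$$ be the renormalized energy of $\mathbb D$ with one singularity of degree one ($k=1$, $d=1$). Let $\widehat\Phi_a$ solve $\Delta\widehat\Phi_a=2\pi\delta_a$ in $\mathbb D$, $\widehat\Phi_a=0$ on $\mathbb S^1$;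 a canonical boundary datum associated with $a$ is a $C^1$ map $g:\mathbb S^1\to\mathbb S^1$ of degree $1$ with $g\wedge\frac{\partial g}{\partial\tau}=\frac{\partial\widehat\Phi_a}{\partial\nu}$. Let $u_{*,a,g}(z)=\frac{z-a}{|z-a|}e^{\imath H(z)}$, with $H$ harmonic in $\mathbb D$, be the canonical harmonic map such that $u_{*,a,g}=g$ on $\mathbb S^1$, and put $N(a,g)=u_{*,a,g}\wedge\frac{\partial u_{*,a,g}}{\partial\nu}$ on $\mathbb S^1$. Let $\dot C^\beta(\mathbb S^1;\mathbb R)$ be the space of functions in $C^\beta(\mathbb S^1;\mathbb R)$ with zero integral. Then the following hold. 1. The canonical boundary data associated with $a=0$ are exactly the maps $z\mapsto cz$ with $c\in\mathbb S^1$; that is, $g^0(z)=z$ modulo $\mathbb S^1$. 2. For every canonical boundary datum $g^0$ associated with $0$, the point $a=0$ is a nondegenerate critical point of $W(\cdot,g^0)$, with Hessian $2\pi I_2$. 3. For such $g^0$, if $\psi$ is small in $C^{1,\beta}(\mathbb S^1;\mathbb R)$, then $W(\cdot,g^0e^{\imath\psi})$ has in a fixed neighborhood of $0$ a unique critical point $a(\psi)$,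 which is nondegenerate, and the formula $U_{*,0,g^0}(\psi)=N(a(\psi),g^0e^{\imath\psi})$ defines, near the origin, a map from $C^{1,\beta}(\mathbb S^1;\mathbb R)/\mathbb R$ to $\dot C^\beta(\mathbb S^1;\mathbb R)$. This map is Fréchet differentiable at the origin, and its differential $$DU_{*,0,g^0}(0):C^{1,\beta}(\mathbb S^1;\mathbb R)/\mathbb R\longrightarrow\dot C^\beta(\mathbb S^1;\mathbb R)$$ is invertible (a bounded linear bijection with bounded inverse). -/

import Mathlib

open Set Filter Topology MeasureTheory Metric InnerProductSpace
open scoped NNReal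

noncomputable section

namespace GLDisc

/-! ## Calculus on the unit circle -/

/-- The vector product of complex numbers, `(u₁ + i u₂) ∧ (v₁ + i v₂) = u₁ v₂ - u₂ v₁`. -/
def wedge (u v : ℂ) : ℝ := u.re * v.im - u.im * v.re

/-- The (counterclockwise) tangential derivative `∂f/∂τ` at `z ∈ 𝕊¹`. -/
def tangDeriv {E : Type*} [NormedAddCommGroup E] [NormedSpace ℝ E] (f : Circle → E)
    (z : Circle) : E :=
  deriv (fun t : ℝ => f (z * Circle.exp t)) 0

/-- `f` is of class `C¹` on `𝕊¹`. -/
def IsC1 {E : Type*} [NormedAddCommGroup E] [NormedSpace ℝ E] (f : Circle → E) : Prop :=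
  (∀ z : Circle, DifferentiableAt ℝ (fun t : ℝ => f (z * Circle.exp t)) 0) ∧
    Continuous (tangDeriv f)

/-- `∂f/∂ν (z) = v` at `z ∈ 𝕊¹`, where `ν = z` is the outer normal to the unit disc and `f` is
defined on the closed disc. -/
def HasNormalDeriv {E : Type*} [NormedAddCommGroup E] [NormedSpace ℝ E] (f : ℂ → E) (v : E)
    (z : Circle) : Prop :=
  HasDerivWithinAt (fun r : ℝ => f ((r : ℂ) * (z : ℂ))) v (Iic 1) 1

/-- The integral `∫_{𝕊¹} f` with respect to arc length. -/
def circleInt (f : Circle → ℝ) : ℝ := ∫ θ in (0 : ℝ)..(2 * Real.pi), f (Circle.exp θ)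

/-- `g ∧ ∂g/∂τ` for an `𝕊¹`-valued map `g` on `𝕊¹`. -/
def current (g : Circle → Circle) (z : Circle) : ℝ :=
  wedge (g z) (tangDeriv (fun w => (g w : ℂ)) z)

/-! ## The space `C^β(𝕊¹; ℝ)` and its subspace of functions with zero mean -/

/-- Hölder continuous functions of exponent `β` on `𝕊¹`, as a set of continuous functions. -/
def holderSubmodule (β : ℝ≥0) : Submodule ℝ C(Circle, ℝ) where
  carrier := {f | MemHolder β f}
  add_mem' := fun {_ _} hf hg => MemHolder.add hf hg
  zero_mem' := memHolder_zero
  smul_mem' := fun _ {_} hf => MemHolder.smul hf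

/-- The space `C^β(𝕊¹; ℝ)`. -/
def CHolder (β : ℝ≥0) : Type := holderSubmodule β

instance (β : ℝ≥0) : AddCommGroup (CHolder β) := inferInstanceAs (AddCommGroup (holderSubmodule β))

instance (β : ℝ≥0) : Module ℝ (CHolder β) := inferInstanceAs (Module ℝ (holderSubmodule β))

instance (β : ℝ≥0) : CoeFun (CHolder β) (fun _ => Circle → ℝ) := ⟨fun f => f.1⟩

/-- `‖f‖_{C^β} = sup |f| + [f]_β`, where `[f]_β` is the best Hölder constant. -/
instance (β : ℝ≥0) : Norm (CHolder β) := ⟨fun f => ‖f.1‖ + (nnHolderNorm β f.1 : ℝ)⟩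

theorem CHolder.norm_def {β : ℝ≥0} (f : CHolder β) :
    ‖f‖ = ‖f.1‖ + (nnHolderNorm β f.1 : ℝ) := rfl

theorem CHolder.core (β : ℝ≥0) : NormedSpace.Core ℝ (CHolder β) where
  norm_nonneg f := by rw [CHolder.norm_def]; positivity
  norm_smul c f := by
    have h1 : ‖(c • f).1‖ = ‖c‖ * ‖f.1‖ := norm_smul c f.1
    have h2 : nnHolderNorm β (c • f).1 = ‖c‖₊ * nnHolderNorm β f.1 :=
      MemHolder.nnHolderNorm_smul f.2 c
    rw [CHolder.norm_def, CHolder.norm_def, h1, h2]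
    push_cast
    ring
  norm_triangle f g := by
    have h1 : ‖(f + g).1‖ ≤ ‖f.1‖ + ‖g.1‖ := norm_add_le f.1 g.1
    have h2 : nnHolderNorm β (f + g).1 ≤ nnHolderNorm β f.1 + nnHolderNorm β g.1 :=
      MemHolder.nnHolderNorm_add_le f.2 g.2
    have h3 : (nnHolderNorm β (f + g).1 : ℝ) ≤ nnHolderNorm β f.1 + nnHolderNorm β g.1 := by
      exact_mod_cast h2
    rw [CHolder.norm_def, CHolder.norm_def, CHolder.norm_def]
    linarith
  norm_eq_zero_iff f := by
    constructor
    · intro h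
      have h1 : 0 ≤ ‖f.1‖ := norm_nonneg _
      have h2 : (0 : ℝ) ≤ nnHolderNorm β f.1 := NNReal.coe_nonneg _
      rw [CHolder.norm_def] at h
      have h3 : f.1 = 0 := norm_eq_zero.1 (by linarith)
      exact Subtype.ext h3
    · rintro rfl
      have h1 : (0 : CHolder β).1 = 0 := rfl
      have h2 : nnHolderNorm β (0 : CHolder β).1 = 0 :=
        (MemHolder.nnHolderNorm_eq_zero (0 : CHolder β).2).2 (fun _ _ => rfl)
      rw [CHolder.norm_def, h2, h1]
      simp

instance (β : ℝ≥0) : NormedAddCommGroup (CHolder β) := NormedAddCommGroup.ofCore (CHolder.core β)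

instance (β : ℝ≥0) : NormedSpace ℝ (CHolder β) := NormedSpace.ofCore (CHolder.core β)

/-- `Ċ^β(𝕊¹; ℝ)`: the functions of `C^β(𝕊¹; ℝ)` with zero integral, with the norm of
`C^β(𝕊¹; ℝ)`. -/
def CHolderDot (β : ℝ≥0) : Submodule ℝ (CHolder β) where
  carrier := {f | circleInt f = 0}
  zero_mem' := by
    change ∫ θ in (0 : ℝ)..(2 * Real.pi), (0 : ℝ) = 0
    simp
  add_mem' := by
    intro f g hf hg
    have hi : ∀ h : CHolder β, IntervalIntegrable (fun θ : ℝ => h.1 (Circle.exp θ)) volume 0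
        (2 * Real.pi) := fun h =>
      (h.1.continuous.comp Circle.exp.continuous).intervalIntegrable _ _
    change ∫ θ in (0 : ℝ)..(2 * Real.pi), (f.1 (Circle.exp θ) + g.1 (Circle.exp θ)) = 0
    rw [intervalIntegral.integral_add (hi f) (hi g)]
    have h1 : ∫ θ in (0 : ℝ)..(2 * Real.pi), f.1 (Circle.exp θ) = 0 := hf
    have h2 : ∫ θ in (0 : ℝ)..(2 * Real.pi), g.1 (Circle.exp θ) = 0 := hg
    rw [h1, h2, add_zero]
  smul_mem' := by
    intro c f hf
    change ∫ θ in (0 : ℝ)..(2 * Real.pi), c * f.1 (Circle.exp θ) = 0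
    have h1 : ∫ θ in (0 : ℝ)..(2 * Real.pi), f.1 (Circle.exp θ) = 0 := hf
    rw [intervalIntegral.integral_const_mul, h1, mul_zero]

/-! ## The space `C^{1,β}(𝕊¹; ℝ)` and its quotient by the constants -/

theorem tangDeriv_add {f g : Circle → ℝ} (hf : IsC1 f) (hg : IsC1 g) :
    tangDeriv (f + g) = tangDeriv f + tangDeriv g :=
  funext fun z => deriv_add (hf.1 z) (hg.1 z)

theorem tangDeriv_smul (c : ℝ) {f : Circle → ℝ} (hf : IsC1 f) :
    tangDeriv (c • f) = c • tangDeriv f :=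
  funext fun z => deriv_const_smul c (hf.1 z)

theorem tangDeriv_zero : tangDeriv (0 : Circle → ℝ) = 0 :=
  funext fun _ => deriv_const 0 (0 : ℝ)

/-- The `C¹` functions on `𝕊¹` whose tangential derivative is Hölder continuous of exponent `β`. -/
def holder1Submodule (β : ℝ≥0) : Submodule ℝ C(Circle, ℝ) where
  carrier := {f | IsC1 f ∧ MemHolder β (tangDeriv f)}
  add_mem' := by
    rintro f g ⟨hf, hf'⟩ ⟨hg, hg'⟩
    change IsC1 (⇑f + ⇑g) ∧ MemHolder β (tangDeriv (⇑f + ⇑g))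
    refine ⟨⟨fun z => (hf.1 z).add (hg.1 z), ?_⟩, ?_⟩
    · rw [tangDeriv_add hf hg]; exact hf.2.add hg.2
    · rw [tangDeriv_add hf hg]; exact hf'.add hg'
  zero_mem' := by
    change IsC1 (0 : Circle → ℝ) ∧ MemHolder β (tangDeriv (0 : Circle → ℝ))
    refine ⟨⟨fun z => differentiableAt_const (0 : ℝ), ?_⟩, ?_⟩
    · rw [tangDeriv_zero]; exact continuous_const
    · rw [tangDeriv_zero]; exact memHolder_zero
  smul_mem' := by
    rintro c f ⟨hf, hf'⟩
    change IsC1 (c • ⇑f) ∧ MemHolder β (tangDeriv (c • ⇑f))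
    refine ⟨⟨fun z => (hf.1 z).const_smul c, ?_⟩, ?_⟩
    · rw [tangDeriv_smul c hf]; exact hf.2.const_smul c
    · rw [tangDeriv_smul c hf]; exact hf'.smul

/-- The space `C^{1,β}(𝕊¹; ℝ)`. -/
def C1Holder (β : ℝ≥0) : Type := holder1Submodule β

instance (β : ℝ≥0) : AddCommGroup (C1Holder β) :=
  inferInstanceAs (AddCommGroup (holder1Submodule β))

instance (β : ℝ≥0) : Module ℝ (C1Holder β) := inferInstanceAs (Module ℝ (holder1Submodule β))

instance (β : ℝ≥0) : CoeFun (C1Holder β) (fun _ => Circle → ℝ) := ⟨fun f => f.1⟩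

/-- The tangential derivative `∂/∂τ : C^{1,β}(𝕊¹; ℝ) → C^β(𝕊¹; ℝ)`. -/
def C1Holder.tang {β : ℝ≥0} : C1Holder β →ₗ[ℝ] CHolder β where
  toFun f := ⟨⟨tangDeriv f, f.2.1.2⟩, f.2.2⟩
  map_add' f g := Subtype.ext (ContinuousMap.coe_injective (tangDeriv_add f.2.1 g.2.1))
  map_smul' c f := Subtype.ext (ContinuousMap.coe_injective (tangDeriv_smul c f.2.1))

/-- `‖f‖_{C^{1,β}} = sup |f| + ‖∂f/∂τ‖_{C^β}`. -/
instance (β : ℝ≥0) : Norm (C1Holder β) := ⟨fun f => ‖f.1‖ + ‖C1Holder.tang f‖⟩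

theorem C1Holder.norm_def {β : ℝ≥0} (f : C1Holder β) :
    ‖f‖ = ‖f.1‖ + ‖C1Holder.tang f‖ := rfl

theorem C1Holder.core (β : ℝ≥0) : NormedSpace.Core ℝ (C1Holder β) where
  norm_nonneg f := by rw [C1Holder.norm_def]; positivity
  norm_smul c f := by
    have h1 : ‖(c • f).1‖ = ‖c‖ * ‖f.1‖ := norm_smul c f.1
    rw [C1Holder.norm_def, C1Holder.norm_def, h1, map_smul, norm_smul]
    ring
  norm_triangle f g := by
    have h1 : ‖(f + g).1‖ ≤ ‖f.1‖ + ‖g.1‖ := norm_add_le f.1 g.1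
    have h2 := norm_add_le (C1Holder.tang f) (C1Holder.tang g)
    rw [C1Holder.norm_def, C1Holder.norm_def, C1Holder.norm_def, map_add]
    linarith
  norm_eq_zero_iff f := by
    constructor
    · intro h
      have h1 : 0 ≤ ‖f.1‖ := norm_nonneg _
      have h2 : 0 ≤ ‖C1Holder.tang f‖ := norm_nonneg _
      rw [C1Holder.norm_def] at h
      have h3 : f.1 = 0 := norm_eq_zero.1 (by linarith)
      exact Subtype.ext h3
    · rintro rfl
      have h1 : (0 : C1Holder β).1 = 0 := rfl
      rw [C1Holder.norm_def, h1, map_zero]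
      simp

instance (β : ℝ≥0) : NormedAddCommGroup (C1Holder β) :=
  NormedAddCommGroup.ofCore (C1Holder.core β)

instance (β : ℝ≥0) : NormedSpace ℝ (C1Holder β) := NormedSpace.ofCore (C1Holder.core β)

/-- The constant functions in `C^{1,β}(𝕊¹; ℝ)`. -/
def constants (β : ℝ≥0) : Submodule ℝ (C1Holder β) where
  carrier := {f | ∃ c : ℝ, ∀ z : Circle, f z = c}
  zero_mem' := ⟨0, fun _ => rfl⟩
  add_mem' := by
    rintro f g ⟨c, hc⟩ ⟨d, hd⟩
    exact ⟨c + d, fun z => congrArg₂ (· + ·) (hc z) (hd z)⟩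
  smul_mem' := by
    rintro r f ⟨c, hc⟩
    exact ⟨r * c, fun z => congrArg (r * ·) (hc z)⟩

/-- `C^{1,β}(𝕊¹; ℝ)/ℝ`, with the quotient norm. -/
abbrev C1HolderModConst (β : ℝ≥0) : Type := C1Holder β ⧸ constants β

/-! ## Renormalized energy of the unit disc with one singularity `a` of degree one -/

/-- `R` is the regular part of the solution `Φ_{a,g}` of the Neumann problem `ΔΦ = 2π δ_a` in `𝔻`,
`∂Φ/∂ν = g ∧ ∂g/∂τ` on `𝕊¹`, `∫_{𝕊¹} Φ = 0`: that is, `Φ(x) = log |x - a| + R(x)` with `R` harmonic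
(recall `Δ log |· - a| = 2π δ_a`). -/
def IsNeumannRegularPart (a : ℂ) (g : Circle → Circle) (R : ℂ → ℝ) : Prop :=
  HarmonicContOnCl R (ball (0 : ℂ) 1) ∧
  (∀ z : Circle, HasNormalDeriv (fun x => Real.log ‖x - a‖ + R x) (current g z) z) ∧
  circleInt (fun z => Real.log ‖(z : ℂ) - a‖ + R z) = 0

open Classical in
/-- The function `R_{a,g}` (junk value `0` if the Neumann problem has no solution). -/
def neumannR (a : ℂ) (g : Circle → Circle) : ℂ → ℝ :=
  if h : ∃ R, IsNeumannRegularPart a g R then h.choose else 0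

/-- `Φ_{a,g}(x) = log |x - a| + R_{a,g}(x)`. -/
def neumannPhi (a : ℂ) (g : Circle → Circle) (x : ℂ) : ℝ :=
  Real.log ‖x - a‖ + neumannR a g x

/-- The renormalized energy `W(a, g) = ½ ∫_{𝕊¹} Φ_{a,g} (g ∧ ∂g/∂τ) - π R_{a,g}(a)`. -/
def W (a : ℂ) (g : Circle → Circle) : ℝ :=
  (1 / 2) * circleInt (fun z => neumannPhi a g z * current g z) - Real.pi * neumannR a g a

/-- `R` is the regular part of the solution `Φ̂_a` of the Dirichlet problem `ΔΦ̂ = 2π δ_a` in `𝔻`,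
`Φ̂ = 0` on `𝕊¹`. -/
def IsDirichletRegularPart (a : ℂ) (R : ℂ → ℝ) : Prop :=
  HarmonicContOnCl R (ball (0 : ℂ) 1) ∧
  ∀ z : Circle, Real.log ‖(z : ℂ) - a‖ + R z = 0

/-- `g` is a canonical boundary datum associated with `a`: a map `g : 𝕊¹ → 𝕊¹` of class `C¹` and
degree one with `g ∧ ∂g/∂τ = ∂Φ̂_a/∂ν` on `𝕊¹`. -/
def IsCanonicalDatum (a : ℂ) (g : Circle → Circle) : Prop :=
  IsC1 (fun z => (g z : ℂ)) ∧
  circleInt (current g) = 2 * Real.pi ∧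
  ∃ R, IsDirichletRegularPart a R ∧
    ∀ z : Circle, HasNormalDeriv (fun x => Real.log ‖x - a‖ + R x) (current g z) z

/-- `a ∈ 𝔻` is a critical point of `W(·, g)`. -/
def IsCriticalPoint (g : Circle → Circle) (a : ℂ) : Prop :=
  a ∈ ball (0 : ℂ) 1 ∧ HasFDerivAt (fun b => W b g) (0 : ℂ →L[ℝ] ℝ) a

/-- The Hessian of `W(·, g)` at `a`, as a bilinear form on `ℂ ≃ ℝ²`. -/
def hessW (g : Circle → Circle) (a : ℂ) : ℂ →L[ℝ] ℂ →L[ℝ] ℝ :=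
  fderiv ℝ (fderiv ℝ (fun b => W b g)) a

/-- `a ∈ 𝔻` is a nondegenerate critical point of `W(·, g)`: the function is `C²` near `a`, its
differential at `a` vanishes and its Hessian at `a` is a nondegenerate bilinear form. -/
def IsNondegenerateCriticalPoint (g : Circle → Circle) (a : ℂ) : Prop :=
  IsCriticalPoint g a ∧ ContDiffAt ℝ 2 (fun b => W b g) a ∧ Function.Injective (hessW g a)

/-! ## The canonical harmonic map and the operator `U_*` -/

/-- `u` is the canonical harmonic map `u_{*,a,g}`: `u(z) = (z - a)/|z - a| · e^{iH(z)}` with `H`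
harmonic in `𝔻`, and `u = g` on `𝕊¹`. (At the singularity `z = a` the value `0` is prescribed.) -/
def IsCanonicalHarmonicMap (a : ℂ) (g : Circle → Circle) (u : ℂ → ℂ) : Prop :=
  ∃ H : ℂ → ℝ, HarmonicContOnCl H (ball (0 : ℂ) 1) ∧
    (∀ z ∈ closedBall (0 : ℂ) 1,
      u z = (z - a) / (‖z - a‖ : ℂ) * Complex.exp (Complex.I * (H z : ℂ))) ∧
    ∀ z : Circle, u z = g z

/-- `N(a, g) = u ∧ ∂u/∂ν` on `𝕊¹` with `u = u_{*,a,g}`: this is the relation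
`N(a, g)(z) = s` for all `z`, where `s : 𝕊¹ → ℝ`; it includes the existence of `u_{*,a,g}` and of
its normal derivative. -/
def HasN (a : ℂ) (g : Circle → Circle) (s : Circle → ℝ) : Prop :=
  ∃ u : ℂ → ℂ, IsCanonicalHarmonicMap a g u ∧
    ∀ z : Circle, ∃ v : ℂ, HasNormalDeriv u v z ∧ s z = wedge (u z) v

/-- The boundary datum `g e^{iψ}`. -/
def twist (g : Circle → Circle) (ψ : Circle → ℝ) (z : Circle) : Circle :=
  g z * Circle.exp (ψ z)

/-- `ψ ↦ a(ψ) = a(g₀ e^{iψ})` is the branch of critical points through `a₀`: for `ψ` small in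
`C^{1,β}(𝕊¹; ℝ)`, `a(ψ)` is the unique critical point of `W(·, g₀ e^{iψ})` in some fixed
neighbourhood of `a₀`, and it is nondegenerate. -/
def IsCriticalBranch (β : ℝ≥0) (a₀ : ℂ) (g₀ : Circle → Circle) (a : C1Holder β → ℂ) : Prop :=
  ∃ r > 0, ∀ᶠ ψ : C1Holder β in 𝓝 0,
    a ψ ∈ ball a₀ r ∧ IsNondegenerateCriticalPoint (twist g₀ ψ) (a ψ) ∧
    ∀ b ∈ ball a₀ r, IsCriticalPoint (twist g₀ ψ) b → b = a ψ

/-- `U` represents the operator `U_{*,a₀,g₀} : 𝔅/ℝ → Ċ^β(𝕊¹; ℝ)`,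
`U_*(ψ) = N(a(g₀ e^{iψ}), g₀ e^{iψ})`, with `𝔅` a small neighbourhood of the origin in
`C^{1,β}(𝕊¹; ℝ)`. The values of `U` away from the origin are immaterial. -/
def IsUStar (β : ℝ≥0) (a₀ : ℂ) (g₀ : Circle → Circle)
    (U : C1HolderModConst β → CHolderDot β) : Prop :=
  ∃ a : C1Holder β → ℂ, IsCriticalBranch β a₀ g₀ a ∧
    ∀ᶠ ψ : C1Holder β in 𝓝 0,
      HasN (a ψ) (twist g₀ ψ) (U (Submodule.Quotient.mk ψ)).1

end GLDisc

end

open GLDisc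

noncomputable section

namespace GLDisc

/-! ## Elementary estimates on the circle -/

/-! Everything is made explicit through the Schwarz integral. At the singularity `0` the Dirichlet
solution is `log |x|`, so a canonical datum has current `1` and is a rotation `z ↦ c z`. The
perturbed datum `c z e^{iψ}` has current `1 + ψ'`, where `ψ'` is the tangential derivative. Let `F`
be the Schwarz integral of `ψ`: it is holomorphic in the disc, with `Re F = ψ` on the circle and `Im
F(0) = 0`. The method of images gives `R = log |1 - ā x| - Im F`, and an integration by parts gives
`W(a) = const - π log (1 - |a|²) + 2π Im F(a)` (`W_twist`). At `ψ = 0` this has Hessian `2π I` at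
the origin. In general the critical points solve `ā = (1 - |a|²) i F'(a)`, a fixed point equation
that is contracting for small `ψ`; hence `ā = i F'(0) + O(‖ψ‖²)`. The identity `w F'(w) = -i S(w)`,
with `S` the Schwarz integral of `ψ'` (`mul_deriv_schwarz`), turns `i F'(0)` into `d = S'(0)`.

The canonical harmonic map is explicit too, and its normal current is `Im S - 2 Im (ā z / (1 - ā
z))` (`hasN_twist`). Write `H` for the conjugation operator (`hilbert`). To first order in `ψ` the
current is `H ψ' + Re (2 i d z)`. The first Fourier mode of `ψ'` is `Re (d z)`, and `H` sends it to
`Re (-i d z)`; the motion of the singularity therefore only reverses the sign of `H` on the first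
mode. The differential is `H` composed with a reflection and with the tangential derivative. Since
`H² = -1`, the reflection is an involution, and differentiation is an isomorphism from `C^{1,β}`
modulo constants onto mean-zero `C^β` functions, it is invertible (`conjFlipEquiv`, `diffEquiv`).

The analytic input is the boundedness of `H` on `C^β` (Privalov's theorem, by the Hardy–Littlewood
derivative criterion). As `neumannR` is obtained by choice and the representative `U` is arbitrary,
uniqueness is needed as well: for the Neumann problem by Hopf's lemma, for the branch of critical
points by contraction, for the canonical harmonic map by the Dirichlet problem. -/

theorem abs_div_pi_le_norm_exp_sub_one {θ : ℝ} (h : |θ| ≤ Real.pi) :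
    2 * (|θ| / Real.pi) ≤ ‖Complex.exp (θ * Complex.I) - 1‖ := by
  rw [mul_comm (θ : ℂ), Complex.norm_exp_I_mul_ofReal_sub_one, Real.norm_eq_abs, abs_mul,
    abs_of_pos (by norm_num : (0 : ℝ) < 2)]
  have h1 := Real.mul_abs_le_abs_sin (x := θ / 2)
    (by rw [abs_div, abs_of_pos (by norm_num : (0 : ℝ) < 2)]; linarith)
  rw [abs_div, abs_of_pos (by norm_num : (0 : ℝ) < 2)] at h1
  have h2 : 2 / Real.pi * (|θ| / 2) = |θ| / Real.pi := by ring
  linarith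

/-- The gap `1 - ‖w‖` from `w` to its radial projection `z` is at most the distance from `w` to any
point `ζ` of the circle, so the projection costs only a factor `2`. -/
theorem norm_sub_radial_le {w z ζ : ℂ} (hw : ‖w‖ ≤ 1) (hζ : ‖ζ‖ = 1) (hz : w = ‖w‖ * z)
    (hz1 : ‖z‖ = 1) : ‖ζ - z‖ ≤ 2 * ‖ζ - w‖ := by
  have h1 : ‖w - z‖ = 1 - ‖w‖ := by
    have : w - z = ((‖w‖ - 1 : ℝ) : ℂ) * z := by
      conv_lhs => rw [hz]
      push_cast
      ring
    rw [this, norm_mul, hz1, Complex.norm_real, Real.norm_eq_abs, abs_of_nonpos (by linarith)]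
    ring
  have h2 : 1 - ‖w‖ ≤ ‖ζ - w‖ := by
    have := norm_sub_norm_le ζ w
    linarith
  have h3 : ‖ζ - z‖ ≤ ‖ζ - w‖ + ‖w - z‖ := norm_sub_le_norm_sub_add_norm_sub ζ w z
  linarith

/-- The distance dominates both `1 - r` and, after projecting `r` to `1`, `|θ| / π`; the bound
follows by averaging the two. -/
theorem exp_sub_radius_lower_bound {θ r : ℝ} (h : |θ| ≤ Real.pi) (hr : 0 ≤ r) (hr1 : r ≤ 1) :
    (1 - r + |θ|) / (2 * Real.pi) ≤ ‖Complex.exp (θ * Complex.I) - r‖ := by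
  have hpi := Real.pi_gt_three
  have h1 : 1 - r ≤ ‖Complex.exp (θ * Complex.I) - r‖ := by
    have := norm_sub_norm_le (Complex.exp (θ * Complex.I)) (r : ℂ)
    rwa [Complex.norm_exp_ofReal_mul_I, Complex.norm_real, Real.norm_eq_abs, abs_of_nonneg hr]
      at this
  have h2 := abs_div_pi_le_norm_exp_sub_one h
  have h3 := norm_sub_radial_le (w := (r : ℂ)) (z := 1) (ζ := Complex.exp (θ * Complex.I))
    (by simpa [abs_of_nonneg hr] using hr1) (Complex.norm_exp_ofReal_mul_I _)
    (by simp [abs_of_nonneg hr]) (by simp)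
  have h4 : (1 - r + |θ|) / (2 * Real.pi) = (1 - r) / (2 * Real.pi) + (|θ| / Real.pi) / 2 := by
    field_simp
  have h5 : (1 - r) / (2 * Real.pi) ≤ (1 - r) / 2 := by
    apply div_le_div_of_nonneg_left <;> linarith
  linarith

theorem integral_add_rpow_le {β δ : ℝ} (hβ1 : β < 1) (hδ : 0 < δ) :
    ∫ θ in (0 : ℝ)..Real.pi, (δ + θ) ^ (β - 2) ≤ δ ^ (β - 1) / (1 - β) := by
  have hpi := Real.pi_pos
  rw [intervalIntegral.integral_comp_add_left (fun x => x ^ (β - 2)) δ,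
    integral_rpow (Or.inr ⟨by linarith, by
      rw [uIcc_of_le (by linarith)]; intro h; have := h.1; linarith⟩)]
  have h1 : β - 2 + 1 = -(1 - β) := by ring
  have h2 : β - 1 = -(1 - β) := by ring
  rw [h1, h2, div_neg, ← neg_div, add_zero]
  apply div_le_div_of_nonneg_right _ (by linarith)
  have : 0 ≤ (δ + Real.pi) ^ (-(1 - β)) := by positivity
  linarith

theorem integral_add_abs_rpow_le {β δ : ℝ} (hβ1 : β < 1) (hδ : 0 < δ) :
    ∫ θ in (-Real.pi)..Real.pi, (δ + |θ|) ^ (β - 2) ≤ 2 * (δ ^ (β - 1) / (1 - β)) := by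
  have hc : Continuous fun θ : ℝ => (δ + |θ|) ^ (β - 2) := by
    apply Continuous.rpow_const (by fun_prop)
    intro x
    left
    positivity
  have hpi := Real.pi_pos
  rw [← intervalIntegral.integral_add_adjacent_intervals (b := 0) (hc.intervalIntegrable _ _)
    (hc.intervalIntegrable _ _)]
  have h1 : ∫ θ in (-Real.pi)..0, (δ + |θ|) ^ (β - 2) = ∫ θ in (0 : ℝ)..Real.pi,
      (δ + θ) ^ (β - 2) := by
    have := intervalIntegral.integral_comp_neg (a := 0) (b := Real.pi)
      (fun θ : ℝ => (δ + |θ|) ^ (β - 2))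
    rw [neg_zero] at this
    rw [← this]
    apply intervalIntegral.integral_congr
    intro x hx
    rw [uIcc_of_le hpi.le] at hx
    simp [abs_of_nonneg hx.1]
  have h2 : ∫ θ in (0 : ℝ)..Real.pi, (δ + |θ|) ^ (β - 2) = ∫ θ in (0 : ℝ)..Real.pi,
      (δ + θ) ^ (β - 2) := by
    apply intervalIntegral.integral_congr
    intro x hx
    rw [uIcc_of_le hpi.le] at hx
    simp [abs_of_nonneg hx.1]
  rw [h1, h2]
  have := integral_add_rpow_le hβ1 hδ
  linarith

theorem continuous_norm_circleMap_sub_rpow {w : ℂ} (hw : w ∈ ball (0 : ℂ) 1) (s : ℝ) :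
    Continuous fun θ : ℝ => ‖circleMap 0 1 θ - w‖ ^ s := by
  apply Continuous.rpow_const (by fun_prop)
  intro θ
  left
  rw [norm_ne_zero_iff]
  exact sub_ne_zero.2 (circleMap_ne_mem_ball hw θ)

/-- The basic integral estimate for kernels on the circle with an integrable singularity. -/
theorem circleAverage_norm_sub_rpow_le {β : ℝ} (hβ1 : β < 1) {w : ℂ}
    (hw : w ∈ ball (0 : ℂ) 1) :
    Real.circleAverage (fun ζ => ‖ζ - w‖ ^ (β - 2)) 0 1 ≤
      ((2 * Real.pi) ^ (2 - β) / (1 - β)) * (1 - ‖w‖) ^ (β - 1) := by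
  have hw' : ‖w‖ < 1 := by simpa using hw
  have hpi := Real.pi_gt_three
  have hδ : 0 < 1 - ‖w‖ := by linarith
  rw [Real.circleAverage_def]
  have hper : Function.Periodic (fun θ : ℝ => ‖circleMap 0 1 θ - w‖ ^ (β - 2)) (2 * Real.pi) := by
    intro θ
    simp only [periodic_circleMap 0 1 θ]
  -- Centre the period at the argument of `w`, where the integrand peaks, so that the lower bound in
  -- terms of `|θ|` applies.
  have h1 := hper.intervalIntegral_add_eq 0 (Complex.arg w - Real.pi)
  rw [zero_add] at h1
  rw [h1]
  have h2 := intervalIntegral.integral_comp_add_right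
    (fun θ : ℝ => ‖circleMap 0 1 θ - w‖ ^ (β - 2)) (Complex.arg w) (a := -Real.pi) (b := Real.pi)
  have e1 : -Real.pi + Complex.arg w = Complex.arg w - Real.pi := by ring
  have e2 : Real.pi + Complex.arg w = Complex.arg w - Real.pi + 2 * Real.pi := by ring
  rw [e1, e2] at h2
  rw [← h2]
  have h3 : ∀ θ ∈ Icc (-Real.pi) Real.pi, ‖circleMap 0 1 (θ + Complex.arg w) - w‖ ^ (β - 2) ≤
      (2 * Real.pi) ^ (2 - β) * (1 - ‖w‖ + |θ|) ^ (β - 2) := by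
    intro θ hθ
    have hθ' : |θ| ≤ Real.pi := abs_le.2 ⟨hθ.1, hθ.2⟩
    have e3 : circleMap 0 1 (θ + Complex.arg w) - w =
        (Complex.exp (θ * Complex.I) - ‖w‖) * Complex.exp (Complex.arg w * Complex.I) := by
      rw [sub_mul, Complex.norm_mul_exp_arg_mul_I w, circleMap_zero]
      push_cast
      rw [add_mul, Complex.exp_add, one_mul]
    rw [e3, norm_mul, Complex.norm_exp_ofReal_mul_I, mul_one]
    have h4 := exp_sub_radius_lower_bound hθ' (norm_nonneg w) hw'.le
    have h5 : 0 < 1 - ‖w‖ + |θ| := by positivity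
    calc ‖Complex.exp (θ * Complex.I) - ‖w‖‖ ^ (β - 2)
        ≤ ((1 - ‖w‖ + |θ|) / (2 * Real.pi)) ^ (β - 2) :=
          Real.rpow_le_rpow_of_nonpos (by positivity) h4 (by linarith)
      _ = (2 * Real.pi) ^ (2 - β) * (1 - ‖w‖ + |θ|) ^ (β - 2) := by
          rw [Real.div_rpow h5.le (by positivity), div_eq_inv_mul,
            ← Real.rpow_neg (by positivity), neg_sub]
  have hc := continuous_norm_circleMap_sub_rpow hw (β - 2)
  have hc2 : Continuous fun θ : ℝ => (2 * Real.pi) ^ (2 - β) * (1 - ‖w‖ + |θ|) ^ (β - 2) := by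
    apply Continuous.mul continuous_const
    apply Continuous.rpow_const (by fun_prop)
    intro x
    left
    positivity
  have h6 := intervalIntegral.integral_mono_on (μ := volume) (by linarith : -Real.pi ≤ Real.pi)
    ((hc.comp (continuous_add_const (Complex.arg w))).intervalIntegrable _ _)
    (hc2.intervalIntegrable _ _) h3
  rw [intervalIntegral.integral_const_mul] at h6
  have h7 := integral_add_abs_rpow_le hβ1 hδ
  have h8 : 0 ≤ (2 * Real.pi) ^ (2 - β) := by positivity
  have h9 := h6.trans (mul_le_mul_of_nonneg_left h7 h8)
  rw [smul_eq_mul]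
  have h10 : 0 ≤ (2 * Real.pi) ^ (2 - β) / (1 - β) * (1 - ‖w‖) ^ (β - 1) := by
    have : 0 < 1 - β := by linarith
    positivity
  calc (2 * Real.pi)⁻¹ * _ ≤ (2 * Real.pi)⁻¹ *
        ((2 * Real.pi) ^ (2 - β) * (2 * ((1 - ‖w‖) ^ (β - 1) / (1 - β)))) :=
        mul_le_mul_of_nonneg_left h9 (by positivity)
    _ = (2 * Real.pi)⁻¹ * 2 * ((2 * Real.pi) ^ (2 - β) / (1 - β) * (1 - ‖w‖) ^ (β - 1)) := by ring
    _ ≤ 1 * ((2 * Real.pi) ^ (2 - β) / (1 - β) * (1 - ‖w‖) ^ (β - 1)) := by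
        apply mul_le_mul_of_nonneg_right _ h10
        rw [mul_inv, mul_assoc, mul_comm, mul_assoc]
        rw [mul_inv_cancel₀ (by norm_num), mul_one]
        exact inv_le_one_of_one_le₀ (by linarith)
    _ = _ := one_mul _

/-! ## Holomorphic functions whose derivative grows at most like a power near the circle -/

theorem integral_one_sub_rpow {β h : ℝ} (hβ0 : 0 < β) :
    ∫ s in (1 - h)..1, (1 - s) ^ (β - 1) = h ^ β / β := by
  rw [intervalIntegral.integral_comp_sub_left (fun x => x ^ (β - 1)) 1,
    integral_rpow (Or.inl (by linarith))]
  simp [Real.zero_rpow hβ0.ne']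

/-- Hardy–Littlewood: radial increments. -/
theorem norm_sub_dilate_le {β C : ℝ} (hβ0 : 0 < β) (hβ1 : β < 1) (hC : 0 ≤ C) {G : ℂ → ℂ}
    (hG : DifferentiableOn ℂ G (ball 0 1))
    (hG' : ∀ w ∈ ball (0 : ℂ) 1, ‖deriv G w‖ ≤ C * (1 - ‖w‖) ^ (β - 1))
    {z : ℂ} (hz : z ∈ ball (0 : ℂ) 1) {h : ℝ} (h0 : 0 ≤ h) (h1 : h ≤ 1) :
    ‖G z - G (((1 - h : ℝ) : ℂ) * z)‖ ≤ C / β * h ^ β := by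
  have hz' : ‖z‖ < 1 := by simpa using hz
  have hmem : ∀ s ∈ Icc (0 : ℝ) 1, (s : ℂ) * z ∈ ball (0 : ℂ) 1 := by
    intro s hs
    rw [mem_ball_zero_iff, norm_mul, Complex.norm_real, Real.norm_eq_abs, abs_of_nonneg hs.1]
    nlinarith [norm_nonneg z, hs.2]
  have hd : ∀ s ∈ Icc (0 : ℝ) 1, HasDerivAt (fun s : ℝ => G ((s : ℂ) * z))
      (deriv G ((s : ℂ) * z) * z) s := by
    intro s hs
    have h2 := (hG.differentiableAt (isOpen_ball.mem_nhds (hmem s hs))).hasDerivAt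
    have h3 : HasDerivAt (fun s : ℝ => (s : ℂ) * z) z s := by
      simpa using (Complex.ofRealCLM.hasDerivAt (x := s)).mul_const z
    exact h2.comp s h3
  have hcont : ContinuousOn (fun s : ℝ => deriv G ((s : ℂ) * z) * z) (Icc 0 1) := by
    apply ContinuousOn.mul _ continuousOn_const
    exact ((hG.deriv isOpen_ball).continuousOn).comp (by fun_prop) hmem
  have hsub : uIcc (1 - h) 1 ⊆ Icc (0 : ℝ) 1 := by
    rw [uIcc_of_le (by linarith)]
    exact Icc_subset_Icc (by linarith) le_rfl
  have hftc := intervalIntegral.integral_eq_sub_of_hasDerivAt (fun s hs => hd s (hsub hs))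
    ((hcont.mono hsub).intervalIntegrable)
  rw [Complex.ofReal_one, one_mul] at hftc
  rw [← hftc]
  have hint : IntervalIntegrable (fun s : ℝ => C * (1 - s) ^ (β - 1)) volume (1 - h) 1 := by
    apply IntervalIntegrable.const_mul
    have := (intervalIntegral.intervalIntegrable_rpow' (a := h) (b := 0)
      (by linarith : -1 < β - 1)).comp_sub_left 1
    simpa using this
  have hb := intervalIntegral.norm_integral_le_of_norm_le (by linarith : 1 - h ≤ 1)
    (f := fun s : ℝ => deriv G ((s : ℂ) * z) * z) (g := fun s : ℝ => C * (1 - s) ^ (β - 1))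
    (μ := volume) ?_ hint
  · rw [intervalIntegral.integral_const_mul, integral_one_sub_rpow hβ0] at hb
    calc _ ≤ _ := hb
      _ = _ := by ring
  -- The endpoint must be excluded: there the majorant is `0 ^ (β - 1)`, which is `0` by convention.
  · have hne : ∀ᵐ s : ℝ, s ≠ 1 := by
      simp [ae_iff, measure_singleton]
    filter_upwards [hne] with s hs1 hs
    have hs' : s ∈ Icc (0 : ℝ) 1 := ⟨by linarith [hs.1], hs.2⟩
    have hs2 : s < 1 := lt_of_le_of_ne hs.2 hs1
    have hle := hG' _ (hmem s hs')
    rw [norm_mul, Complex.norm_real, Real.norm_eq_abs, abs_of_nonneg hs'.1] at hle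
    have hle2 : (1 - s * ‖z‖) ^ (β - 1) ≤ (1 - s) ^ (β - 1) := by
      apply Real.rpow_le_rpow_of_nonpos (by linarith) _ (by linarith)
      nlinarith [norm_nonneg z, hs'.1]
    rw [norm_mul]
    calc ‖deriv G (s * z)‖ * ‖z‖ ≤ ‖deriv G (s * z)‖ * 1 :=
          mul_le_mul_of_nonneg_left hz'.le (norm_nonneg _)
      _ ≤ C * (1 - s * ‖z‖) ^ (β - 1) := by rw [mul_one]; exact hle
      _ ≤ C * (1 - s) ^ (β - 1) := mul_le_mul_of_nonneg_left hle2 hC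

/-- Hardy–Littlewood: a holomorphic function on the disc with `|G'| ≤ C (1 - |w|)^{β - 1}` is
Hölder continuous of exponent `β`. -/
theorem norm_sub_le_of_deriv_le {β C : ℝ} (hβ0 : 0 < β) (hβ1 : β < 1) (hC : 0 ≤ C) {G : ℂ → ℂ}
    (hG : DifferentiableOn ℂ G (ball 0 1))
    (hG' : ∀ w ∈ ball (0 : ℂ) 1, ‖deriv G w‖ ≤ C * (1 - ‖w‖) ^ (β - 1))
    {z w : ℂ} (hz : z ∈ ball (0 : ℂ) 1) (hw : w ∈ ball (0 : ℂ) 1) :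
    ‖G z - G w‖ ≤ C * (1 + 2 / β) * ‖z - w‖ ^ β := by
  -- With `h = ‖z - w‖ < 1`, both points are pulled inward by the factor `1 - h`. At that depth the
  -- derivative is at most `C h ^ (β - 1)`, and the pulled points are at distance at most `h`. For
  -- `h ≥ 1` both points are compared with the centre.
  rcases lt_or_ge ‖z - w‖ 1 with h1 | h1
  · rcases eq_or_ne z w with rfl | hne
    · simp [Real.zero_rpow hβ0.ne']
    set h := ‖z - w‖ with hh
    have h0 : 0 < h := norm_pos_iff.2 (sub_ne_zero.2 hne)
    have a1 := norm_sub_dilate_le hβ0 hβ1 hC hG hG' hz h0.le h1.le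
    have a2 := norm_sub_dilate_le hβ0 hβ1 hC hG hG' hw h0.le h1.le
    set z' := ((1 - h : ℝ) : ℂ) * z
    set w' := ((1 - h : ℝ) : ℂ) * w
    have hz1 : ‖z‖ < 1 := by simpa using hz
    have hw1 : ‖w‖ < 1 := by simpa using hw
    have hn : ‖((1 - h : ℝ) : ℂ)‖ = 1 - h := by
      rw [Complex.norm_real, Real.norm_eq_abs, abs_of_pos (by linarith)]
    have hz2 : z' ∈ closedBall (0 : ℂ) (1 - h) := by
      rw [mem_closedBall_zero_iff, norm_mul, hn]
      nlinarith
    have hw2 : w' ∈ closedBall (0 : ℂ) (1 - h) := by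
      rw [mem_closedBall_zero_iff, norm_mul, hn]
      nlinarith
    have a3 : ‖G z' - G w'‖ ≤ C * h ^ (β - 1) * ‖z' - w'‖ := by
      apply (convex_closedBall (0 : ℂ) (1 - h)).norm_image_sub_le_of_norm_deriv_le _ _ hw2 hz2
      · intro x hx
        apply hG.differentiableAt (isOpen_ball.mem_nhds _)
        rw [mem_ball_zero_iff]
        rw [mem_closedBall_zero_iff] at hx
        linarith
      · intro x hx
        rw [mem_closedBall_zero_iff] at hx
        refine (hG' x (by rw [mem_ball_zero_iff]; linarith)).trans ?_
        apply mul_le_mul_of_nonneg_left _ hC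
        exact Real.rpow_le_rpow_of_nonpos h0 (by linarith) (by linarith)
    have a4 : ‖z' - w'‖ ≤ h := by
      have : z' - w' = ((1 - h : ℝ) : ℂ) * (z - w) := by simp only [z', w']; ring
      rw [this, norm_mul, hn, ← hh]
      nlinarith
    have a5 : C * h ^ (β - 1) * ‖z' - w'‖ ≤ C * h ^ β := by
      calc C * h ^ (β - 1) * ‖z' - w'‖ ≤ C * h ^ (β - 1) * h :=
            mul_le_mul_of_nonneg_left a4 (by positivity)
        _ = C * h ^ β := by
            rw [mul_assoc, ← Real.rpow_add_one h0.ne']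
            norm_num
    have a6 : ‖G z - G w‖ ≤ ‖G z - G z'‖ + ‖G z' - G w'‖ + ‖G w - G w'‖ := by
      have : G z - G w = (G z - G z') + (G z' - G w') - (G w - G w') := by ring
      rw [this]
      exact (norm_sub_le _ _).trans (add_le_add (norm_add_le _ _) le_rfl)
    calc ‖G z - G w‖ ≤ C / β * h ^ β + C * h ^ β + C / β * h ^ β := by linarith
      _ = C * (1 + 2 / β) * h ^ β := by ring
  · have a1 := norm_sub_dilate_le hβ0 hβ1 hC hG hG' hz zero_le_one le_rfl
    have a2 := norm_sub_dilate_le hβ0 hβ1 hC hG hG' hw zero_le_one le_rfl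
    simp only [sub_self, Complex.ofReal_zero, zero_mul, Real.one_rpow, mul_one] at a1 a2
    have a3 : ‖G z - G w‖ ≤ ‖G z - G 0‖ + ‖G w - G 0‖ := by
      have : G z - G w = (G z - G 0) - (G w - G 0) := by ring
      rw [this]
      exact norm_sub_le _ _
    have a4 : 1 ≤ ‖z - w‖ ^ β := Real.one_le_rpow h1 hβ0.le
    have a5 : 0 ≤ C * (1 + 2 / β) := by positivity
    calc ‖G z - G w‖ ≤ C / β + C / β := by linarith
      _ ≤ C * (1 + 2 / β) * 1 := by
          have : C * (1 + 2 / β) = C + (C / β + C / β) := by ring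
          linarith
      _ ≤ _ := mul_le_mul_of_nonneg_left a4 a5

/-! ## Functions on the circle and circle averages -/

/-- The radially constant extension to the plane of a function on the circle. -/
def onPlane {E : Type*} (f : Circle → E) (z : ℂ) : E := f (Circle.exp (Complex.arg z))

@[simp]
theorem onPlane_coe {E : Type*} (f : Circle → E) (z : Circle) : onPlane f (z : ℂ) = f z := by
  rw [onPlane, Circle.exp_arg]

theorem circleMap_zero_one (θ : ℝ) : circleMap 0 1 θ = (Circle.exp θ : ℂ) := by
  simp [circleMap_zero, Circle.coe_exp]

@[simp]
theorem onPlane_circleMap {E : Type*} (f : Circle → E) (θ : ℝ) :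
    onPlane f (circleMap 0 1 θ) = f (Circle.exp θ) := by
  rw [circleMap_zero_one, onPlane_coe]

theorem exists_circle_of_mem_sphere {z : ℂ} (hz : z ∈ sphere (0 : ℂ) 1) :
    ∃ c : Circle, z = c := ⟨⟨z, hz⟩, rfl⟩

theorem exists_radial (w : ℂ) : ∃ z : Circle, w = ‖w‖ * z :=
  ⟨Circle.exp (Complex.arg w), by rw [Circle.coe_exp, Complex.norm_mul_exp_arg_mul_I]⟩

theorem circleIntegrable_of_continuous {E : Type*} [NormedAddCommGroup E] {φ : ℂ → E}
    (h : Continuous fun θ : ℝ => φ (circleMap 0 1 θ)) : CircleIntegrable φ 0 1 :=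
  h.intervalIntegrable _ _

theorem circleIntegrable_onPlane {E : Type*} [NormedAddCommGroup E] {f : Circle → E}
    (hf : Continuous f) : CircleIntegrable (onPlane f) 0 1 := by
  apply circleIntegrable_of_continuous
  simp only [onPlane_circleMap]
  exact hf.comp Circle.exp.continuous

theorem circleInt_eq (φ : ℂ → ℝ) :
    circleInt (fun z => φ z) = 2 * Real.pi * Real.circleAverage φ 0 1 := by
  have hpi := Real.pi_pos
  rw [Real.circleAverage_def, smul_eq_mul, ← mul_assoc, mul_inv_cancel₀ (by positivity), one_mul]
  simp only [circleInt, circleMap_zero_one]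

theorem circleInt_eq_onPlane (f : Circle → ℝ) :
    circleInt f = 2 * Real.pi * Real.circleAverage (onPlane f) 0 1 := by
  rw [← circleInt_eq]
  simp only [onPlane_coe]

theorem circleAverage_congr_circle {E : Type*} [NormedAddCommGroup E] [NormedSpace ℝ E]
    {φ χ : ℂ → E} (h : ∀ z : Circle, φ z = χ z) :
    Real.circleAverage φ 0 1 = Real.circleAverage χ 0 1 := by
  apply Real.circleAverage_congr_sphere
  intro z hz
  rw [abs_one] at hz
  obtain ⟨c, rfl⟩ := exists_circle_of_mem_sphere hz
  exact h c

theorem norm_circleAverage_le {E : Type*} [NormedAddCommGroup E] [NormedSpace ℝ E]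
    {φ : ℂ → E} {χ : ℂ → ℝ} (hχ : CircleIntegrable χ 0 1) (h : ∀ z : Circle, ‖φ z‖ ≤ χ z) :
    ‖Real.circleAverage φ 0 1‖ ≤ Real.circleAverage χ 0 1 := by
  have hpi := Real.pi_pos
  rw [Real.circleAverage_def, Real.circleAverage_def, norm_smul, smul_eq_mul, Real.norm_eq_abs,
    abs_of_pos (by positivity)]
  apply mul_le_mul_of_nonneg_left _ (by positivity)
  apply intervalIntegral.norm_integral_le_of_norm_le (by positivity) _ hχ
  refine Eventually.of_forall fun θ _ => ?_
  rw [circleMap_zero_one]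
  exact h _

theorem continuous_circleMap_kernel {w : ℂ} (hw : w ∈ ball (0 : ℂ) 1) (k : ℕ) (P : ℂ → ℂ)
    (hP : Continuous P) :
    Continuous fun θ : ℝ => P (circleMap 0 1 θ) / (circleMap 0 1 θ - w) ^ k := by
  apply Continuous.div (hP.comp (continuous_circleMap 0 1)) (by fun_prop)
  intro θ
  exact pow_ne_zero _ (sub_ne_zero.2 (circleMap_ne_mem_ball hw θ))

/-! ## The Schwarz integral -/

/-- The Schwarz integral of `f`: the holomorphic function on the disc whose real part is the
Poisson integral of `f` and whose value at `0` is real. -/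
def schwarz (f : Circle → ℝ) (w : ℂ) : ℂ :=
  Real.circleAverage (fun ζ => herglotzRieszKernel 0 w ζ • ((onPlane f ζ : ℝ) : ℂ)) 0 1

theorem circleIntegrable_ofReal_onPlane {f : Circle → ℝ} (hf : Continuous f) :
    CircleIntegrable (fun ζ => ((onPlane f ζ : ℝ) : ℂ)) 0 1 :=
  circleIntegrable_onPlane (f := fun z => (f z : ℂ)) (Complex.continuous_ofReal.comp hf)

theorem circleIntegrable_div_pow_smul {f : Circle → ℝ} (hf : Continuous f) {w : ℂ}
    (hw : w ∈ ball (0 : ℂ) 1) (k : ℕ) (P : ℂ → ℂ) (hP : Continuous P) :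
    CircleIntegrable (fun ζ => (P ζ / (ζ - w) ^ k) • ((onPlane f ζ : ℝ) : ℂ)) 0 1 := by
  apply circleIntegrable_of_continuous
  simp only [onPlane_circleMap, smul_eq_mul]
  exact (continuous_circleMap_kernel hw k P hP).mul
    (Complex.continuous_ofReal.comp (hf.comp Circle.exp.continuous))

theorem herglotz_eq (w ζ : ℂ) : herglotzRieszKernel 0 w ζ = (ζ + w) / (ζ - w) ^ 1 := by
  simp [herglotzRieszKernel_def]

theorem circleIntegrable_schwarz {f : Circle → ℝ} (hf : Continuous f) {w : ℂ}
    (hw : w ∈ ball (0 : ℂ) 1) :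
    CircleIntegrable (fun ζ => herglotzRieszKernel 0 w ζ • ((onPlane f ζ : ℝ) : ℂ)) 0 1 := by
  simp only [herglotz_eq]
  exact circleIntegrable_div_pow_smul hf hw 1 (fun ζ => ζ + w) (by fun_prop)

theorem hasDerivAt_schwarz {f : Circle → ℝ} (hf : Continuous f) {w : ℂ}
    (hw : w ∈ ball (0 : ℂ) 1) :
    HasDerivAt (schwarz f)
      (Real.circleAverage (fun ζ => (2 * ζ / (ζ - w) ^ 2) • ((onPlane f ζ : ℝ) : ℂ)) 0 1) w :=
  hasDerivAt_circleAverage_herglotzRieszKernel_smul (circleIntegrable_ofReal_onPlane hf) hw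

theorem differentiableOn_schwarz {f : Circle → ℝ} (hf : Continuous f) :
    DifferentiableOn ℂ (schwarz f) (ball 0 1) := fun _ hw =>
  (hasDerivAt_schwarz hf hw).differentiableAt.differentiableWithinAt

/-- The substitution `ζ ↦ ζ⁻¹` preserves circle averages and turns the kernel into `(1 + w z) / (1 -
w z)`, holomorphic near the closed disc with value `1` at `0`; the mean value property concludes. -/
theorem circleAverage_herglotz {w : ℂ} (hw : w ∈ ball (0 : ℂ) 1) :
    Real.circleAverage (fun ζ => herglotzRieszKernel 0 w ζ) 0 1 = 1 := by
  have hw' : ‖w‖ < 1 := by simpa using hw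
  have h1 := Real.circleAverage_zero_one_congr_inv (f := fun ζ => herglotzRieszKernel 0 w ζ)
  rw [← h1]
  have hne : ∀ z ∈ closedBall (0 : ℂ) 1, 1 - w * z ≠ 0 := by
    intro z hz h
    rw [mem_closedBall_zero_iff] at hz
    have h2 : ‖w * z‖ = 1 := by rw [← sub_eq_zero.1 h, norm_one]
    rw [norm_mul] at h2
    nlinarith [norm_nonneg w, norm_nonneg z]
  have h2 : Real.circleAverage (fun z => herglotzRieszKernel 0 w z⁻¹) 0 1 =
      Real.circleAverage (fun z => (1 + w * z) / (1 - w * z)) 0 1 := by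
    apply circleAverage_congr_circle
    intro z
    have hz : (z : ℂ) ≠ 0 := z.coe_ne_zero
    rw [herglotzRieszKernel_def, sub_zero, sub_zero]
    rw [← mul_div_mul_left _ _ hz, mul_add, mul_sub, mul_inv_cancel₀ hz, mul_comm (z : ℂ) w]
  rw [h2]
  have h3 : DiffContOnCl ℂ (fun z : ℂ => (1 + w * z) / (1 - w * z)) (ball 0 |1|) := by
    rw [abs_one]
    apply DifferentiableOn.diffContOnCl
    rw [closure_ball _ one_ne_zero]
    exact DifferentiableOn.div (by fun_prop) (by fun_prop) hne
  rw [h3.circleAverage]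
  simp

theorem schwarz_const (c : ℝ) {w : ℂ} (hw : w ∈ ball (0 : ℂ) 1) :
    schwarz (fun _ => c) w = c := by
  have h := circleAverage_herglotz hw
  have : schwarz (fun _ => c) w =
      Real.circleAverage ((c : ℂ) • fun ζ => herglotzRieszKernel 0 w ζ) 0 1 := by
    apply circleAverage_congr_circle
    intro z
    simp [onPlane, mul_comm]
  rw [this, Real.circleAverage_smul, h, smul_eq_mul, mul_one]

theorem schwarz_add {f g : Circle → ℝ} (hf : Continuous f) (hg : Continuous g) {w : ℂ}
    (hw : w ∈ ball (0 : ℂ) 1) : schwarz (fun z => f z + g z) w = schwarz f w + schwarz g w := by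
  rw [schwarz, schwarz, schwarz, ← Real.circleAverage_fun_add (circleIntegrable_schwarz hf hw)
    (circleIntegrable_schwarz hg hw)]
  apply circleAverage_congr_circle
  intro z
  simp [mul_add]

theorem schwarz_smul (c : ℝ) (f : Circle → ℝ) (w : ℂ) :
    schwarz (fun z => c * f z) w = c * schwarz f w := by
  rw [schwarz, schwarz, ← smul_eq_mul (c : ℂ), ← Real.circleAverage_fun_smul]
  apply circleAverage_congr_circle
  intro z
  simp only [onPlane_coe, smul_eq_mul]
  push_cast
  ring

theorem schwarz_sub_const {f : Circle → ℝ} (hf : Continuous f) (c : ℝ) {w : ℂ}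
    (hw : w ∈ ball (0 : ℂ) 1) : schwarz (fun z => f z - c) w = schwarz f w - c := by
  have := schwarz_add hf (continuous_const : Continuous fun _ : Circle => -c) hw
  rw [schwarz_const _ hw] at this
  simpa [sub_eq_add_neg] using this

theorem schwarz_zero_eq {f : Circle → ℝ} (hf : Continuous f) :
    schwarz f 0 = (Real.circleAverage (onPlane f) 0 1 : ℝ) := by
  have h1 := Complex.ofRealCLM.circleAverage_comp_comm (circleIntegrable_onPlane hf)
  rw [Complex.ofRealCLM_apply] at h1
  rw [← h1]
  apply circleAverage_congr_circle
  intro z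
  simp [herglotzRieszKernel_def]

theorem re_schwarz {f : Circle → ℝ} (hf : Continuous f) {w : ℂ} (hw : w ∈ ball (0 : ℂ) 1) :
    (schwarz f w).re = Real.circleAverage (poissonKernel 0 w • onPlane f) 0 1 := by
  rw [schwarz, re_circleAverage_herglotzRieszKernel_smul (circleIntegrable_onPlane hf) hw,
    poissonKernel_eq_re_herglotzRieszKernel]

/-- The constant in the interior derivative estimate for Schwarz integrals. -/
def derivConst (β : ℝ) : ℝ := 4 * ((2 * Real.pi) ^ (2 - β) / (1 - β))

theorem derivConst_nonneg {β : ℝ} (hβ1 : β < 1) : 0 ≤ derivConst β := by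
  have h1 : 0 < 1 - β := by linarith
  have h2 := Real.pi_pos
  unfold derivConst
  positivity

/-! ### Boundary regularity of the Schwarz integral of a Hölder function. -/

section Holder

variable {β A : ℝ} {f : Circle → ℝ}

theorem circleIntegrable_norm_sub_rpow {w : ℂ} (hw : w ∈ ball (0 : ℂ) 1) (s : ℝ) :
    CircleIntegrable (fun ζ => ‖ζ - w‖ ^ s) 0 1 :=
  circleIntegrable_of_continuous (continuous_norm_circleMap_sub_rpow hw s)

/-- Comparing `f` with its value at the radial projection of `w` weakens the kernel singularity from
`‖ζ - w‖ ^ (-2)` to `‖ζ - w‖ ^ (β - 2)`, whose average is controlled by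
`circleAverage_norm_sub_rpow_le`. The factor `2` bounds the `2 ^ β` produced by the projection. -/
theorem holder_numerator_le (hβ0 : 0 < β) (hβ1 : β < 1) (hA : 0 ≤ A)
    (hf : ∀ z w : Circle, |f z - f w| ≤ A * ‖(z : ℂ) - w‖ ^ β) {w : ℂ} (hw : w ∈ ball (0 : ℂ) 1)
    {z : Circle} (hz : w = ‖w‖ * z) (ζ : Circle) :
    |f ζ - f z| / ‖(ζ : ℂ) - w‖ ^ 2 ≤ 2 * A * ‖(ζ : ℂ) - w‖ ^ (β - 2) := by
  have hw' : ‖w‖ < 1 := by simpa using hw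
  have hpos : 0 < ‖(ζ : ℂ) - w‖ := by
    rw [norm_pos_iff, sub_ne_zero]
    rintro rfl
    simp [Circle.norm_coe] at hw'
  have h1 := norm_sub_radial_le hw'.le ζ.norm_coe hz z.norm_coe
  rw [div_le_iff₀ (by positivity)]
  have h2 : ‖(ζ : ℂ) - z‖ ^ β ≤ 2 * ‖(ζ : ℂ) - w‖ ^ β := by
    calc ‖(ζ : ℂ) - z‖ ^ β ≤ (2 * ‖(ζ : ℂ) - w‖) ^ β :=
          Real.rpow_le_rpow (norm_nonneg _) h1 hβ0.le
      _ = 2 ^ β * ‖(ζ : ℂ) - w‖ ^ β := Real.mul_rpow (by norm_num) hpos.le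
      _ ≤ 2 * ‖(ζ : ℂ) - w‖ ^ β := by
          apply mul_le_mul_of_nonneg_right _ (by positivity)
          calc (2 : ℝ) ^ β ≤ 2 ^ (1 : ℝ) :=
                Real.rpow_le_rpow_of_exponent_le (by norm_num) hβ1.le
            _ = 2 := Real.rpow_one 2
  have h3 : ‖(ζ : ℂ) - w‖ ^ (β - 2) * ‖(ζ : ℂ) - w‖ ^ 2 = ‖(ζ : ℂ) - w‖ ^ β := by
    rw [← Real.rpow_natCast, ← Real.rpow_add hpos]
    norm_num
  calc |f ζ - f z| ≤ A * ‖(ζ : ℂ) - z‖ ^ β := hf ζ z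
    _ ≤ A * (2 * ‖(ζ : ℂ) - w‖ ^ β) := mul_le_mul_of_nonneg_left h2 hA
    _ = 2 * A * ‖(ζ : ℂ) - w‖ ^ (β - 2) * ‖(ζ : ℂ) - w‖ ^ 2 := by rw [mul_assoc, h3]; ring

/-- Subtracting the constant `f z` does not change the derivative, because the Schwarz integral of a
constant is constant. This is the hypothesis of the Hardy–Littlewood criterion. -/
theorem norm_deriv_schwarz_le (hβ0 : 0 < β) (hβ1 : β < 1) (hA : 0 ≤ A) (hfc : Continuous f)
    (hf : ∀ z w : Circle, |f z - f w| ≤ A * ‖(z : ℂ) - w‖ ^ β) {w : ℂ}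
    (hw : w ∈ ball (0 : ℂ) 1) :
    ‖deriv (schwarz f) w‖ ≤ derivConst β * A * (1 - ‖w‖) ^ (β - 1) := by
  obtain ⟨z, hz⟩ := exists_radial w
  have hfc' : Continuous fun ζ => f ζ - f z := hfc.sub continuous_const
  have h1 : deriv (schwarz f) w = deriv (schwarz fun ζ => f ζ - f z) w := by
    have : (schwarz fun ζ => f ζ - f z) =ᶠ[𝓝 w] fun w => schwarz f w - f z := by
      filter_upwards [isOpen_ball.mem_nhds hw] with v hv
      exact schwarz_sub_const hfc _ hv
    rw [this.deriv_eq, deriv_sub_const]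
  rw [h1, (hasDerivAt_schwarz hfc' hw).deriv]
  have h2 := norm_circleAverage_le
    (φ := fun ζ => (2 * ζ / (ζ - w) ^ 2) • ((onPlane (fun ζ => f ζ - f z) ζ : ℝ) : ℂ))
    (((circleIntegrable_norm_sub_rpow hw (β - 2)).const_smul (a := 4 * A))) (fun ζ => ?_)
  · refine h2.trans ?_
    rw [Real.circleAverage_smul, smul_eq_mul]
    have h3 := mul_le_mul_of_nonneg_left (circleAverage_norm_sub_rpow_le hβ1 hw)
      (by positivity : 0 ≤ 4 * A)
    refine h3.trans (le_of_eq ?_)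
    rw [derivConst]
    ring
  · have h3 := holder_numerator_le hβ0 hβ1 hA hf hw hz ζ
    rw [onPlane_coe, norm_smul, norm_div, norm_mul, norm_pow, Circle.norm_coe, Complex.norm_real,
      Real.norm_eq_abs, Complex.norm_ofNat, mul_one, Pi.smul_apply, smul_eq_mul]
    calc 2 / ‖(ζ : ℂ) - w‖ ^ 2 * |f ζ - f z| = 2 * (|f ζ - f z| / ‖(ζ : ℂ) - w‖ ^ 2) := by ring
      _ ≤ 2 * (2 * A * ‖(ζ : ℂ) - w‖ ^ (β - 2)) := by linarith
      _ = _ := by ring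

/-- The numerator of the Poisson kernel is at most `2 (1 - ‖w‖)`, one power better than in the
derivative estimate. The resulting rate of convergence identifies the boundary values of the real
part. -/
theorem abs_re_schwarz_sub_le (hβ0 : 0 < β) (hβ1 : β < 1) (hA : 0 ≤ A) (hfc : Continuous f)
    (hf : ∀ z w : Circle, |f z - f w| ≤ A * ‖(z : ℂ) - w‖ ^ β) {w : ℂ}
    (hw : w ∈ ball (0 : ℂ) 1) {z : Circle} (hz : w = ‖w‖ * z) :
    |(schwarz f w).re - f z| ≤ derivConst β * A * (1 - ‖w‖) ^ β := by
  have hw' : ‖w‖ < 1 := by simpa using hw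
  have hfc' : Continuous fun ζ => f ζ - f z := hfc.sub continuous_const
  have h1 : (schwarz f w).re - f z = (schwarz (fun ζ => f ζ - f z) w).re := by
    rw [schwarz_sub_const hfc _ hw]
    simp
  rw [h1, re_schwarz hfc' hw, ← Real.norm_eq_abs]
  have h2 := norm_circleAverage_le
    (φ := poissonKernel 0 w • onPlane (fun ζ => f ζ - f z))
    (((circleIntegrable_norm_sub_rpow hw (β - 2)).const_smul (a := 2 * (1 - ‖w‖) * (2 * A))))
    (fun ζ => ?_)
  · refine h2.trans ?_
    rw [Real.circleAverage_smul, smul_eq_mul]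
    have h3 := mul_le_mul_of_nonneg_left (circleAverage_norm_sub_rpow_le hβ1 hw)
      (by have : 0 ≤ 1 - ‖w‖ := by linarith
          positivity : 0 ≤ 2 * (1 - ‖w‖) * (2 * A))
    refine h3.trans (le_of_eq ?_)
    have h4 : (1 - ‖w‖) ^ β = (1 - ‖w‖) * (1 - ‖w‖) ^ (β - 1) := by
      rw [mul_comm, ← Real.rpow_add_one (by linarith)]
      norm_num
    rw [derivConst, h4]
    ring
  · have h3 := holder_numerator_le hβ0 hβ1 hA hf hw hz ζ
    rw [Pi.smul_apply', Pi.smul_apply, onPlane_coe, smul_eq_mul, smul_eq_mul, norm_mul,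
      poissonKernel_def, sub_zero, sub_zero, Circle.norm_coe, norm_div, norm_pow, norm_norm,
      Real.norm_eq_abs, Real.norm_eq_abs,
      abs_of_nonneg (by nlinarith [norm_nonneg w] : (0 : ℝ) ≤ 1 ^ 2 - ‖w‖ ^ 2)]
    have h5 : (1 : ℝ) ^ 2 - ‖w‖ ^ 2 ≤ 2 * (1 - ‖w‖) := by nlinarith [norm_nonneg w]
    calc (1 ^ 2 - ‖w‖ ^ 2) / ‖(ζ : ℂ) - w‖ ^ 2 * |f ζ - f z|
        = (1 ^ 2 - ‖w‖ ^ 2) * (|f ζ - f z| / ‖(ζ : ℂ) - w‖ ^ 2) := by ring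
      _ ≤ 2 * (1 - ‖w‖) * (2 * A * ‖(ζ : ℂ) - w‖ ^ (β - 2)) :=
          mul_le_mul h5 h3 (by positivity) (by linarith)
      _ = _ := by ring

theorem norm_schwarz_sub_le (hβ0 : 0 < β) (hβ1 : β < 1) (hA : 0 ≤ A) (hfc : Continuous f)
    (hf : ∀ z w : Circle, |f z - f w| ≤ A * ‖(z : ℂ) - w‖ ^ β) {z w : ℂ}
    (hz : z ∈ ball (0 : ℂ) 1) (hw : w ∈ ball (0 : ℂ) 1) :
    ‖schwarz f z - schwarz f w‖ ≤ derivConst β * A * (1 + 2 / β) * ‖z - w‖ ^ β :=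
  norm_sub_le_of_deriv_le hβ0 hβ1 (mul_nonneg (derivConst_nonneg hβ1) hA)
    (differentiableOn_schwarz hfc) (fun _ hv => norm_deriv_schwarz_le hβ0 hβ1 hA hfc hf hv) hz hw

/-- The continuous extension of the Schwarz integral to the closed disc. -/
def schwarzExt (f : Circle → ℝ) : ℂ → ℂ := extendFrom (ball 0 1) (schwarz f)

theorem exists_tendsto_schwarz (hβ0 : 0 < β) (hβ1 : β < 1) (hA : 0 ≤ A) (hfc : Continuous f)
    (hf : ∀ z w : Circle, |f z - f w| ≤ A * ‖(z : ℂ) - w‖ ^ β) {z : ℂ}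
    (hz : z ∈ closedBall (0 : ℂ) 1) :
    ∃ y, Tendsto (schwarz f) (𝓝[ball 0 1] z) (𝓝 y) := by
  have huc : UniformContinuousOn (schwarz f) (ball 0 1) := by
    rw [Metric.uniformContinuousOn_iff]
    intro ε hε
    have hK : 0 ≤ derivConst β * A * (1 + 2 / β) :=
      mul_nonneg (mul_nonneg (derivConst_nonneg hβ1) hA) (by positivity)
    have ht : Tendsto (fun t : ℝ => derivConst β * A * (1 + 2 / β) * t ^ β) (𝓝[≥] 0) (𝓝 0) := by
      have h1 : ContinuousAt (fun t : ℝ => derivConst β * A * (1 + 2 / β) * t ^ β) 0 :=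
        continuousAt_const.mul (Real.continuousAt_rpow_const 0 β (Or.inr hβ0.le))
      have h2 := h1.tendsto
      simp only [Real.zero_rpow hβ0.ne', mul_zero] at h2
      exact h2.mono_left nhdsWithin_le_nhds
    have h3 := ht.eventually (gt_mem_nhds hε)
    rw [eventually_nhdsWithin_iff, Metric.eventually_nhds_iff] at h3
    obtain ⟨δ, hδ, h4⟩ := h3
    refine ⟨δ, hδ, fun a ha b hb hab => ?_⟩
    rw [dist_eq_norm]
    refine (norm_schwarz_sub_le hβ0 hβ1 hA hfc hf ha hb).trans_lt ?_
    rw [dist_eq_norm] at hab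
    exact h4 (by simpa using hab) (norm_nonneg _)
  have hne : (𝓝[ball 0 1] z).NeBot := by
    rw [← mem_closure_iff_nhdsWithin_neBot, closure_ball _ one_ne_zero]
    exact hz
  have hcau : Cauchy (map (schwarz f) (𝓝[ball 0 1] z)) := by
    apply Cauchy.map_of_le (cauchy_nhds.mono nhdsWithin_le_nhds) huc
    exact le_principal_iff.2 self_mem_nhdsWithin
  exact CompleteSpace.complete hcau

theorem schwarzExt_eqOn (hfc : Continuous f) {z : ℂ} (hz : z ∈ ball (0 : ℂ) 1) :
    schwarzExt f z = schwarz f z :=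
  extendFrom_extends (differentiableOn_schwarz hfc).continuousOn z hz

theorem continuousOn_schwarzExt (hβ0 : 0 < β) (hβ1 : β < 1) (hA : 0 ≤ A) (hfc : Continuous f)
    (hf : ∀ z w : Circle, |f z - f w| ≤ A * ‖(z : ℂ) - w‖ ^ β) :
    ContinuousOn (schwarzExt f) (closedBall 0 1) := by
  apply continuousOn_extendFrom
  · rw [closure_ball _ one_ne_zero]
  · exact fun z hz => exists_tendsto_schwarz hβ0 hβ1 hA hfc hf hz

theorem diffContOnCl_schwarzExt (hβ0 : 0 < β) (hβ1 : β < 1) (hA : 0 ≤ A) (hfc : Continuous f)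
    (hf : ∀ z w : Circle, |f z - f w| ≤ A * ‖(z : ℂ) - w‖ ^ β) :
    DiffContOnCl ℂ (schwarzExt f) (ball 0 1) := by
  refine ⟨(differentiableOn_schwarz hfc).congr fun z hz => schwarzExt_eqOn hfc hz, ?_⟩
  rw [closure_ball _ one_ne_zero]
  exact continuousOn_schwarzExt hβ0 hβ1 hA hfc hf

theorem norm_schwarzExt_sub_le (hβ0 : 0 < β) (hβ1 : β < 1) (hA : 0 ≤ A) (hfc : Continuous f)
    (hf : ∀ z w : Circle, |f z - f w| ≤ A * ‖(z : ℂ) - w‖ ^ β) {z w : ℂ}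
    (hz : z ∈ closedBall (0 : ℂ) 1) (hw : w ∈ closedBall (0 : ℂ) 1) :
    ‖schwarzExt f z - schwarzExt f w‖ ≤ derivConst β * A * (1 + 2 / β) * ‖z - w‖ ^ β := by
  have hc := continuousOn_schwarzExt hβ0 hβ1 hA hfc hf
  have h0 : ∀ p ∈ ball (0 : ℂ) 1 ×ˢ ball (0 : ℂ) 1, ‖schwarzExt f p.1 - schwarzExt f p.2‖ ≤
      derivConst β * A * (1 + 2 / β) * ‖p.1 - p.2‖ ^ β := by
    rintro ⟨a, b⟩ ⟨ha, hb⟩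
    rw [schwarzExt_eqOn hfc ha, schwarzExt_eqOn hfc hb]
    exact norm_schwarz_sub_le hβ0 hβ1 hA hfc hf ha hb
  have hcl : closure (ball (0 : ℂ) 1 ×ˢ ball (0 : ℂ) 1) =
      closedBall (0 : ℂ) 1 ×ˢ closedBall (0 : ℂ) 1 := by
    rw [closure_prod_eq, closure_ball _ one_ne_zero]
  have hmem : (z, w) ∈ closure (ball (0 : ℂ) 1 ×ˢ ball (0 : ℂ) 1) := by
    rw [hcl]
    exact ⟨hz, hw⟩
  have h1 : ContinuousWithinAt (fun p : ℂ × ℂ => ‖schwarzExt f p.1 - schwarzExt f p.2‖)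
      (ball (0 : ℂ) 1 ×ˢ ball (0 : ℂ) 1) (z, w) := by
    have h1 : ContinuousOn (fun p : ℂ × ℂ => ‖schwarzExt f p.1 - schwarzExt f p.2‖)
        (closedBall (0 : ℂ) 1 ×ˢ closedBall (0 : ℂ) 1) :=
      ((hc.comp continuousOn_fst fun p hp => hp.1).sub
        (hc.comp continuousOn_snd fun p hp => hp.2)).norm
    exact (h1 (z, w) ⟨hz, hw⟩).mono
      (prod_mono ball_subset_closedBall ball_subset_closedBall)
  have h2 : Continuous fun p : ℂ × ℂ => derivConst β * A * (1 + 2 / β) * ‖p.1 - p.2‖ ^ β := by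
    apply continuous_const.mul
    exact Continuous.rpow_const (by fun_prop) fun _ => Or.inr hβ0.le
  exact ContinuousWithinAt.closure_le hmem h1 h2.continuousWithinAt h0

theorem tendsto_radial {F : ℂ → ℂ} (hF : ContinuousOn F (closedBall 0 1)) (z : Circle) :
    Tendsto (fun r : ℝ => F ((r : ℂ) * z)) (𝓝[<] 1) (𝓝 (F z)) := by
  have h1 : ContinuousWithinAt F (closedBall 0 1) ((1 : ℝ) * (z : ℂ)) := by
    apply hF
    simp [Circle.norm_coe]
  have h2 : Tendsto (fun r : ℝ => (r : ℂ) * z) (𝓝[<] 1) (𝓝[closedBall 0 1] ((1 : ℝ) * (z : ℂ))) := by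
    apply tendsto_nhdsWithin_of_tendsto_nhds_of_eventually_within
    · have : Continuous fun r : ℝ => (r : ℂ) * z := by fun_prop
      exact (this.tendsto 1).mono_left nhdsWithin_le_nhds
    · filter_upwards [Ioo_mem_nhdsLT (zero_lt_one' ℝ)] with r hr
      simp [abs_of_pos hr.1, hr.2.le, Circle.norm_coe]
  have h3 := h1.tendsto.comp h2
  simpa [Function.comp_def] using h3

theorem re_schwarzExt_coe (hβ0 : 0 < β) (hβ1 : β < 1) (hA : 0 ≤ A) (hfc : Continuous f)
    (hf : ∀ z w : Circle, |f z - f w| ≤ A * ‖(z : ℂ) - w‖ ^ β) (z : Circle) :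
    (schwarzExt f z).re = f z := by
  have h1 := (Complex.continuous_re.tendsto _).comp
    (tendsto_radial (continuousOn_schwarzExt hβ0 hβ1 hA hfc hf) z)
  refine tendsto_nhds_unique h1 ?_
  have h2 : Tendsto (fun r : ℝ => derivConst β * A * (1 - r) ^ β) (𝓝[<] 1) (𝓝 0) := by
    have h3 : ContinuousAt (fun r : ℝ => derivConst β * A * (1 - r) ^ β) 1 :=
      continuousAt_const.mul (ContinuousAt.rpow_const (by fun_prop) (Or.inr hβ0.le))
    have h4 := h3.tendsto
    simp only [sub_self, Real.zero_rpow hβ0.ne', mul_zero] at h4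
    exact h4.mono_left nhdsWithin_le_nhds
  rw [tendsto_iff_dist_tendsto_zero]
  refine squeeze_zero' (Eventually.of_forall fun _ => dist_nonneg) ?_ h2
  filter_upwards [Ioo_mem_nhdsLT (zero_lt_one' ℝ)] with r hr
  have hn : ‖(r : ℂ) * z‖ = r := by simp [abs_of_pos hr.1, Circle.norm_coe]
  have hm : (r : ℂ) * z ∈ ball (0 : ℂ) 1 := by
    rw [mem_ball_zero_iff, hn]
    exact hr.2
  have h5 := abs_re_schwarz_sub_le hβ0 hβ1 hA hfc hf hm (z := z) (by rw [hn])
  rw [hn] at h5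
  rw [Real.dist_eq]
  simp only [Function.comp_apply]
  rw [schwarzExt_eqOn hfc hm]
  exact h5

end Holder

/-! ## Uniqueness for the Dirichlet problem and for Schwarz integrals -/

theorem closure_unitBall : closure (ball (0 : ℂ) 1) = closedBall 0 1 :=
  closure_ball _ one_ne_zero

theorem Circle_mem_closedBall (z : Circle) : (z : ℂ) ∈ closedBall (0 : ℂ) 1 := by
  simp [Circle.norm_coe]

theorem mem_ball_or_exists_circle {w : ℂ} (hw : w ∈ closedBall (0 : ℂ) 1) :
    w ∈ ball (0 : ℂ) 1 ∨ ∃ z : Circle, w = z := by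
  rw [← ball_union_sphere] at hw
  exact hw.imp_right exists_circle_of_mem_sphere

theorem eqOn_closedBall_of_eq_circle {u v : ℂ → ℝ} (hu : HarmonicContOnCl u (ball 0 1))
    (hv : HarmonicContOnCl v (ball 0 1)) (h : ∀ z : Circle, u z = v z) :
    EqOn u v (closedBall 0 1) := by
  intro w hw
  rcases mem_ball_or_exists_circle hw with hw | ⟨z, rfl⟩
  · rw [← hu.circleAverage_poissonKernel_smul hw, ← hv.circleAverage_poissonKernel_smul hw]
    apply circleAverage_congr_circle
    intro z
    simp [h z]
  · exact h z

theorem harmonicContOnCl_re {G : ℂ → ℂ} (hG : DiffContOnCl ℂ G (ball 0 1)) :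
    HarmonicContOnCl (fun z => (G z).re) (ball 0 1) :=
  ⟨fun _ hx => (hG.differentiableOn.analyticAt (isOpen_ball.mem_nhds hx)).harmonicAt_re,
    Complex.continuous_re.comp_continuousOn hG.continuousOn⟩

theorem harmonicContOnCl_im {G : ℂ → ℂ} (hG : DiffContOnCl ℂ G (ball 0 1)) :
    HarmonicContOnCl (fun z => (G z).im) (ball 0 1) :=
  ⟨fun _ hx => (hG.differentiableOn.analyticAt (isOpen_ball.mem_nhds hx)).harmonicAt_im,
    Complex.continuous_im.comp_continuousOn hG.continuousOn⟩

/-- The real parts agree by Poisson's formula; a holomorphic function with constant real part is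
constant, and the value at `0` fixes the constant. Conjugate functions are computed below by
exhibiting a suitable `G`. -/
theorem schwarz_unique {f : Circle → ℝ} (hf : Continuous f) {G : ℂ → ℂ}
    (hG : DiffContOnCl ℂ G (ball 0 1)) (hre : ∀ z : Circle, (G z).re = f z)
    (him : (G 0).im = 0) : EqOn G (schwarz f) (ball 0 1) := by
  have hd := differentiableOn_schwarz hf
  have hre' : ∀ w ∈ ball (0 : ℂ) 1, (G w - schwarz f w).re = 0 := by
    intro w hw
    rw [Complex.sub_re, re_schwarz hf hw,
      ← (harmonicContOnCl_re hG).circleAverage_poissonKernel_smul hw, sub_eq_zero]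
    apply circleAverage_congr_circle
    intro z
    simp [hre z]
  have h0 : (0 : ℂ) ∈ ball (0 : ℂ) 1 := by simp
  obtain ⟨c, hc⟩ := AnalyticOnNhd.eq_const_of_re_eq_const
    ((hG.differentiableOn.sub hd).analyticOnNhd isOpen_ball) hre' isOpen_ball
    ((convex_ball (0 : ℂ) 1).isConnected ⟨0, h0⟩)
  have hc0 : c = 0 := by
    apply Complex.ext
    · rw [← hc 0 h0]
      exact hre' 0 h0
    · rw [← hc 0 h0]
      simp [him, schwarz_zero_eq hf]
  intro w hw
  have := hc w hw
  rw [hc0] at this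
  exact sub_eq_zero.1 this

/-! ## Hölder functions on the circle -/

theorem Circle_dist (z w : Circle) : dist z w = ‖(z : ℂ) - w‖ := by
  rw [← dist_eq_norm]
  rfl

theorem holderWith_of_abs_sub_le {β C : ℝ≥0} {f : Circle → ℝ}
    (h : ∀ z w : Circle, |f z - f w| ≤ C * ‖(z : ℂ) - w‖ ^ (β : ℝ)) : HolderWith C β f := by
  intro z w
  rw [edist_dist, edist_dist, ENNReal.ofReal_rpow_of_nonneg dist_nonneg β.coe_nonneg,
    ← ENNReal.ofReal_coe_nnreal, ← ENNReal.ofReal_mul C.coe_nonneg]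
  apply ENNReal.ofReal_le_ofReal
  rw [Real.dist_eq, Circle_dist]
  exact h z w

/-- Chords have length at most `2`, and `2 ^ (1 - β) ≤ 2`. Lipschitz bounds thus become Hölder
bounds at the cost of a factor `2`. -/
theorem norm_circle_sub_le {β : ℝ≥0} (hβ0 : 0 < β) (hβ1 : β < 1) (z w : Circle) :
    ‖(z : ℂ) - w‖ ≤ 2 * ‖(z : ℂ) - w‖ ^ (β : ℝ) := by
  have hβ1' : (β : ℝ) < 1 := by exact_mod_cast hβ1
  have hβ0' : 0 < (β : ℝ) := by exact_mod_cast hβ0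
  rcases (norm_nonneg ((z : ℂ) - w)).eq_or_lt with h | h
  · rw [← h, Real.zero_rpow hβ0'.ne', mul_zero]
  · have h2 : ‖(z : ℂ) - w‖ ≤ 2 := by
      have := norm_sub_le (z : ℂ) w
      rw [z.norm_coe, w.norm_coe] at this
      linarith
    calc ‖(z : ℂ) - w‖ = ‖(z : ℂ) - w‖ ^ (1 - (β : ℝ)) * ‖(z : ℂ) - w‖ ^ (β : ℝ) := by
          rw [← Real.rpow_add h]
          simp
      _ ≤ 2 ^ (1 : ℝ) * ‖(z : ℂ) - w‖ ^ (β : ℝ) := by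
          apply mul_le_mul_of_nonneg_right _ (by positivity)
          exact (Real.rpow_le_rpow h.le h2 (by linarith)).trans
            (Real.rpow_le_rpow_of_exponent_le (by norm_num) (by linarith))
      _ = _ := by rw [Real.rpow_one]

namespace CHolder

variable {β : ℝ≥0}

theorem continuous (f : CHolder β) : Continuous f := f.1.continuous

theorem abs_apply_le (f : CHolder β) (z : Circle) : |f z| ≤ ‖f‖ := by
  rw [CHolder.norm_def]
  have h1 := f.1.norm_coe_le_norm z
  rw [Real.norm_eq_abs] at h1
  have h2 : (0 : ℝ) ≤ nnHolderNorm β f.1 := NNReal.coe_nonneg _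
  linarith

theorem abs_sub_le (f : CHolder β) (z w : Circle) :
    |f z - f w| ≤ ‖f‖ * ‖(z : ℂ) - w‖ ^ (β : ℝ) := by
  have h1 := (MemHolder.holderWith f.2).dist_le z w
  rw [Real.dist_eq, Circle_dist] at h1
  refine h1.trans (mul_le_mul_of_nonneg_right ?_ (by positivity))
  rw [CHolder.norm_def]
  have := norm_nonneg f.1
  linarith

/-- A function on the circle with a Hölder bound, as an element of `CHolder β`. -/
def ofBound (hβ0 : 0 < β) (f : Circle → ℝ)
    (h : ∃ C : ℝ≥0, ∀ z w : Circle, |f z - f w| ≤ C * ‖(z : ℂ) - w‖ ^ (β : ℝ)) : CHolder β :=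
  ⟨⟨f, (holderWith_of_abs_sub_le h.choose_spec).continuous hβ0⟩, h.imp fun _ hC =>
    holderWith_of_abs_sub_le hC⟩

@[simp]
theorem ofBound_apply (hβ0 : 0 < β) (f : Circle → ℝ)
    (h : ∃ C : ℝ≥0, ∀ z w : Circle, |f z - f w| ≤ C * ‖(z : ℂ) - w‖ ^ (β : ℝ)) (z : Circle) :
    ofBound hβ0 f h z = f z := rfl

theorem norm_le {f : CHolder β} {A B : ℝ} (hB : 0 ≤ B) (hA : ∀ z, |f z| ≤ A)
    (h : ∀ z w : Circle, |f z - f w| ≤ B * ‖(z : ℂ) - w‖ ^ (β : ℝ)) : ‖f‖ ≤ A + B := by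
  rw [CHolder.norm_def]
  have hA0 : 0 ≤ A := (abs_nonneg _).trans (hA 1)
  apply add_le_add
  · exact (ContinuousMap.norm_le _ hA0).2 hA
  · have h1 : HolderWith ⟨B, hB⟩ β f.1 := holderWith_of_abs_sub_le h
    have h2 := h1.nnholderNorm_le
    exact_mod_cast h2

theorem ext {f g : CHolder β} (h : ∀ z, f z = g z) : f = g :=
  Subtype.ext (ContinuousMap.ext h)

@[simp]
theorem add_apply (f g : CHolder β) (z : Circle) : (f + g) z = f z + g z := rfl

@[simp]
theorem smul_apply (c : ℝ) (f : CHolder β) (z : Circle) : (c • f) z = c * f z := rfl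

@[simp]
theorem neg_apply (f : CHolder β) (z : Circle) : (-f) z = -f z := rfl


theorem schwarzExt_diffContOnCl (hβ0 : 0 < β) (hβ1 : β < 1) (f : CHolder β) :
   
   
   
    DiffContOnCl ℂ (schwarzExt f) (ball 0 1) :=
  diffContOnCl_schwarzExt (β := β) (by exact_mod_cast hβ0) (by exact_mod_cast hβ1)
    (norm_nonneg f) f.continuous f.abs_sub_le

theorem re_schwarzExt (hβ0 : 0 < β) (hβ1 : β < 1) (f : CHolder β) (z : Circle) : (schwarzExt f z).re = f z :=
  re_schwarzExt_coe (β := β) (by exact_mod_cast hβ0) (by exact_mod_cast hβ1)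
    (norm_nonneg f) f.continuous f.abs_sub_le z

theorem norm_schwarzExt_sub (hβ0 : 0 < β) (hβ1 : β < 1) (f : CHolder β) {z w : ℂ} (hz : z ∈ closedBall (0 : ℂ) 1)
    (hw : w ∈ closedBall (0 : ℂ) 1) :
    ‖schwarzExt f z - schwarzExt f w‖ ≤
      derivConst β * ‖f‖ * (1 + 2 / β) * ‖z - w‖ ^ (β : ℝ) :=
  norm_schwarzExt_sub_le (β := β) (by exact_mod_cast hβ0) (by exact_mod_cast hβ1)
    (norm_nonneg f) f.continuous f.abs_sub_le hz hw

theorem schwarzExt_unique (hβ0 : 0 < β) (hβ1 : β < 1) (f : CHolder β) {G : ℂ → ℂ} (hG : DiffContOnCl ℂ G (ball 0 1))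
    (hre : ∀ z : Circle, (G z).re = f z) (him : (G 0).im = 0) :
    EqOn G (schwarzExt f) (closedBall 0 1) := by
  have h1 : EqOn G (schwarzExt f) (ball 0 1) := fun w hw => by
    rw [schwarz_unique f.continuous hG hre him hw, schwarzExt_eqOn f.continuous hw]
  rw [← closure_unitBall]
  exact h1.of_subset_closure hG.continuousOn
    (schwarzExt_diffContOnCl hβ0 hβ1 f).continuousOn subset_closure Subset.rfl

theorem schwarzExt_zero (f : CHolder β) :
    schwarzExt f 0 = (Real.circleAverage (onPlane f) 0 1 : ℝ) := by
  rw [schwarzExt_eqOn f.continuous (by simp), schwarz_zero_eq f.continuous]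

theorem im_schwarzExt_zero (f : CHolder β) : (schwarzExt f 0).im = 0 := by
  rw [schwarzExt_zero, Complex.ofReal_im]

end CHolder

theorem mem_CHolderDot_iff {β : ℝ≥0} {f : CHolder β} :
    f ∈ CHolderDot β ↔ Real.circleAverage (onPlane f) 0 1 = 0 := by
  have h : f ∈ CHolderDot β ↔ circleInt f = 0 := Iff.rfl
  rw [h, circleInt_eq_onPlane, mul_eq_zero]
  have := Real.pi_pos
  simp [this.ne']

theorem CHolderDot.ext {β : ℝ≥0} {f g : CHolderDot β} (h : ∀ z, f.1 z = g.1 z) : f = g :=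
  Subtype.ext (CHolder.ext h)

theorem circleAverage_onPlane_eq_of_harmonic {f : Circle → ℝ} {u : ℂ → ℝ}
    (hu : HarmonicContOnCl u (ball 0 1)) (h : ∀ z : Circle, u z = f z) :
    Real.circleAverage (onPlane f) 0 1 = u 0 := by
  have h1 : HarmonicContOnCl u (ball 0 |1|) := by rwa [abs_one]
  rw [← h1.circleAverage_eq]
  apply circleAverage_congr_circle
  intro z
  rw [onPlane_coe, h z]

/-! ### The conjugation operator on mean-zero Hölder functions. -/

section Conj

variable {β : ℝ≥0} (hβ0 : 0 < β) (hβ1 : β < 1)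

theorem derivConst_mul_nonneg {β : ℝ≥0} (hβ1 : β < 1) (A : ℝ) (hA : 0 ≤ A) :
    0 ≤ derivConst β * A * (1 + 2 / β) := by
  have := derivConst_nonneg (β := β) (by exact_mod_cast hβ1)
  positivity

/-- The conjugate function of `f`, i.e. the boundary values of the imaginary part of its Schwarz
integral (Privalov's theorem). -/
def conjFun (f : CHolder β) : CHolder β :=
  CHolder.ofBound hβ0 (fun z => (schwarzExt f z).im)
    ⟨⟨derivConst β * ‖f‖ * (1 + 2 / β), derivConst_mul_nonneg hβ1 _ (norm_nonneg f)⟩,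
      fun z w => by
        rw [← Complex.sub_im]
        exact (Complex.abs_im_le_norm _).trans (CHolder.norm_schwarzExt_sub hβ0 hβ1 f
          (Circle_mem_closedBall z) (Circle_mem_closedBall w))⟩

theorem conjFun_apply (f : CHolder β) (z : Circle) :
    conjFun hβ0 hβ1 f z = (schwarzExt f z).im := rfl

theorem conjFun_eq {f : CHolder β} {G : ℂ → ℂ} (hG : DiffContOnCl ℂ G (ball 0 1))
    (hre : ∀ z : Circle, (G z).re = f z) (him : (G 0).im = 0) (z : Circle) :
    conjFun hβ0 hβ1 f z = (G z).im := by
  rw [conjFun_apply, CHolder.schwarzExt_unique hβ0 hβ1 f hG hre him (Circle_mem_closedBall z)]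

/-- The Hölder estimate holds on the closed disc, so comparing a boundary point with the centre, at
distance `1` and with zero imaginary part, also bounds the supremum; hence the factor `2`. -/
theorem norm_conjFun_le (f : CHolder β) :
    ‖conjFun hβ0 hβ1 f‖ ≤ 2 * (derivConst β * (1 + 2 / β)) * ‖f‖ := by
  have h0 : (0 : ℂ) ∈ closedBall (0 : ℂ) 1 := by simp
  have h1 := CHolder.norm_le (f := conjFun hβ0 hβ1 f)
    (A := derivConst β * ‖f‖ * (1 + 2 / β))
    (derivConst_mul_nonneg hβ1 _ (norm_nonneg f)) (fun z => ?_) (fun z w => ?_)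
  · refine h1.trans (le_of_eq ?_)
    ring
  · have h2 := CHolder.norm_schwarzExt_sub hβ0 hβ1 f (Circle_mem_closedBall z) h0
    rw [sub_zero, Circle.norm_coe, Real.one_rpow, mul_one] at h2
    refine le_trans ?_ h2
    have h3 := Complex.abs_im_le_norm (schwarzExt f z - schwarzExt f 0)
    rwa [Complex.sub_im, CHolder.im_schwarzExt_zero, sub_zero] at h3
  · rw [conjFun_apply, conjFun_apply, ← Complex.sub_im]
    exact (Complex.abs_im_le_norm _).trans (CHolder.norm_schwarzExt_sub hβ0 hβ1 f
      (Circle_mem_closedBall z) (Circle_mem_closedBall w))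

theorem conjFun_mem (f : CHolder β) : conjFun hβ0 hβ1 f ∈ CHolderDot β := by
  rw [mem_CHolderDot_iff, circleAverage_onPlane_eq_of_harmonic
    (harmonicContOnCl_im (CHolder.schwarzExt_diffContOnCl hβ0 hβ1 f))
    (fun z => (conjFun_apply hβ0 hβ1 f z).symm), CHolder.im_schwarzExt_zero]

/-- The conjugation operator on `CHolderDot β`. -/
def hilbert : CHolderDot β →L[ℝ] CHolderDot β :=
  LinearMap.mkContinuous
    { toFun := fun f => ⟨conjFun hβ0 hβ1 f.1, conjFun_mem hβ0 hβ1 f.1⟩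
      map_add' := fun f g => by
        apply CHolderDot.ext
        intro z
        change conjFun hβ0 hβ1 (f.1 + g.1) z = conjFun hβ0 hβ1 f.1 z + conjFun hβ0 hβ1 g.1 z
        rw [conjFun_eq hβ0 hβ1 ((CHolder.schwarzExt_diffContOnCl hβ0 hβ1 f.1).add
          (CHolder.schwarzExt_diffContOnCl hβ0 hβ1 g.1))]
        · rfl
        · intro z
          simp [CHolder.re_schwarzExt hβ0 hβ1]
        · simp [CHolder.im_schwarzExt_zero]
      map_smul' := fun c f => by
        apply CHolderDot.ext
        intro z
        change conjFun hβ0 hβ1 (c • f.1) z = c * conjFun hβ0 hβ1 f.1 z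
        rw [conjFun_eq hβ0 hβ1 ((CHolder.schwarzExt_diffContOnCl hβ0 hβ1 f.1).const_smul (c : ℂ))]
        · simp [conjFun_apply]
        · intro z
          simp [CHolder.re_schwarzExt hβ0 hβ1]
        · simp [CHolder.im_schwarzExt_zero] }
    (2 * (derivConst β * (1 + 2 / β))) fun f => norm_conjFun_le hβ0 hβ1 f.1

theorem hilbert_apply (f : CHolderDot β) (z : Circle) :
    (hilbert hβ0 hβ1 f).1 z = (schwarzExt f.1 z).im := rfl

theorem hilbert_eq {f : CHolderDot β} {G : ℂ → ℂ} (hG : DiffContOnCl ℂ G (ball 0 1))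
    (hre : ∀ z : Circle, (G z).re = f.1 z) (him : (G 0).im = 0) (z : Circle) :
    (hilbert hβ0 hβ1 f).1 z = (G z).im := conjFun_eq hβ0 hβ1 hG hre him z

/-- If `F` is the Schwarz integral of `f`, then `-i F` has real part `Im F` and imaginary part `-Re
F`. Its imaginary part at `0` is minus the mean of `f`, so the zero mean is what makes it the
Schwarz integral of the conjugate function. -/
theorem hilbert_hilbert (f : CHolderDot β) : hilbert hβ0 hβ1 (hilbert hβ0 hβ1 f) = -f := by
  apply CHolderDot.ext
  intro z
  rw [hilbert_eq hβ0 hβ1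
    ((CHolder.schwarzExt_diffContOnCl hβ0 hβ1 f.1).const_smul (-Complex.I))]
  · simp [CHolder.re_schwarzExt hβ0 hβ1]
  · intro w
    simp [hilbert_apply]
  · simp [CHolder.schwarzExt_zero, mem_CHolderDot_iff.1 f.2]

/-! ### The first Fourier mode -/

theorem diffContOnCl_mul_id (c : ℂ) : DiffContOnCl ℂ (fun z : ℂ => c * z) (ball 0 1) :=
  (differentiable_id.const_mul c).diffContOnCl

/-- The function `z ↦ Re (c z)` on the circle. -/
def mode : ℂ →L[ℝ] CHolderDot β :=
  LinearMap.toContinuousLinearMap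
    { toFun := fun c => ⟨CHolder.ofBound hβ0 (fun z => (c * z).re) ⟨2 * ‖c‖₊, fun z w => by
          rw [← Complex.sub_re, ← mul_sub]
          refine (Complex.abs_re_le_norm _).trans ?_
          rw [norm_mul]
          have := mul_le_mul_of_nonneg_left (norm_circle_sub_le hβ0 hβ1 z w) (norm_nonneg c)
          push_cast
          linarith⟩, by
            have h := circleAverage_onPlane_eq_of_harmonic
              (harmonicContOnCl_re (diffContOnCl_mul_id c)) (fun z : Circle => rfl)
            rw [mul_zero, Complex.zero_re] at h
            exact mem_CHolderDot_iff.2 h⟩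
      map_add' := fun c d => by
        apply CHolderDot.ext
        intro z
        change ((c + d) * z : ℂ).re = (c * z : ℂ).re + (d * z : ℂ).re
        rw [add_mul, Complex.add_re]
      map_smul' := fun r c => by
        apply CHolderDot.ext
        intro z
        change ((r • c) * z : ℂ).re = r * (c * z : ℂ).re
        rw [smul_mul_assoc, Complex.smul_re, smul_eq_mul] }

theorem mode_apply (c : ℂ) (z : Circle) : (mode hβ0 hβ1 c).1 z = (c * z).re := rfl

/-- The Schwarz integral of `Re (c z)` is `c z`, and `Im (c z) = Re (-i c z)`. -/
theorem hilbert_mode (c : ℂ) :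
    hilbert hβ0 hβ1 (mode hβ0 hβ1 c) = mode hβ0 hβ1 (-Complex.I * c) := by
  apply CHolderDot.ext
  intro z
  rw [hilbert_eq hβ0 hβ1 (diffContOnCl_mul_id c) (fun z => rfl) (by simp), mode_apply]
  simp [mul_assoc]

/-- Away from the circle the differentiated kernel is bounded, so the supremum of `f` suffices. This
is the estimate that locates the critical point. -/
theorem norm_deriv_schwarz_le_norm {f : Circle → ℝ} (hf : Continuous f) {M r : ℝ}
    (hM : ∀ z, |f z| ≤ M) (hr : r < 1) {w : ℂ} (hw : ‖w‖ ≤ r) :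
    ‖deriv (schwarz f) w‖ ≤ 2 / (1 - r) ^ 2 * M := by
  have hw1 : w ∈ ball (0 : ℂ) 1 := by
    rw [mem_ball_zero_iff]
    linarith
  rw [(hasDerivAt_schwarz hf hw1).deriv]
  refine (norm_circleAverage_le (χ := fun _ => 2 / (1 - r) ^ 2 * M)
    (circleIntegrable_const _ _ _) fun z => ?_).trans (Real.circleAverage_const _ _ _).le
  have h1 : 1 - r ≤ ‖(z : ℂ) - w‖ := by
    have := norm_sub_norm_le (z : ℂ) w
    rw [z.norm_coe] at this
    linarith
  rw [onPlane_coe, norm_smul, norm_div, norm_mul, norm_pow, Circle.norm_coe, Complex.norm_real,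
    Real.norm_eq_abs, Complex.norm_ofNat, mul_one]
  apply mul_le_mul _ (hM z) (abs_nonneg _) (by positivity)
  apply div_le_div_of_nonneg_left (by norm_num) (by have : 0 < 1 - r := by linarith
                                                    positivity)
  exact pow_le_pow_left₀ (by linarith) h1 2

/-- The derivative at the origin of the Schwarz integral. -/
def derivZero : CHolderDot β →L[ℝ] ℂ :=
  LinearMap.mkContinuous
    { toFun := fun f => deriv (schwarz f.1) 0
      map_add' := fun f g => by
        have h : schwarz (f + g).1 =ᶠ[𝓝 0] schwarz f.1 + schwarz g.1 := by
          filter_upwards [ball_mem_nhds (0 : ℂ) one_pos] with w hw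
          exact schwarz_add f.1.continuous g.1.continuous hw
        rw [h.deriv_eq, deriv_add]
        · exact (hasDerivAt_schwarz f.1.continuous (by simp)).differentiableAt
        · exact (hasDerivAt_schwarz g.1.continuous (by simp)).differentiableAt
      map_smul' := fun c f => by
        have h : schwarz (c • f).1 = fun w => (c : ℂ) * schwarz f.1 w :=
          funext fun w => schwarz_smul c f.1 w
        rw [h, deriv_const_mul_field]
        simp }
    2 fun f => by
      have h : ‖deriv (schwarz f.1) 0‖ ≤ 2 / (1 - 0) ^ 2 * ‖f.1‖ :=
        norm_deriv_schwarz_le_norm f.1.continuous f.1.abs_apply_le zero_lt_one (by simp)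
      have h2 : (2 : ℝ) / (1 - 0) ^ 2 = 2 := by norm_num
      rw [h2] at h
      exact h

theorem derivZero_apply (f : CHolderDot β) : derivZero f = deriv (schwarz f.1) 0 := rfl

theorem derivZero_mode (c : ℂ) : derivZero (mode hβ0 hβ1 c) = c := by
  have h : (fun z : ℂ => c * z) =ᶠ[𝓝 0] schwarz (mode hβ0 hβ1 c).1 := by
    filter_upwards [ball_mem_nhds (0 : ℂ) one_pos] with w hw
    exact schwarz_unique (mode hβ0 hβ1 c).1.continuous (diffContOnCl_mul_id c) (fun z => rfl)
      (by simp) hw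
  rw [derivZero_apply, ← h.deriv_eq]
  simp

/-- The reflection of the first Fourier mode. -/
def flipMode : CHolderDot β →L[ℝ] CHolderDot β :=
  ContinuousLinearMap.id ℝ _ - (2 : ℝ) • (mode hβ0 hβ1).comp derivZero

theorem flipMode_apply (f : CHolderDot β) :
    flipMode hβ0 hβ1 f = f - (2 : ℝ) • mode hβ0 hβ1 (derivZero f) := rfl

/-- By `derivZero_mode`, `mode ∘ derivZero` is a projection `P`, and `1 - 2P` is an involution. -/
theorem flipMode_flipMode (f : CHolderDot β) : flipMode hβ0 hβ1 (flipMode hβ0 hβ1 f) = f := by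
  rw [flipMode_apply, flipMode_apply, map_sub, map_smul, derivZero_mode, map_sub, map_smul]
  module

/-- The first mode `Re (d z)`, with `d = derivZero f`, has conjugate `Re (-i d z)`; adding `Re (2 i
d z)` reverses its sign. The added term is the one later produced by the motion of the singularity.
-/
theorem hilbert_flipMode (f : CHolderDot β) :
    hilbert hβ0 hβ1 (flipMode hβ0 hβ1 f) =
      hilbert hβ0 hβ1 f + mode hβ0 hβ1 (2 * Complex.I * derivZero f) := by
  rw [flipMode_apply, map_sub, map_smul, hilbert_mode, ← map_smul, sub_eq_add_neg, ← map_neg]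
  congr 2
  rw [Complex.real_smul]
  push_cast
  ring

/-- The conjugation operator composed with the reflection of the first Fourier mode, as an
isomorphism. -/
def conjFlipEquiv : CHolderDot β ≃L[ℝ] CHolderDot β :=
  ContinuousLinearEquiv.equivOfInverse ((hilbert hβ0 hβ1).comp (flipMode hβ0 hβ1))
    ((flipMode hβ0 hβ1).comp (-hilbert hβ0 hβ1))
    (fun f => by
      change flipMode hβ0 hβ1 (-hilbert hβ0 hβ1 (hilbert hβ0 hβ1 (flipMode hβ0 hβ1 f))) = f
      rw [hilbert_hilbert, neg_neg, flipMode_flipMode])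
    (fun f => by
      change hilbert hβ0 hβ1 (flipMode hβ0 hβ1 (flipMode hβ0 hβ1 (-hilbert hβ0 hβ1 f))) = f
      rw [flipMode_flipMode, map_neg, hilbert_hilbert, neg_neg])

theorem conjFlipEquiv_apply (f : CHolderDot β) : conjFlipEquiv hβ0 hβ1 f =
    hilbert hβ0 hβ1 f + mode hβ0 hβ1 (2 * Complex.I * derivZero f) :=
  hilbert_flipMode hβ0 hβ1 f

end Conj

/-! ## `C¹` functions on the circle -/

section C1

variable {E : Type*} [NormedAddCommGroup E] [NormedSpace ℝ E]

theorem IsC1.hasDerivAt_exp {f : Circle → E} (hf : IsC1 f) (t : ℝ) :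
    HasDerivAt (fun s : ℝ => f (Circle.exp s)) (tangDeriv f (Circle.exp t)) t := by
  have h1 : HasDerivAt (fun s : ℝ => f (Circle.exp t * Circle.exp s))
      (tangDeriv f (Circle.exp t)) (t - t) := by
    rw [sub_self]
    exact (hf.1 (Circle.exp t)).hasDerivAt
  refine (h1.comp_sub_const t t).congr_of_eventuallyEq (Eventually.of_forall fun s => ?_)
  simp only
  rw [← Circle.exp_add, add_sub_cancel]

theorem hasDerivAt_mul_exp {f d : Circle → E}
    (h : ∀ t : ℝ, HasDerivAt (fun s : ℝ => f (Circle.exp s)) (d (Circle.exp t)) t) (z : Circle) :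
    HasDerivAt (fun t : ℝ => f (z * Circle.exp t)) (d z) 0 := by
  obtain ⟨a, rfl⟩ := Circle.exp_surjective z
  have h1 := h a
  rw [← add_zero a] at h1
  have h2 := h1.comp_const_add a 0
  rw [add_zero] at h2
  simpa only [Circle.exp_add] using h2

theorem tangDeriv_eq {f d : Circle → E}
    (h : ∀ t : ℝ, HasDerivAt (fun s : ℝ => f (Circle.exp s)) (d (Circle.exp t)) t) :
    tangDeriv f = d :=
  funext fun z => (hasDerivAt_mul_exp h z).deriv

theorem isC1_of_hasDerivAt {f d : Circle → E} (hd : Continuous d)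
    (h : ∀ t : ℝ, HasDerivAt (fun s : ℝ => f (Circle.exp s)) (d (Circle.exp t)) t) : IsC1 f :=
  ⟨fun z => (hasDerivAt_mul_exp h z).differentiableAt, by rwa [tangDeriv_eq h]⟩

/-- The lifts differ by the principal argument of the quotient, so Jordan's inequality compares arc
with chord. This converts the mean value inequality in the angle into a Lipschitz bound on the
circle. -/
theorem exists_angles (z w : Circle) : ∃ s t : ℝ, Circle.exp s = z ∧ Circle.exp t = w ∧
    |s - t| ≤ Real.pi / 2 * ‖(z : ℂ) - w‖ := by
  obtain ⟨t, rfl⟩ := Circle.exp_surjective w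
  set u := Complex.arg ((z / Circle.exp t : Circle) : ℂ) with hu
  have h1 : Circle.exp u = z / Circle.exp t := Circle.exp_arg _
  have h2 : Circle.exp (t + u) = z := by
    rw [Circle.exp_add, h1, mul_div_cancel]
  refine ⟨t + u, t, h2, rfl, ?_⟩
  have h3 : |u| ≤ Real.pi := Complex.abs_arg_le_pi _
  have h4 := abs_div_pi_le_norm_exp_sub_one h3
  have h5 : (z : ℂ) - Circle.exp t =
      (Circle.exp t : ℂ) * (Complex.exp (u * Complex.I) - 1) := by
    rw [← h2, Circle.exp_add, Circle.coe_mul, Circle.coe_exp u]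
    ring
  rw [h5, norm_mul, Circle.norm_coe, one_mul, add_sub_cancel_left]
  have hpi := Real.pi_pos
  calc |u| = Real.pi / 2 * (2 * (|u| / Real.pi)) := by field_simp
    _ ≤ _ := mul_le_mul_of_nonneg_left h4 (by positivity)

theorem IsC1.norm_sub_le {f : Circle → E} (hf : IsC1 f) {M : ℝ} (hM0 : 0 ≤ M)
    (hM : ∀ z, ‖tangDeriv f z‖ ≤ M) (z w : Circle) :
    ‖f z - f w‖ ≤ M * (Real.pi / 2) * ‖(z : ℂ) - w‖ := by
  obtain ⟨s, t, rfl, rfl, hst⟩ := exists_angles z w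
  have h := convex_univ.norm_image_sub_le_of_norm_hasDerivWithin_le
    (fun x _ => (hf.hasDerivAt_exp x).hasDerivWithinAt) (fun x _ => hM (Circle.exp x))
    (mem_univ t) (mem_univ s)
  refine h.trans ?_
  rw [mul_assoc]
  exact mul_le_mul_of_nonneg_left hst hM0

end C1

theorem circleInt_tangDeriv {f : Circle → ℝ} (hf : IsC1 f) : circleInt (tangDeriv f) = 0 := by
  rw [circleInt, intervalIntegral.integral_eq_sub_of_hasDerivAt
    (fun t _ => hf.hasDerivAt_exp t)
    ((hf.2.comp Circle.exp.continuous).intervalIntegrable _ _)]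
  simp

theorem isC1_coe : IsC1 (fun z : Circle => (z : ℂ)) ∧
    tangDeriv (fun z : Circle => (z : ℂ)) = fun z : Circle => Complex.I * (z : ℂ) := by
  have h : ∀ t : ℝ, HasDerivAt (fun s : ℝ => (Circle.exp s : ℂ))
      (Complex.I * (Circle.exp t : ℂ)) t := by
    intro t
    have h1 := ((Complex.ofRealCLM.hasDerivAt (x := t)).mul_const Complex.I).cexp
    simp only [Complex.ofRealCLM_apply, Complex.ofReal_one, one_mul] at h1
    rw [mul_comm]
    exact h1
  exact ⟨isC1_of_hasDerivAt (d := fun z : Circle => Complex.I * (z : ℂ)) (by fun_prop) h,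
    tangDeriv_eq (d := fun z : Circle => Complex.I * (z : ℂ)) h⟩

theorem hasDerivAt_coe_exp (t : ℝ) :
    HasDerivAt (fun s : ℝ => (Circle.exp s : ℂ)) (Complex.I * (Circle.exp t : ℂ)) t := by
  have h := isC1_coe.1.hasDerivAt_exp t
  rwa [isC1_coe.2] at h

/-- Integration by parts in the Schwarz integral. -/
theorem mul_deriv_schwarz {ψ : Circle → ℝ} (hψc : Continuous ψ) (hψ : IsC1 ψ) {w : ℂ}
    (hw : w ∈ ball (0 : ℂ) 1) :
    w * deriv (schwarz ψ) w = -Complex.I * schwarz (tangDeriv ψ) w := by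
  have hne : ∀ t : ℝ, (Circle.exp t : ℂ) - w ≠ 0 := by
    intro t
    rw [← circleMap_zero_one]
    exact sub_ne_zero.2 (circleMap_ne_mem_ball hw t)
  -- The angular derivative of the Herglotz kernel is `-i w` times its derivative `2 ζ / (ζ - w)²`
  -- in `w`; this is what produces the factor `w` in the identity.
  have hk : ∀ t ∈ uIcc 0 (2 * Real.pi), HasDerivAt
      (fun s : ℝ => ((Circle.exp s : ℂ) + w) / ((Circle.exp s : ℂ) - w))
      (-(2 * Complex.I * w * (Circle.exp t : ℂ)) / ((Circle.exp t : ℂ) - w) ^ 2) t := by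
    intro t _
    have h1 := ((hasDerivAt_coe_exp t).add_const w).div ((hasDerivAt_coe_exp t).sub_const w)
      (hne t)
    refine h1.congr_deriv ?_
    ring
  have hv : ∀ t ∈ uIcc 0 (2 * Real.pi), HasDerivAt (fun s : ℝ => ((ψ (Circle.exp s) : ℝ) : ℂ))
      ((tangDeriv ψ (Circle.exp t) : ℝ) : ℂ) t := fun t _ => (hψ.hasDerivAt_exp t).ofReal_comp
  have hcont : Continuous fun t : ℝ =>
      -(2 * Complex.I * w * (Circle.exp t : ℂ)) / ((Circle.exp t : ℂ) - w) ^ 2 := by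
    apply Continuous.div
    · fun_prop
    · fun_prop
    · exact fun t => pow_ne_zero _ (hne t)
  have hcont2 : Continuous fun t : ℝ => ((tangDeriv ψ (Circle.exp t) : ℝ) : ℂ) :=
    Complex.continuous_ofReal.comp (hψ.2.comp Circle.exp.continuous)
  have hparts := intervalIntegral.integral_mul_deriv_eq_deriv_mul hk hv
    (hcont.intervalIntegrable _ _) (hcont2.intervalIntegrable _ _)
  simp only [Circle.exp_two_pi, Circle.exp_zero, sub_self, zero_sub] at hparts
  rw [(hasDerivAt_schwarz hψc hw).deriv, schwarz, Real.circleAverage_def, Real.circleAverage_def]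
  have e1 : (∫ θ in (0 : ℝ)..2 * Real.pi, herglotzRieszKernel 0 w (circleMap 0 1 θ) •
      ((onPlane (tangDeriv ψ) (circleMap 0 1 θ) : ℝ) : ℂ)) =
      ∫ θ in (0 : ℝ)..2 * Real.pi, ((Circle.exp θ : ℂ) + w) / ((Circle.exp θ : ℂ) - w) *
        ((tangDeriv ψ (Circle.exp θ) : ℝ) : ℂ) := by
    apply intervalIntegral.integral_congr
    intro θ _
    simp only [onPlane_coe, circleMap_zero_one, herglotzRieszKernel_def, sub_zero,
      smul_eq_mul]
  rw [e1, hparts, ← intervalIntegral.integral_neg]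
  rw [mul_smul_comm, mul_smul_comm, ← intervalIntegral.integral_const_mul,
    ← intervalIntegral.integral_const_mul]
  congr 1
  apply intervalIntegral.integral_congr
  intro θ _
  simp only [onPlane_coe, circleMap_zero_one, smul_eq_mul]
  linear_combination (2 * w * (Circle.exp θ : ℂ) / ((Circle.exp θ : ℂ) - w) ^ 2 *
    (ψ (Circle.exp θ) : ℂ)) * Complex.I_sq

/-! ### Schwarz integrals of `C^{1,β}` functions and their normal derivatives. -/

namespace C1Holder

variable {β : ℝ≥0}

theorem isC1 (ψ : C1Holder β) : IsC1 ψ := ψ.2.1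

theorem continuous (ψ : C1Holder β) : Continuous ψ := ψ.1.continuous

theorem tang_apply (ψ : C1Holder β) (z : Circle) : tang ψ z = tangDeriv ψ z := rfl

theorem abs_apply_le (ψ : C1Holder β) (z : Circle) : |ψ z| ≤ ‖ψ‖ := by
  rw [C1Holder.norm_def]
  have h1 := ψ.1.norm_coe_le_norm z
  rw [Real.norm_eq_abs] at h1
  have h2 := norm_nonneg (tang ψ)
  linarith

theorem norm_tang_le (ψ : C1Holder β) : ‖tang ψ‖ ≤ ‖ψ‖ := by
  rw [C1Holder.norm_def ψ]
  have := norm_nonneg ψ.1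
  linarith

theorem ext {f g : C1Holder β} (h : ∀ z, f z = g z) : f = g :=
  Subtype.ext (ContinuousMap.ext h)

@[simp]
theorem sub_apply (f g : C1Holder β) (z : Circle) : (f - g) z = f z - g z := rfl

/-- The inclusion of `C1Holder β` in `CHolder β`. -/
def toCHolder (hβ0 : 0 < β) (hβ1 : β < 1) (ψ : C1Holder β) : CHolder β :=
  CHolder.ofBound hβ0 ψ
    ⟨⟨‖tang ψ‖ * (Real.pi / 2) * 2, by have := Real.pi_pos; positivity⟩, fun z w => by
      have h1 := ψ.isC1.norm_sub_le (norm_nonneg (tang ψ)) (fun z => (tang ψ).abs_apply_le z) z w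
      have h2 := mul_le_mul_of_nonneg_left (norm_circle_sub_le hβ0 hβ1 z w)
        (by have := Real.pi_pos; positivity : 0 ≤ ‖tang ψ‖ * (Real.pi / 2))
      rw [Real.norm_eq_abs] at h1
      change _ ≤ ‖tang ψ‖ * (Real.pi / 2) * 2 * _
      linarith⟩

theorem schwarzExt_diffContOnCl (hβ0 : 0 < β) (hβ1 : β < 1) (ψ : C1Holder β) :
    DiffContOnCl ℂ (schwarzExt ψ) (ball 0 1) :=
  (toCHolder hβ0 hβ1 ψ).schwarzExt_diffContOnCl hβ0 hβ1

theorem re_schwarzExt (hβ0 : 0 < β) (hβ1 : β < 1) (ψ : C1Holder β) (z : Circle) :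
    (schwarzExt ψ z).re = ψ z :=
  (toCHolder hβ0 hβ1 ψ).re_schwarzExt hβ0 hβ1 z

theorem im_schwarzExt_zero (hβ0 : 0 < β) (hβ1 : β < 1) (ψ : C1Holder β) :
    (schwarzExt ψ 0).im = 0 :=
  (toCHolder hβ0 hβ1 ψ).im_schwarzExt_zero

/-- The normal derivative on the circle of the Schwarz integral of `ψ`. -/
theorem hasNormalDeriv_schwarzExt (hβ0 : 0 < β) (hβ1 : β < 1) (ψ : C1Holder β) (z : Circle) :
    HasNormalDeriv (schwarzExt ψ) (-Complex.I * schwarzExt (tang ψ) z) z := by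
  have hball : ∀ r ∈ Ioo (0 : ℝ) 1, (r : ℂ) * z ∈ ball (0 : ℂ) 1 := by
    intro r hr
    simp [abs_of_pos hr.1, hr.2, Circle.norm_coe]
  have hd : ∀ r ∈ Ioo (0 : ℝ) 1, HasDerivAt (fun r : ℝ => schwarzExt ψ ((r : ℂ) * z))
      ((r : ℂ)⁻¹ * (-Complex.I * schwarzExt (tang ψ) ((r : ℂ) * z))) r := by
    intro r hr
    have h1 := (hasDerivAt_schwarz ψ.continuous (hball r hr)).differentiableAt.hasDerivAt
    have h2 : schwarzExt ψ =ᶠ[𝓝 ((r : ℂ) * z)] schwarz ψ := by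
      filter_upwards [isOpen_ball.mem_nhds (hball r hr)] with w hw
      exact schwarzExt_eqOn ψ.continuous hw
    have h3 : HasDerivAt (fun r : ℝ => (r : ℂ) * z) z r := by
      simpa using (Complex.ofRealCLM.hasDerivAt (x := r)).mul_const (z : ℂ)
    have h4 := (h1.congr_of_eventuallyEq h2).comp r h3
    refine h4.congr_deriv ?_
    have h5 := mul_deriv_schwarz ψ.continuous ψ.isC1 (hball r hr)
    have hr0 : (r : ℂ) ≠ 0 := by exact_mod_cast hr.1.ne'
    rw [schwarzExt_eqOn (tang ψ).continuous (hball r hr)]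
    change _ = _ * (-Complex.I * schwarz (tangDeriv ψ) _)
    rw [← h5]
    field_simp
  -- The one-sided derivative at `r = 1` is the limit of the interior derivatives, which exists
  -- because the Schwarz integral of the Hölder function `tang ψ` is continuous up to the circle.
  apply hasDerivWithinAt_Iic_of_tendsto_deriv (s := Ioo 0 1)
  · exact fun r hr => (hd r hr).differentiableAt.differentiableWithinAt
  · have h1 := tendsto_radial (F := schwarzExt ψ)
      (by rw [← closure_unitBall]; exact (schwarzExt_diffContOnCl hβ0 hβ1 ψ).continuousOn) z
    have h2 : 𝓝[Ioo (0 : ℝ) 1] 1 ≤ 𝓝[<] 1 := nhdsWithin_mono _ Ioo_subset_Iio_self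
    have h3 := h1.mono_left h2
    rw [ContinuousWithinAt]
    simpa using h3
  · exact Ioo_mem_nhdsLT zero_lt_one
  · have h1 := tendsto_radial (F := schwarzExt (tang ψ))
      (by rw [← closure_unitBall]
          exact ((tang ψ).schwarzExt_diffContOnCl hβ0 hβ1).continuousOn) z
    have h2 : Tendsto (fun r : ℝ => (r : ℂ)⁻¹) (𝓝[<] 1) (𝓝 1) := by
      have : ContinuousAt (fun r : ℝ => (r : ℂ)⁻¹) 1 :=
        Complex.continuous_ofReal.continuousAt.inv₀ (by simp)
      have h := this.tendsto
      simp only [Complex.ofReal_one, inv_one] at h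
      exact h.mono_left nhdsWithin_le_nhds
    have h3 := h2.mul (h1.const_mul (-Complex.I))
    rw [one_mul] at h3
    refine h3.congr' ?_
    filter_upwards [Ioo_mem_nhdsLT (zero_lt_one' ℝ)] with r hr
    exact (hd r hr).deriv.symm

/-- The tangential derivative as a bounded operator. -/
def diff : C1Holder β →L[ℝ] CHolderDot β :=
  LinearMap.mkContinuous
    { toFun := fun ψ => ⟨tang ψ, circleInt_tangDeriv ψ.isC1⟩
      map_add' := fun f g => Subtype.ext (map_add tang f g)
      map_smul' := fun c f => Subtype.ext (map_smul tang c f) } 1 fun ψ => by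
    rw [one_mul]
    exact norm_tang_le ψ

@[simp]
theorem coe_diff (ψ : C1Holder β) : (diff ψ).1 = tang ψ := rfl

end C1Holder

/-- The primitive, vanishing at `1`, of a function of mean zero on the circle. -/
def primitive (f : Circle → ℝ) (z : Circle) : ℝ :=
  ∫ s in (0 : ℝ)..Complex.arg z, f (Circle.exp s)

/-- Zero mean makes the integral `2π`-periodic in its upper limit, so the branch cut of the argument
is harmless. -/
theorem primitive_exp {f : Circle → ℝ} (hf : Continuous f) (h0 : circleInt f = 0) (t : ℝ) :
    primitive f (Circle.exp t) = ∫ s in (0 : ℝ)..t, f (Circle.exp s) := by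
  have hint : ∀ a b : ℝ, IntervalIntegrable (fun s => f (Circle.exp s)) volume a b :=
    fun a b => (hf.comp Circle.exp.continuous).intervalIntegrable a b
  have hper : Function.Periodic (fun t : ℝ => ∫ s in (0 : ℝ)..t, f (Circle.exp s))
      (2 * Real.pi) := by
    intro t
    have h1 : Function.Periodic (fun s : ℝ => f (Circle.exp s)) (2 * Real.pi) := fun s => by
      simp only [Circle.exp_add_two_pi]
    have h2 := h1.intervalIntegral_add_eq t 0
    rw [zero_add] at h2
    simp only
    rw [← intervalIntegral.integral_add_adjacent_intervals (hint 0 t) (hint t (t + 2 * Real.pi)),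
      h2]
    change _ + circleInt f = _
    rw [h0, add_zero]
  obtain ⟨m, hm⟩ := Circle.exp_eq_exp.1 (Circle.exp_arg (Circle.exp t))
  rw [primitive, hm]
  exact hper.int_mul m t

/-! ### Differentiation as an isomorphism from `C^{1,β}` modulo constants. -/

section Primitive

variable {β : ℝ≥0}

theorem hasDerivAt_primitive_exp (f : CHolderDot β) (t : ℝ) :
    HasDerivAt (fun s : ℝ => primitive f.1 (Circle.exp s)) (f.1 (Circle.exp t)) t := by
  have h0 : circleInt f.1 = 0 := f.2
  simp only [primitive_exp f.1.continuous h0]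
  exact intervalIntegral.integral_hasDerivAt_right
    ((f.1.continuous.comp Circle.exp.continuous).intervalIntegrable _ _)
    ((f.1.continuous.comp Circle.exp.continuous).stronglyMeasurableAtFilter _ _)
    (f.1.continuous.comp Circle.exp.continuous).continuousAt

theorem isC1_primitive (f : CHolderDot β) : IsC1 (primitive f.1) :=
  isC1_of_hasDerivAt f.1.continuous (hasDerivAt_primitive_exp f)

theorem tangDeriv_primitive (f : CHolderDot β) : tangDeriv (primitive f.1) = f.1 :=
  tangDeriv_eq (hasDerivAt_primitive_exp f)

theorem continuous_primitive (f : CHolderDot β) : Continuous (primitive f.1) := by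
  have h := (isC1_primitive f).norm_sub_le (norm_nonneg f.1)
    (fun z => by rw [tangDeriv_primitive]; exact f.1.abs_apply_le z)
  have hpi := Real.pi_pos
  refine (LipschitzWith.of_dist_le_mul (K := ⟨‖f.1‖ * (Real.pi / 2), by positivity⟩)
    fun z w => ?_).continuous
  rw [dist_eq_norm, Circle_dist]
  exact h z w

theorem abs_primitive_le (f : CHolderDot β) (z : Circle) : |primitive f.1 z| ≤ Real.pi * ‖f‖ := by
  have h := intervalIntegral.norm_integral_le_of_norm_le_const (a := 0) (b := Complex.arg z)
    (f := fun s => f.1 (Circle.exp s)) (C := ‖f.1‖) fun s _ => f.1.abs_apply_le _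
  rw [sub_zero, mul_comm] at h
  exact h.trans (mul_le_mul_of_nonneg_right (Complex.abs_arg_le_pi _) (norm_nonneg _))

/-- The primitive as a bounded operator from `CHolderDot β` to `C1Holder β`. -/
def primitiveL : CHolderDot β →L[ℝ] C1Holder β :=
  LinearMap.mkContinuous
    { toFun := fun f => (⟨⟨primitive f.1, continuous_primitive f⟩, isC1_primitive f, by
        change MemHolder β (tangDeriv (primitive f.1))
        rw [tangDeriv_primitive]
        exact f.1.2⟩ : holder1Submodule β)
      map_add' := fun f g => C1Holder.ext fun z =>
        intervalIntegral.integral_add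
          ((f.1.continuous.comp Circle.exp.continuous).intervalIntegrable _ _)
          ((g.1.continuous.comp Circle.exp.continuous).intervalIntegrable _ _)
      map_smul' := fun c f => C1Holder.ext fun z =>
        intervalIntegral.integral_const_mul c fun s => f.1 (Circle.exp s) }
    (Real.pi + 1) fun f => by
      rw [C1Holder.norm_def, add_mul, one_mul]
      apply add_le_add
      · refine (ContinuousMap.norm_le _ ?_).2 fun z => abs_primitive_le f z
        have := Real.pi_pos
        positivity
      · apply le_of_eq
        change _ = ‖f.1‖
        congr 1
        exact CHolder.ext fun z => congrFun (tangDeriv_primitive f) z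

theorem primitiveL_apply (f : CHolderDot β) (z : Circle) : primitiveL f z = primitive f.1 z := rfl

theorem diff_primitiveL (f : CHolderDot β) : C1Holder.diff (primitiveL f) = f :=
  CHolderDot.ext fun z => congrFun (tangDeriv_primitive f) z

theorem primitiveL_diff_sub_mem (ψ : C1Holder β) :
    primitiveL (C1Holder.diff ψ) - ψ ∈ constants β := by
  refine ⟨-ψ 1, fun z => ?_⟩
  obtain ⟨t, rfl⟩ := Circle.exp_surjective z
  rw [C1Holder.sub_apply, primitiveL_apply,
    primitive_exp (C1Holder.diff ψ).1.continuous (C1Holder.diff ψ).2]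
  change (∫ s in (0 : ℝ)..t, tangDeriv ψ (Circle.exp s)) - _ = _
  rw [intervalIntegral.integral_eq_sub_of_hasDerivAt (fun t _ => ψ.isC1.hasDerivAt_exp t)
    ((ψ.isC1.2.comp Circle.exp.continuous).intervalIntegrable _ _), Circle.exp_zero]
  ring

theorem constants_le_ker : constants β ≤ (C1Holder.diff (β := β)).ker := by
  rintro ψ ⟨c, hc⟩
  rw [LinearMap.mem_ker]
  apply CHolderDot.ext
  intro z
  change tangDeriv ψ z = 0
  have : (ψ : Circle → ℝ) = fun _ => c := funext hc
  rw [this]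
  exact deriv_const 0 c

/-- The tangential derivative as an isomorphism from `C1HolderModConst β` to `CHolderDot β`. -/
def diffEquiv : C1HolderModConst β ≃L[ℝ] CHolderDot β :=
  ContinuousLinearEquiv.equivOfInverse ((constants β).liftQL C1Holder.diff constants_le_ker)
    ((constants β).mkQL.comp primitiveL)
    (fun q => by
      obtain ⟨ψ, rfl⟩ := Submodule.Quotient.mk_surjective _ q
      exact (Submodule.Quotient.eq _).2 (primitiveL_diff_sub_mem ψ))
    (fun f => diff_primitiveL f)

theorem diffEquiv_mk (ψ : C1Holder β) :
    diffEquiv (Submodule.Quotient.mk ψ) = C1Holder.diff ψ := rfl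

theorem mk_primitiveL_diffEquiv (q : C1HolderModConst β) :
    Submodule.Quotient.mk (primitiveL (diffEquiv q)) = q :=
  diffEquiv.symm_apply_apply q

end Primitive

/-! ## Uniqueness for the Neumann problem -/

/-- Harnack's inequality at a boundary point where a harmonic function is maximal. -/
theorem harnack_radial {v : ℂ → ℝ} (hv : HarmonicContOnCl v (ball 0 1))
    (h0 : ∀ z : Circle, 0 ≤ v z) {w : ℂ} (hw : w ∈ ball (0 : ℂ) 1) :
    (1 - ‖w‖) / (1 + ‖w‖) * v 0 ≤ v w := by
  have hw' : ‖w‖ < 1 := by simpa using hw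
  have hv0 := Real.circleAverage_smul (a := (1 - ‖w‖) / (1 + ‖w‖)) (f := v) (c := 0) (R := 1)
  have h1 : HarmonicContOnCl v (ball 0 |1|) := by rwa [abs_one]
  rw [h1.circleAverage_eq, smul_eq_mul] at hv0
  rw [← hv0, ← hv.circleAverage_re_herglotzRieszKernel_smul hw]
  have hc : Continuous fun θ : ℝ => v (circleMap 0 1 θ) := by
    apply (hv.continuousOn_ball).comp_continuous (continuous_circleMap 0 1)
    exact circleMap_mem_closedBall 0 zero_le_one
  apply Real.circleAverage_mono
  · exact circleIntegrable_of_continuous (hc.const_smul _)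
  · apply circleIntegrable_of_continuous
    refine Continuous.smul (Complex.continuous_re.comp ?_) hc
    simp only [herglotz_eq]
    exact continuous_circleMap_kernel hw 1 (fun ζ => ζ + w) (by fun_prop)
  · intro z hz
    rw [abs_one] at hz
    have hk := le_re_herglotzRieszKernel hz hw
    obtain ⟨ζ, rfl⟩ := exists_circle_of_mem_sphere hz
    rw [sub_zero, sub_zero] at hk
    simp only [Pi.smul_apply, Pi.smul_apply', smul_eq_mul, Function.comp_apply,
      herglotzRieszKernel_def, sub_zero]
    exact mul_le_mul_of_nonneg_right hk (h0 ζ)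

/-- Hopf's lemma: at a maximum point on the circle with vanishing normal derivative. -/
theorem le_zero_value_of_hasNormalDeriv_zero {u : ℂ → ℝ} (hu : HarmonicContOnCl u (ball 0 1))
    {z₀ : Circle} (hmax : ∀ z : Circle, u z ≤ u z₀) (hd : HasNormalDeriv u 0 z₀) :
    u z₀ ≤ u 0 := by
  have hv : HarmonicContOnCl (fun x => u z₀ - u x) (ball 0 1) := by
    have h1 := (harmonicContOnCl_const (s := ball (0 : ℂ) 1) (c := u z₀)).sub hu
    exact h1
  have h2 := hasDerivWithinAt_iff_tendsto_slope.1 hd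
  have h3 : Iic (1 : ℝ) \ {1} = Iio 1 := Iic_sdiff_right
  rw [h3] at h2
  -- Harnack's inequality for `u z₀ - u` bounds the radial difference quotients of `u` below by `(u
  -- z₀ - u 0) / (1 + r)`, hence by half of `u z₀ - u 0`; their limit is the vanishing normal
  -- derivative.
  have h4 : (u z₀ - u 0) / 2 ≤ 0 := by
    apply ge_of_tendsto h2
    filter_upwards [Ioo_mem_nhdsLT (zero_lt_one' ℝ)] with r hr
    have hn : ‖(r : ℂ) * z₀‖ = r := by simp [abs_of_pos hr.1, Circle.norm_coe]
    have hm : (r : ℂ) * z₀ ∈ ball (0 : ℂ) 1 := by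
      rw [mem_ball_zero_iff, hn]
      exact hr.2
    have h5 := harnack_radial hv (fun z => sub_nonneg.2 (hmax z)) hm
    rw [hn] at h5
    have h6 := harnack_radial hv (fun z => sub_nonneg.2 (hmax z)) (mem_ball_self one_pos)
    rw [slope_def_field, Complex.ofReal_one, one_mul]
    have hr1 : 0 < 1 - r := by linarith [hr.2]
    have e : (u (r * z₀) - u z₀) / (r - 1) = (u z₀ - u (r * z₀)) / (1 - r) := by
      rw [← neg_sub (u z₀), ← neg_sub 1 r, neg_div_neg_eq]
    rw [e, le_div_iff₀ hr1]
    have h7 : 0 ≤ u z₀ - u 0 := by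
      have h8 : HarmonicContOnCl (fun x => u z₀ - u x) (ball 0 |1|) := by rwa [abs_one]
      rw [← h8.circleAverage_eq]
      apply Real.circleAverage_nonneg_of_nonneg
      intro x hx
      rw [abs_one] at hx
      obtain ⟨ζ, rfl⟩ := exists_circle_of_mem_sphere hx
      exact sub_nonneg.2 (hmax ζ)
    refine le_trans ?_ h5
    rw [div_mul_eq_mul_div, div_mul_eq_mul_div, div_le_div_iff₀ (by norm_num) (by linarith [hr.1])]
    nlinarith [mul_nonneg h7 hr1.le, hr.1]
  linarith

theorem HasNormalDeriv.neg {u : ℂ → ℝ} {s : ℝ} {z : Circle} (h : HasNormalDeriv u s z) :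
    HasNormalDeriv (fun x => -u x) (-s) z := HasDerivWithinAt.fun_neg h

/-- Hopf's lemma at a maximum and at a minimum on the circle squeezes all boundary values onto `u
0`. Green's identity is avoided because the normal derivative is only assumed to exist pointwise,
with no control of the gradient near the circle. -/
theorem eq_const_of_hasNormalDeriv_zero {u : ℂ → ℝ} (hu : HarmonicContOnCl u (ball 0 1))
    (hd : ∀ z : Circle, HasNormalDeriv u 0 z) : EqOn u (fun _ => u 0) (closedBall 0 1) := by
  have hc : Continuous fun z : Circle => u z :=
    hu.continuousOn_ball.comp_continuous continuous_induced_dom Circle_mem_closedBall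
  obtain ⟨z₁, -, h1⟩ := isCompact_univ.exists_isMaxOn univ_nonempty hc.continuousOn
  obtain ⟨z₂, -, h2⟩ := isCompact_univ.exists_isMinOn univ_nonempty hc.continuousOn
  have h3 := le_zero_value_of_hasNormalDeriv_zero hu (fun z => h1 (mem_univ z)) (hd z₁)
  have hneg : HarmonicContOnCl (fun x => -u x) (ball 0 1) := hu.neg
  have h4 := le_zero_value_of_hasNormalDeriv_zero hneg
    (fun z => neg_le_neg (h2 (mem_univ z))) (by simpa using (hd z₂).neg)
  apply eqOn_closedBall_of_eq_circle hu harmonicContOnCl_const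
  intro z
  have h5 : u z ≤ u z₁ := h1 (mem_univ z)
  have h6 : u z₂ ≤ u z := h2 (mem_univ z)
  change u z = u 0
  linarith

theorem continuous_log_norm_sub {a : ℂ} (ha : a ∈ ball (0 : ℂ) 1) :
    Continuous fun z : Circle => Real.log ‖(z : ℂ) - a‖ := by
  apply Continuous.log (by fun_prop)
  intro z h
  rw [norm_eq_zero, sub_eq_zero] at h
  rw [← h, mem_ball_zero_iff, z.norm_coe] at ha
  exact lt_irrefl _ ha

/-- The logarithms cancel in the difference, which is therefore harmonic with zero normal
derivative, hence constant; the normalization of the mean removes the constant. -/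
theorem IsNeumannRegularPart.eqOn {a : ℂ} (ha : a ∈ ball (0 : ℂ) 1) {g : Circle → Circle}
    {R R' : ℂ → ℝ} (hR : IsNeumannRegularPart a g R) (hR' : IsNeumannRegularPart a g R') :
    EqOn R R' (closedBall 0 1) := by
  have hu : HarmonicContOnCl (fun x => R x - R' x) (ball 0 1) := hR.1.sub hR'.1
  have h1 := eq_const_of_hasNormalDeriv_zero hu fun z => by
    have h2 := (hR.2.1 z).fun_sub (hR'.2.1 z)
    simp only [add_sub_add_left_eq_sub, sub_self] at h2
    exact h2
  have hcont : ∀ S : ℂ → ℝ, HarmonicContOnCl S (ball 0 1) → IntervalIntegrable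
      (fun t : ℝ => Real.log ‖(Circle.exp t : ℂ) - a‖ + S (Circle.exp t)) volume 0
        (2 * Real.pi) := by
    intro S hS
    have hc : Continuous fun z : Circle => S z :=
      hS.continuousOn_ball.comp_continuous continuous_induced_dom Circle_mem_closedBall
    exact (((continuous_log_norm_sub ha).add hc).comp Circle.exp.continuous).intervalIntegrable _ _
  have h2 : circleInt (fun z => R z - R' z) = 0 := by
    have h3 := intervalIntegral.integral_sub (hcont R hR.1) (hcont R' hR'.1)
    simp only [add_sub_add_left_eq_sub] at h3
    rw [circleInt, h3]
    have h4 := hR.2.2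
    have h5 := hR'.2.2
    rw [circleInt] at h4 h5
    rw [h4, h5, sub_self]
  rw [circleInt_eq (fun x => R x - R' x)] at h2
  have h3 : HarmonicContOnCl (fun x => R x - R' x) (ball 0 |1|) := by rwa [abs_one]
  rw [h3.circleAverage_eq] at h2
  have h4 : R 0 - R' 0 = 0 := by
    have := Real.pi_pos
    rcases mul_eq_zero.1 h2 with h | h
    · linarith
    · exact h
  intro w hw
  have h5 := h1 hw
  simp only [h4] at h5
  exact sub_eq_zero.1 h5

/-- As `neumannR` is a solution obtained by choice, this is what allows it to be replaced by an
explicit one. -/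
theorem IsNeumannRegularPart.neumannR_eqOn {a : ℂ} (ha : a ∈ ball (0 : ℂ) 1)
    {g : Circle → Circle} {R : ℂ → ℝ} (hR : IsNeumannRegularPart a g R) :
    EqOn (neumannR a g) R (closedBall 0 1) := by
  have h : ∃ R, IsNeumannRegularPart a g R := ⟨R, hR⟩
  rw [neumannR, dif_pos h]
  exact h.choose_spec.eqOn ha hR

/-! ## The explicit solution of the Neumann problem -/

theorem hasDerivAt_log_norm {w : ℝ → ℂ} {w' : ℂ} {t : ℝ} (hw : HasDerivAt w w' t)
    (h0 : w t ≠ 0) : HasDerivAt (fun s => Real.log ‖w s‖) (w' / w t).re t := by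
  have h1 : HasDerivAt (fun s => (w s).re) w'.re t := Complex.reCLM.hasFDerivAt.comp_hasDerivAt t hw
  have h2 : HasDerivAt (fun s => (w s).im) w'.im t := Complex.imCLM.hasFDerivAt.comp_hasDerivAt t hw
  have h3 : Complex.normSq (w t) ≠ 0 := Complex.normSq_eq_zero.not.2 h0
  have h4 : (w t).re * (w t).re + (w t).im * (w t).im ≠ 0 := by
    rwa [← Complex.normSq_apply]
  have h5 := (((h1.fun_mul h1).fun_add (h2.fun_mul h2)).log h4).div_const 2
  have h6 : (fun s => Real.log ‖w s‖) =
      fun s => Real.log ((w s).re * (w s).re + (w s).im * (w s).im) / 2 := by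
    funext s
    rw [← Complex.normSq_apply, Complex.normSq_eq_norm_sq, Real.log_pow]
    push_cast
    ring
  rw [h6]
  refine h5.congr_deriv ?_
  rw [Complex.div_re, Complex.normSq_apply]
  field_simp
  ring

theorem hasDerivAt_radial (c d : ℂ) (r : ℝ) :
    HasDerivAt (fun r : ℝ => c * ((r : ℂ) * d)) (c * d) r := by
  have h := ((Complex.ofRealCLM.hasDerivAt (x := r)).mul_const d).const_mul c
  simpa using h

theorem one_sub_conj_mul_ne_zero {a z : ℂ} (ha : a ∈ ball (0 : ℂ) 1)
    (hz : z ∈ closedBall (0 : ℂ) 1) : 1 - (starRingEnd ℂ) a * z ≠ 0 := by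
  rw [mem_ball_zero_iff] at ha
  rw [mem_closedBall_zero_iff] at hz
  intro h
  have h2 : ‖(starRingEnd ℂ) a * z‖ = 1 := by rw [← sub_eq_zero.1 h, norm_one]
  rw [norm_mul, RCLike.norm_conj] at h2
  nlinarith [norm_nonneg a, norm_nonneg z]

theorem circle_sub_ne_zero {a : ℂ} (ha : a ∈ ball (0 : ℂ) 1) (z : Circle) : (z : ℂ) - a ≠ 0 := by
  intro h
  rw [← sub_eq_zero.1 h, mem_ball_zero_iff, z.norm_coe] at ha
  exact lt_irrefl _ ha

theorem one_sub_conj_mul_circle (a : ℂ) (z : Circle) :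
    1 - (starRingEnd ℂ) a * z = z * (starRingEnd ℂ) (z - a) := by
  have h : (z : ℂ) * (starRingEnd ℂ) (z : ℂ) = 1 := by
    rw [Complex.mul_conj, Circle.normSq_coe, Complex.ofReal_one]
  rw [map_sub, mul_sub, h]
  ring

theorem norm_one_sub_conj_mul_circle (a : ℂ) (z : Circle) :
    ‖1 - (starRingEnd ℂ) a * z‖ = ‖(z : ℂ) - a‖ := by
  rw [one_sub_conj_mul_circle, norm_mul, Circle.norm_coe, one_mul, RCLike.norm_conj]

/-- On the circle, `ā z / (1 - ā z)` is the conjugate of `a / (z - a)`. -/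
theorem conj_mul_div_circle (a : ℂ) (z : Circle) :
    (starRingEnd ℂ) a * z / (1 - (starRingEnd ℂ) a * z) = (starRingEnd ℂ) (a / (z - a)) := by
  rw [one_sub_conj_mul_circle, map_div₀, mul_comm, mul_div_mul_left _ _ z.coe_ne_zero]

theorem circle_div_sub {a : ℂ} (ha : a ∈ ball (0 : ℂ) 1) (z : Circle) :
    (z : ℂ) / (z - a) = 1 + a / (z - a) := by
  have := circle_sub_ne_zero ha z
  field_simp
  ring

theorem one_sub_conj_mul_mem_slitPlane {a x : ℂ} (ha : a ∈ ball (0 : ℂ) 1)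
    (hx : x ∈ closedBall (0 : ℂ) 1) : 1 - (starRingEnd ℂ) a * x ∈ Complex.slitPlane := by
  left
  rw [mem_ball_zero_iff] at ha
  rw [mem_closedBall_zero_iff] at hx
  have h1 : ‖(starRingEnd ℂ) a * x‖ < 1 := by
    rw [norm_mul, RCLike.norm_conj]
    nlinarith [norm_nonneg a, norm_nonneg x]
  have h2 := (Complex.re_le_norm ((starRingEnd ℂ) a * x)).trans_lt h1
  rw [Complex.sub_re, Complex.one_re]
  linarith

theorem diffContOnCl_log {a : ℂ} (ha : a ∈ ball (0 : ℂ) 1) :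
    DiffContOnCl ℂ (fun x : ℂ => Complex.log (1 - (starRingEnd ℂ) a * x)) (ball 0 1) := by
  apply DifferentiableOn.diffContOnCl
  rw [closure_unitBall]
  intro x hx
  apply DifferentiableAt.differentiableWithinAt
  exact DifferentiableAt.clog (by fun_prop) (one_sub_conj_mul_mem_slitPlane ha hx)

theorem harmonicContOnCl_log_norm {a : ℂ} (ha : a ∈ ball (0 : ℂ) 1) :
    HarmonicContOnCl (fun x : ℂ => Real.log ‖1 - (starRingEnd ℂ) a * x‖) (ball 0 1) := by
  have h := harmonicContOnCl_re (diffContOnCl_log ha)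
  simpa only [Complex.log_re] using h

section Explicit

variable {β : ℝ≥0}

/-- The explicit regular part of the Neumann problem. -/
def regPart (a : ℂ) (ψ : C1Holder β) (x : ℂ) : ℝ :=
  Real.log ‖1 - (starRingEnd ℂ) a * x‖ - (schwarzExt ψ x).im

theorem harmonicContOnCl_regPart (hβ0 : 0 < β) (hβ1 : β < 1) {a : ℂ} (ha : a ∈ ball (0 : ℂ) 1)
    (ψ : C1Holder β) : HarmonicContOnCl (regPart a ψ) (ball 0 1) :=
  (harmonicContOnCl_log_norm ha).sub (harmonicContOnCl_im (ψ.schwarzExt_diffContOnCl hβ0 hβ1))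

theorem wedge_I_mul (k : ℝ) (u : ℂ) : wedge u (Complex.I * k * u) = k * ‖u‖ ^ 2 := by
  rw [← Complex.normSq_eq_norm_sq, Complex.normSq_apply, wedge]
  simp
  ring

theorem current_eq_of_hasDerivAt {g : Circle → Circle} {k : Circle → ℝ}
    (h : ∀ t : ℝ, HasDerivAt (fun s : ℝ => (g (Circle.exp s) : ℂ))
      (Complex.I * k (Circle.exp t) * g (Circle.exp t)) t) (z : Circle) : current g z = k z := by
  have h1 := congrFun (tangDeriv_eq (f := fun w => (g w : ℂ))
    (d := fun w => Complex.I * k w * g w) h) z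
  rw [current, h1, wedge_I_mul, Circle.norm_coe, one_pow, mul_one]

theorem hasDerivAt_twist (c : Circle) {ψ : Circle → ℝ} (hψ : IsC1 ψ) (t : ℝ) :
    HasDerivAt (fun s : ℝ => (twist (fun z => c * z) ψ (Circle.exp s) : ℂ))
      (Complex.I * ((1 + tangDeriv ψ (Circle.exp t) : ℝ) : ℂ) *
        twist (fun z => c * z) ψ (Circle.exp t)) t := by
  have h1 := (hasDerivAt_coe_exp t).const_mul (c : ℂ)
  have h2 := ((hψ.hasDerivAt_exp t).ofReal_comp.mul_const Complex.I).cexp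
  have h3 := h1.mul h2
  simp only [twist, Circle.coe_mul, Circle.coe_exp (ψ _)]
  refine h3.congr_deriv ?_
  push_cast
  ring

theorem current_twist (c : Circle) {ψ : Circle → ℝ} (hψ : IsC1 ψ) (z : Circle) :
    current (twist (fun z => c * z) ψ) z = 1 + tangDeriv ψ z :=
  current_eq_of_hasDerivAt (k := fun z => 1 + tangDeriv ψ z) (hasDerivAt_twist c hψ) z

theorem hasNormalDeriv_log_norm_sub {a : ℂ} (ha : a ∈ ball (0 : ℂ) 1) (z : Circle) :
    HasNormalDeriv (fun x => Real.log ‖x - a‖) ((z : ℂ) / (z - a)).re z := by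
  have h1 : HasDerivAt (fun r : ℝ => (r : ℂ) * (z : ℂ) - a) z 1 := by
    simpa using (hasDerivAt_radial 1 z 1).sub_const a
  have h2 := hasDerivAt_log_norm h1 (by simpa using circle_sub_ne_zero ha z)
  rw [Complex.ofReal_one, one_mul] at h2
  exact h2.hasDerivWithinAt

theorem hasNormalDeriv_log_norm_one_sub {a : ℂ} (ha : a ∈ ball (0 : ℂ) 1) (z : Circle) :
    HasNormalDeriv (fun x => Real.log ‖1 - (starRingEnd ℂ) a * x‖) (-(a / (z - a)).re) z := by
  have h1 : HasDerivAt (fun r : ℝ => 1 - (starRingEnd ℂ) a * ((r : ℂ) * (z : ℂ)))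
      (-((starRingEnd ℂ) a * z)) 1 :=
    (hasDerivAt_radial ((starRingEnd ℂ) a) z 1).const_sub 1
  have h2 := hasDerivAt_log_norm h1
    (by simpa using one_sub_conj_mul_ne_zero ha (Circle_mem_closedBall z))
  rw [Complex.ofReal_one, one_mul, neg_div, conj_mul_div_circle, Complex.neg_re,
    Complex.conj_re] at h2
  exact h2.hasDerivWithinAt

theorem hasNormalDeriv_im_schwarzExt (hβ0 : 0 < β) (hβ1 : β < 1) (ψ : C1Holder β) (z : Circle) :
    HasNormalDeriv (fun x => (schwarzExt ψ x).im) (-tangDeriv ψ z) z := by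
  have h := Complex.imCLM.hasFDerivAt.comp_hasDerivWithinAt (1 : ℝ)
    (ψ.hasNormalDeriv_schwarzExt hβ0 hβ1 z)
  refine HasDerivWithinAt.congr_deriv h ?_
  have h1 := (C1Holder.tang ψ).re_schwarzExt hβ0 hβ1 z
  rw [C1Holder.tang_apply] at h1
  rw [← h1]
  simp

theorem hasNormalDeriv_re_schwarzExt (hβ0 : 0 < β) (hβ1 : β < 1) (ψ : C1Holder β) (z : Circle) :
    HasNormalDeriv (fun x => (schwarzExt ψ x).re) (schwarzExt (C1Holder.tang ψ) z).im z := by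
  have h := Complex.reCLM.hasFDerivAt.comp_hasDerivWithinAt (1 : ℝ)
    (ψ.hasNormalDeriv_schwarzExt hβ0 hβ1 z)
  refine HasDerivWithinAt.congr_deriv h ?_
  simp

/-- The image term `log |1 - ā x|` brings the normal derivative of `log |x - a|` to the constant
`1`, and `-Im F` contributes `ψ'` by the Cauchy–Riemann equations. On the circle the two logarithms
coincide, so the mean is that of a harmonic function vanishing at `0`. -/
theorem isNeumannRegularPart_regPart (hβ0 : 0 < β) (hβ1 : β < 1) {a : ℂ}
    (ha : a ∈ ball (0 : ℂ) 1) (c : Circle) (ψ : C1Holder β) :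
    IsNeumannRegularPart a (twist (fun z => c * z) ψ) (regPart a ψ) := by
  refine ⟨harmonicContOnCl_regPart hβ0 hβ1 ha ψ, fun z => ?_, ?_⟩
  · have h1 := (hasNormalDeriv_log_norm_sub ha z).fun_add
      ((hasNormalDeriv_log_norm_one_sub ha z).fun_sub (hasNormalDeriv_im_schwarzExt hβ0 hβ1 ψ z))
    refine HasDerivWithinAt.congr_deriv h1 ?_
    rw [current_twist c ψ.isC1, circle_div_sub ha, Complex.add_re, Complex.one_re]
    ring
  · have h1 := circleInt_eq (fun x => Real.log ‖1 - (starRingEnd ℂ) a * x‖ + regPart a ψ x)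
    have h2 : HarmonicContOnCl (fun x => Real.log ‖1 - (starRingEnd ℂ) a * x‖ + regPart a ψ x)
        (ball 0 |1|) := by
      rw [abs_one]
      exact (harmonicContOnCl_log_norm ha).add (harmonicContOnCl_regPart hβ0 hβ1 ha ψ)
    rw [h2.circleAverage_eq] at h1
    simp only [norm_one_sub_conj_mul_circle] at h1
    rw [h1]
    simp [regPart, ψ.im_schwarzExt_zero hβ0 hβ1]

/-- After integration by parts, the tangential derivative of the logarithm is `-Im (a / (z - a))`,
which is minus half the imaginary part of the Herglotz kernel `1 + 2 a / (z - a)`. -/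
theorem circleInt_log_mul_tangDeriv {a : ℂ} (ha : a ∈ ball (0 : ℂ) 1) (ψ : C1Holder β) :
    circleInt (fun z => Real.log ‖1 - (starRingEnd ℂ) a * z‖ * tangDeriv ψ z) =
      Real.pi * (schwarz ψ a).im := by
  have hne : ∀ t : ℝ, 1 - (starRingEnd ℂ) a * (Circle.exp t : ℂ) ≠ 0 := fun t =>
    one_sub_conj_mul_ne_zero ha (Circle_mem_closedBall _)
  have hu : ∀ t ∈ uIcc 0 (2 * Real.pi), HasDerivAt
      (fun t : ℝ => Real.log ‖1 - (starRingEnd ℂ) a * (Circle.exp t : ℂ)‖)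
      ((starRingEnd ℂ) a * (Circle.exp t : ℂ) / (1 - (starRingEnd ℂ) a * (Circle.exp t : ℂ))).im
      t := by
    intro t _
    have h1 := hasDerivAt_log_norm
      (((hasDerivAt_coe_exp t).const_mul ((starRingEnd ℂ) a)).const_sub 1) (hne t)
    refine h1.congr_deriv ?_
    have : -((starRingEnd ℂ) a * (Complex.I * (Circle.exp t : ℂ))) /
        (1 - (starRingEnd ℂ) a * (Circle.exp t : ℂ)) = -Complex.I *
        ((starRingEnd ℂ) a * (Circle.exp t : ℂ) / (1 - (starRingEnd ℂ) a * (Circle.exp t : ℂ))) := by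
      ring
    rw [this]
    simp only [Complex.mul_re, Complex.neg_re, Complex.I_re, Complex.neg_im, Complex.I_im]
    ring
  have hc : Continuous fun t : ℝ => ((starRingEnd ℂ) a * (Circle.exp t : ℂ) /
      (1 - (starRingEnd ℂ) a * (Circle.exp t : ℂ))).im :=
    Complex.continuous_im.comp (Continuous.div (by fun_prop) (by fun_prop) hne)
  have h := intervalIntegral.integral_mul_deriv_eq_deriv_mul hu
    (fun t _ => ψ.isC1.hasDerivAt_exp t) (hc.intervalIntegrable _ _)
    ((ψ.isC1.2.comp Circle.exp.continuous).intervalIntegrable _ _)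
  rw [circleInt, h, Circle.exp_two_pi, Circle.exp_zero, sub_self, zero_sub]
  have h2 := Complex.imCLM.circleAverage_comp_comm (circleIntegrable_schwarz ψ.continuous ha)
  rw [Complex.imCLM_apply] at h2
  rw [schwarz, ← h2, Real.circleAverage_def, smul_eq_mul, ← mul_assoc,
    ← intervalIntegral.integral_neg, ← intervalIntegral.integral_const_mul]
  apply intervalIntegral.integral_congr
  intro t _
  have hpi := Real.pi_ne_zero
  simp only [Function.comp_apply, Complex.imCLM_apply, circleMap_zero_one, onPlane_coe,
    smul_eq_mul, Complex.im_mul_ofReal, herglotzRieszKernel_def, sub_zero]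
  have h3 : ((Circle.exp t : ℂ) + a) / ((Circle.exp t : ℂ) - a) =
      1 + 2 * (a / ((Circle.exp t : ℂ) - a)) := by
    have := circle_sub_ne_zero ha (Circle.exp t)
    field_simp
    ring
  have h4 : (2 * (a / ((Circle.exp t : ℂ) - a))).im = 2 * (a / ((Circle.exp t : ℂ) - a)).im := by
    simp
  rw [h3, conj_mul_div_circle, Complex.add_im, Complex.one_im, h4, Complex.conj_im]
  field_simp
  ring

/-- The part of the renormalized energy which does not depend on the singularity. -/
def energyConst (ψ : C1Holder β) : ℝ :=
  -(1 / 2) * circleInt (fun z => (schwarzExt ψ z).im * tangDeriv ψ z)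

/-- On the circle `Φ = 2 log |1 - ā z| - Im F` and the current is `1 + ψ'`. The `1` contributes
nothing because `Φ` has zero mean. The boundary term and `-π R(a)` each contribute `π Im F(a)`. -/
theorem W_twist (hβ0 : 0 < β) (hβ1 : β < 1) {a : ℂ} (ha : a ∈ ball (0 : ℂ) 1) (c : Circle)
    (ψ : C1Holder β) : W a (twist (fun z => c * z) ψ) =
      energyConst ψ - Real.pi * Real.log (1 - Complex.normSq a) +
        2 * Real.pi * (schwarz ψ a).im := by
  have hR := (isNeumannRegularPart_regPart hβ0 hβ1 ha c ψ)
  have hEq := hR.neumannR_eqOn ha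
  have ha' : ‖a‖ < 1 := by simpa using ha
  have h1 : neumannR a (twist (fun z => c * z) ψ) a =
      Real.log (1 - Complex.normSq a) - (schwarz ψ a).im := by
    rw [hEq (ball_subset_closedBall ha), regPart, schwarzExt_eqOn ψ.continuous ha,
      ← Complex.normSq_eq_conj_mul_self, ← Complex.ofReal_one, ← Complex.ofReal_sub,
      Complex.norm_real, Real.norm_eq_abs, Real.log_abs]
  have h2 : circleInt (fun z => neumannPhi a (twist (fun z => c * z) ψ) z *
      current (twist (fun z => c * z) ψ) z) =
      circleInt (fun z => Real.log ‖(z : ℂ) - a‖ + regPart a ψ z) +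
        (2 * circleInt (fun z => Real.log ‖1 - (starRingEnd ℂ) a * z‖ * tangDeriv ψ z) -
          circleInt (fun z => (schwarzExt ψ z).im * tangDeriv ψ z)) := by
    have c1 : Continuous fun z : Circle => Real.log ‖1 - (starRingEnd ℂ) a * z‖ :=
      (harmonicContOnCl_log_norm ha).continuousOn_ball.comp_continuous continuous_induced_dom
        Circle_mem_closedBall
    have c2 : Continuous fun z : Circle => (schwarzExt ψ z).im :=
      (harmonicContOnCl_im (ψ.schwarzExt_diffContOnCl hβ0 hβ1)).continuousOn_ball.comp_continuous
        continuous_induced_dom Circle_mem_closedBall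
    have c3 : Continuous fun z : Circle => regPart a ψ z :=
      hR.1.continuousOn_ball.comp_continuous continuous_induced_dom Circle_mem_closedBall
    have i : ∀ {f : Circle → ℝ}, Continuous f → IntervalIntegrable
        (fun t : ℝ => f (Circle.exp t)) volume 0 (2 * Real.pi) := fun hf =>
      (hf.comp Circle.exp.continuous).intervalIntegrable _ _
    have i1 : IntervalIntegrable (fun t : ℝ => 2 * (Real.log
        ‖1 - (starRingEnd ℂ) a * (Circle.exp t : ℂ)‖ * tangDeriv ψ (Circle.exp t))) volume 0
        (2 * Real.pi) := (i (c1.mul ψ.isC1.2)).const_mul 2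
    have i2 : IntervalIntegrable (fun t : ℝ => (schwarzExt ψ (Circle.exp t)).im *
        tangDeriv ψ (Circle.exp t)) volume 0 (2 * Real.pi) := i (c2.mul ψ.isC1.2)
    have i3 : IntervalIntegrable (fun t : ℝ => Real.log ‖(Circle.exp t : ℂ) - a‖ +
        regPart a ψ (Circle.exp t)) volume 0 (2 * Real.pi) :=
      i ((continuous_log_norm_sub ha).add c3)
    simp only [circleInt]
    rw [← intervalIntegral.integral_const_mul, ← intervalIntegral.integral_sub i1 i2,
      ← intervalIntegral.integral_add i3 (i1.sub i2)]
    apply intervalIntegral.integral_congr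
    intro t _
    simp only
    rw [neumannPhi, hEq (Circle_mem_closedBall _), current_twist c ψ.isC1,
      ← norm_one_sub_conj_mul_circle, regPart]
    ring
  rw [W, h2, hR.2.2, circleInt_log_mul_tangDeriv ha, h1, energyConst]
  ring

end Explicit

/-! ## The gradient and the Hessian of the renormalized energy -/

/-- The linear form on `ℂ ≃ ℝ²` represented by `2π q`. -/
def gradForm : ℂ →L[ℝ] ℂ →L[ℝ] ℝ :=
  (2 * Real.pi) • (ContinuousLinearMap.compL ℝ ℂ ℂ ℝ Complex.reCLM).comp
    (ContinuousLinearMap.mul ℝ ℂ)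

theorem gradForm_apply (q w : ℂ) : gradForm q w = 2 * Real.pi * (q * w).re := rfl

theorem gradForm_eq_zero_iff {q : ℂ} : gradForm q = 0 ↔ q = 0 := by
  refine ⟨fun h => ?_, fun h => by rw [h, map_zero]⟩
  have h1 : gradForm q ((starRingEnd ℂ) q) = 0 := by rw [h]; rfl
  rw [gradForm_apply, Complex.mul_conj, Complex.ofReal_re] at h1
  have := Real.pi_pos
  rcases mul_eq_zero.1 h1 with h2 | h2
  · linarith
  · exact Complex.normSq_eq_zero.1 h2

/-- The conjugate of the gradient of the renormalized energy, divided by `2π`. -/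
def gradField (ψ : Circle → ℝ) (b : ℂ) : ℂ :=
  (1 - Complex.normSq b)⁻¹ • (starRingEnd ℂ) b - Complex.I * deriv (schwarz ψ) b

theorem one_sub_normSq_pos {b : ℂ} (hb : b ∈ ball (0 : ℂ) 1) : 0 < 1 - Complex.normSq b := by
  rw [mem_ball_zero_iff] at hb
  rw [Complex.normSq_eq_norm_sq]
  nlinarith [norm_nonneg b]

theorem hasFDerivAt_normSq (b : ℂ) : HasFDerivAt (fun x : ℂ => Complex.normSq x)
    ((2 : ℝ) • innerSL ℝ b) b := by
  have h := (hasStrictFDerivAt_norm_sq b).hasFDerivAt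
  have e : (fun x : ℂ => Complex.normSq x) = fun x => ‖x‖ ^ 2 :=
    funext fun x => Complex.normSq_eq_norm_sq x
  rw [e]
  refine h.congr_fderiv ?_
  ext
  all_goals simp [two_smul]

theorem innerSL_apply_eq (b v : ℂ) : innerSL ℝ b v = ((starRingEnd ℂ) b * v).re := by
  rw [innerSL_apply_apply, Complex.inner, mul_comm]

section Energy

variable {β : ℝ≥0}

theorem W_eventuallyEq (hβ0 : 0 < β) (hβ1 : β < 1) {b : ℂ} (hb : b ∈ ball (0 : ℂ) 1)
    (c : Circle) (ψ : C1Holder β) : (fun a => W a (twist (fun z => c * z) ψ)) =ᶠ[𝓝 b]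
      fun a => energyConst ψ - Real.pi * Real.log (1 - Complex.normSq a) +
        2 * Real.pi * (schwarz ψ a).im := by
  filter_upwards [isOpen_ball.mem_nhds hb] with a ha
  exact W_twist hβ0 hβ1 ha c ψ

theorem hasFDerivAt_W (hβ0 : 0 < β) (hβ1 : β < 1) {b : ℂ} (hb : b ∈ ball (0 : ℂ) 1)
    (c : Circle) (ψ : C1Holder β) :
    HasFDerivAt (fun a => W a (twist (fun z => c * z) ψ)) (gradForm (gradField ψ b)) b := by
  have h1 := ((hasFDerivAt_normSq b).const_sub 1).log (one_sub_normSq_pos hb).ne'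
  have h2 := ((hasDerivAt_schwarz ψ.continuous hb).differentiableAt.hasDerivAt.hasFDerivAt
    |>.restrictScalars ℝ)
  have h3 := Complex.imCLM.hasFDerivAt.comp b h2
  have h4 := ((h1.const_mul Real.pi).const_sub (energyConst ψ)).add (h3.const_mul (2 * Real.pi))
  refine (h4.congr_fderiv ?_).congr_of_eventuallyEq (W_eventuallyEq hβ0 hβ1 hb c ψ)
  apply ContinuousLinearMap.ext
  intro v
  rw [gradForm_apply, gradField, sub_mul, Complex.sub_re, smul_mul_assoc, Complex.smul_re,
    ← innerSL_apply_eq]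
  simp
  ring

theorem differentiableAt_deriv_schwarz {ψ : Circle → ℝ} (hψ : Continuous ψ) {b : ℂ}
    (hb : b ∈ ball (0 : ℂ) 1) : DifferentiableAt ℂ (deriv (schwarz ψ)) b :=
  ((differentiableOn_schwarz hψ).deriv isOpen_ball).differentiableAt (isOpen_ball.mem_nhds hb)

theorem exists_hasFDerivAt_gradField {ψ : Circle → ℝ} (hψ : Continuous ψ) {b : ℂ}
    (hb : b ∈ ball (0 : ℂ) 1) : ∃ Q : ℂ →L[ℝ] ℂ, HasFDerivAt (gradField ψ) Q b ∧
      ∀ v, Q v = (1 - Complex.normSq b)⁻¹ • (starRingEnd ℂ) v +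
        (2 * ((starRingEnd ℂ) b * v).re / (1 - Complex.normSq b) ^ 2) • (starRingEnd ℂ) b -
          Complex.I * (deriv (deriv (schwarz ψ)) b * v) := by
  have h0 := (one_sub_normSq_pos hb).ne'
  have h1 := ((hasFDerivAt_normSq b).const_sub 1)
  have h2 := (hasDerivAt_inv h0).comp_hasFDerivAt b h1
  have h3 := h2.smul Complex.conjCLE.hasFDerivAt
  have h4 := (((differentiableAt_deriv_schwarz hψ hb).hasDerivAt.const_mul
    Complex.I).hasFDerivAt.restrictScalars ℝ)
  refine ⟨_, h3.sub h4, fun v => ?_⟩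
  simp only [sub_apply, add_apply, smul_apply, ContinuousLinearMap.smulRight_apply, neg_apply,
    innerSL_apply_eq]
  simp
  ring_nf

theorem fderiv_W_eventuallyEq (hβ0 : 0 < β) (hβ1 : β < 1) {b : ℂ} (hb : b ∈ ball (0 : ℂ) 1)
    (c : Circle) (ψ : C1Holder β) :
    fderiv ℝ (fun a => W a (twist (fun z => c * z) ψ)) =ᶠ[𝓝 b]
      fun a => gradForm (gradField ψ a) := by
  filter_upwards [isOpen_ball.mem_nhds hb] with a ha
  exact (hasFDerivAt_W hβ0 hβ1 ha c ψ).fderiv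

theorem hessW_apply (hβ0 : 0 < β) (hβ1 : β < 1) {b : ℂ} (hb : b ∈ ball (0 : ℂ) 1)
    (c : Circle) (ψ : C1Holder β) (v w : ℂ) :
    hessW (twist (fun z => c * z) ψ) b v w = 2 * Real.pi *
      (((1 - Complex.normSq b)⁻¹ • (starRingEnd ℂ) v +
        (2 * ((starRingEnd ℂ) b * v).re / (1 - Complex.normSq b) ^ 2) • (starRingEnd ℂ) b -
          Complex.I * (deriv (deriv (schwarz ψ)) b * v)) * w).re := by
  obtain ⟨Q, hQ, hQv⟩ := exists_hasFDerivAt_gradField ψ.continuous hb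
  have h1 := (gradForm.hasFDerivAt.comp b hQ).congr_of_eventuallyEq
    (fderiv_W_eventuallyEq hβ0 hβ1 hb c ψ)
  rw [hessW, h1.fderiv, ContinuousLinearMap.comp_apply, gradForm_apply, hQv]

theorem contDiffAt_W (hβ0 : 0 < β) (hβ1 : β < 1) {b : ℂ} (hb : b ∈ ball (0 : ℂ) 1)
    (c : Circle) (ψ : C1Holder β) :
    ContDiffAt ℝ 2 (fun a => W a (twist (fun z => c * z) ψ)) b := by
  refine ContDiffAt.congr_of_eventuallyEq ?_ (W_eventuallyEq hβ0 hβ1 hb c ψ)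
  have h1 : ContDiffAt ℝ 2 (fun x : ℂ => Complex.normSq x) b := by
    have e : (fun x : ℂ => Complex.normSq x) = fun x => ‖x‖ ^ 2 :=
      funext fun x => Complex.normSq_eq_norm_sq x
    rw [e]
    exact (contDiff_norm_sq ℝ).contDiffAt
  have h2 : ContDiffAt ℝ 2 (schwarz ψ) b :=
    (((differentiableOn_schwarz ψ.continuous).analyticAt
      (isOpen_ball.mem_nhds hb)).contDiffAt (n := 2)).restrict_scalars ℝ
  have h3 : ContDiffAt ℝ 2 (fun a => (schwarz ψ a).im) b :=
    Complex.imCLM.contDiff.contDiffAt.comp b h2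
  have h4 := (contDiffAt_const (c := (1 : ℝ))).sub h1 |>.log (one_sub_normSq_pos hb).ne'
  exact (contDiffAt_const.sub (contDiffAt_const.mul h4)).add (contDiffAt_const.mul h3)

theorem isCriticalPoint_iff (hβ0 : 0 < β) (hβ1 : β < 1) {b : ℂ} (hb : b ∈ ball (0 : ℂ) 1)
    (c : Circle) (ψ : C1Holder β) :
    IsCriticalPoint (twist (fun z => c * z) ψ) b ↔ gradField ψ b = 0 := by
  have h := hasFDerivAt_W hβ0 hβ1 hb c ψ
  refine ⟨fun h1 => gradForm_eq_zero_iff.1 (h.unique h1.2), fun h1 => ⟨hb, ?_⟩⟩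
  rwa [h1, map_zero] at h

theorem norm_deriv_schwarz_le_eight {ψ : Circle → ℝ} (hψ : Continuous ψ) {M : ℝ}
    (hM : ∀ z, |ψ z| ≤ M) {w : ℂ} (hw : ‖w‖ ≤ 1 / 2) : ‖deriv (schwarz ψ) w‖ ≤ 8 * M := by
  have h := norm_deriv_schwarz_le_norm hψ hM (by norm_num : (1 / 2 : ℝ) < 1) hw
  norm_num at h
  exact h

/-- Cauchy's estimate on the circle of radius `1/4` about `w`, which lies in the disc of radius
`1/2` where the first derivative is at most `8 M`. -/
theorem norm_deriv_deriv_schwarz_le {ψ : Circle → ℝ} (hψ : Continuous ψ) {M : ℝ}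
    (hM : ∀ z, |ψ z| ≤ M) {w : ℂ} (hw : ‖w‖ ≤ 1 / 4) :
    ‖deriv (deriv (schwarz ψ)) w‖ ≤ 32 * M := by
  have hsub : closedBall w (1 / 4) ⊆ ball 0 1 := by
    intro x hx
    rw [mem_closedBall, dist_eq_norm] at hx
    rw [mem_ball_zero_iff]
    have := norm_sub_norm_le x w
    linarith
  have h := Complex.norm_deriv_le_of_forall_mem_sphere_norm_le (c := w) (R := 1 / 4)
    (f := deriv (schwarz ψ)) (C := 8 * M) (by norm_num)
    ((((differentiableOn_schwarz hψ).deriv isOpen_ball).mono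
      (by rwa [closure_ball _ (by norm_num)])).diffContOnCl) (fun z hz => ?_)
  · linarith
  · apply norm_deriv_schwarz_le_eight hψ hM
    rw [mem_sphere, dist_eq_norm] at hz
    have := norm_sub_norm_le z w
    linarith

/-- The Hessian is positive definite: up to the factor `2π`, the logarithmic term contributes at
least `‖v‖²` to the quadratic form, while the harmonic term is at most `32 ‖ψ‖ ‖v‖² < ‖v‖²`. -/
theorem isNondegenerateCriticalPoint (hβ0 : 0 < β) (hβ1 : β < 1) {b : ℂ} (hb : ‖b‖ ≤ 1 / 4)
    (c : Circle) {ψ : C1Holder β} (hψ : ‖ψ‖ < 1 / 32) (h0 : gradField ψ b = 0) :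
    IsNondegenerateCriticalPoint (twist (fun z => c * z) ψ) b := by
  have hb1 : b ∈ ball (0 : ℂ) 1 := by
    rw [mem_ball_zero_iff]
    linarith
  refine ⟨(isCriticalPoint_iff hβ0 hβ1 hb1 c ψ).2 h0, contDiffAt_W hβ0 hβ1 hb1 c ψ, ?_⟩
  rw [injective_iff_map_eq_zero]
  intro v hv
  have h1 : hessW (twist (fun z => c * z) ψ) b v v = 0 := by rw [hv]; rfl
  rw [hessW_apply hβ0 hβ1 hb1] at h1
  have h2 := norm_deriv_deriv_schwarz_le ψ.continuous ψ.abs_apply_le hb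
  have hpos := one_sub_normSq_pos hb1
  set S := deriv (deriv (schwarz ψ)) b
  set k := 1 - Complex.normSq b
  have hk1 : 1 ≤ k⁻¹ := by
    rw [one_le_inv₀ hpos]
    have := Complex.normSq_nonneg b
    simp only [k]
    linarith
  have e1 : ((k⁻¹ • (starRingEnd ℂ) v + (2 * ((starRingEnd ℂ) b * v).re / k ^ 2) •
      (starRingEnd ℂ) b - Complex.I * (S * v)) * v).re =
      k⁻¹ * ‖v‖ ^ 2 + 2 * ((starRingEnd ℂ) b * v).re ^ 2 / k ^ 2 -
        (Complex.I * (S * v) * v).re := by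
    rw [sub_mul, add_mul, Complex.sub_re, Complex.add_re, smul_mul_assoc, smul_mul_assoc,
      Complex.smul_re, Complex.smul_re, ← Complex.normSq_eq_conj_mul_self, Complex.ofReal_re,
      Complex.normSq_eq_norm_sq, smul_eq_mul, smul_eq_mul]
    ring
  rw [e1] at h1
  have h3 : (Complex.I * (S * v) * v).re ≤ ‖S‖ * ‖v‖ ^ 2 := by
    refine (Complex.re_le_norm _).trans (le_of_eq ?_)
    rw [norm_mul, norm_mul, norm_mul, Complex.norm_I]
    ring
  have hpi := Real.pi_pos
  have h4 : k⁻¹ * ‖v‖ ^ 2 + 2 * ((starRingEnd ℂ) b * v).re ^ 2 / k ^ 2 -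
        (Complex.I * (S * v) * v).re = 0 := by
    rcases mul_eq_zero.1 h1 with h | h
    · linarith
    · exact h
  have h5 : 0 ≤ 2 * ((starRingEnd ℂ) b * v).re ^ 2 / k ^ 2 := by positivity
  have h6 : 1 * ‖v‖ ^ 2 ≤ k⁻¹ * ‖v‖ ^ 2 := mul_le_mul_of_nonneg_right hk1 (by positivity)
  have h7 : (1 - ‖S‖) * ‖v‖ ^ 2 ≤ 0 := by linarith
  have h8 : 0 < 1 - ‖S‖ := by linarith
  have h9 : ‖v‖ ^ 2 ≤ 0 := by
    by_contra h
    push Not at h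
    have := mul_pos h8 h
    linarith
  have h10 : ‖v‖ = 0 := pow_eq_zero_iff two_ne_zero |>.1 (le_antisymm h9 (by positivity))
  exact norm_eq_zero.1 h10

theorem schwarz_zero_fun {w : ℂ} : schwarz (fun _ => 0) w = 0 := by
  have : schwarz (fun _ => 0) w = Real.circleAverage (fun _ => (0 : ℂ)) 0 1 := by
    apply circleAverage_congr_circle
    intro z
    simp [onPlane]
  rw [this, Real.circleAverage_const]

theorem schwarz_coe_zero : schwarz (0 : C1Holder β) = fun _ => 0 :=
  funext fun _ => schwarz_zero_fun

theorem hessW_zero (hβ0 : 0 < β) (hβ1 : β < 1) (c : Circle) (v w : ℂ) :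
    hessW (twist (fun z => c * z) (0 : C1Holder β)) 0 v w = 2 * Real.pi * inner ℝ v w := by
  have h0 : (0 : ℂ) ∈ ball (0 : ℂ) 1 := by simp
  rw [hessW_apply hβ0 hβ1 h0, schwarz_coe_zero, Complex.inner]
  simp
  ring

theorem gradField_zero : gradField (0 : C1Holder β) 0 = 0 := by
  rw [gradField, schwarz_coe_zero]
  simp

/-! ## The branch of critical points -/

/-- The fixed points of this map are the zeros of `gradField ψ`. -/
def critMap (ψ : Circle → ℝ) (b : ℂ) : ℂ :=
  (starRingEnd ℂ) ((1 - Complex.normSq b) • (Complex.I * deriv (schwarz ψ) b))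

theorem gradField_eq_zero_iff {ψ : Circle → ℝ} {b : ℂ} (hb : b ∈ ball (0 : ℂ) 1) :
    gradField ψ b = 0 ↔ critMap ψ b = b := by
  have h0 := (one_sub_normSq_pos hb).ne'
  rw [gradField, sub_eq_zero, inv_smul_eq_iff₀ h0, critMap]
  constructor
  · intro h
    rw [← h, Complex.conj_conj]
  · intro h
    conv_lhs => rw [← h]
    rw [Complex.conj_conj]

theorem norm_deriv_schwarz_sub_le {ψ : Circle → ℝ} (hψ : Continuous ψ) {M : ℝ}
    (hM : ∀ z, |ψ z| ≤ M) {a b : ℂ} (ha : ‖a‖ ≤ 1 / 4) (hb : ‖b‖ ≤ 1 / 4) :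
    ‖deriv (schwarz ψ) a - deriv (schwarz ψ) b‖ ≤ 32 * M * ‖a - b‖ := by
  apply (convex_closedBall (0 : ℂ) (1 / 4)).norm_image_sub_le_of_norm_deriv_le
    (𝕜 := ℂ) (f := deriv (schwarz ψ))
  · intro x hx
    rw [mem_closedBall_zero_iff] at hx
    exact differentiableAt_deriv_schwarz hψ (by rw [mem_ball_zero_iff]; linarith)
  · intro x hx
    rw [mem_closedBall_zero_iff] at hx
    exact norm_deriv_deriv_schwarz_le hψ hM hx
  · rwa [mem_closedBall_zero_iff]
  · rwa [mem_closedBall_zero_iff]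

theorem norm_critMap_le {ψ : Circle → ℝ} (hψ : Continuous ψ) {M : ℝ}
    (hM : ∀ z, |ψ z| ≤ M) {b : ℂ} (hb : ‖b‖ ≤ 1 / 4) : ‖critMap ψ b‖ ≤ 8 * M := by
  have h1 := norm_deriv_schwarz_le_eight hψ hM (hb.trans (by norm_num))
  have h2 := one_sub_normSq_pos (b := b) (by rw [mem_ball_zero_iff]; linarith)
  have h3 := Complex.normSq_nonneg b
  rw [critMap, RCLike.norm_conj, norm_smul, norm_mul, Complex.norm_I, one_mul, Real.norm_eq_abs,
    abs_of_pos h2]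
  calc (1 - Complex.normSq b) * ‖deriv (schwarz ψ) b‖ ≤ 1 * ‖deriv (schwarz ψ) b‖ :=
        mul_le_mul_of_nonneg_right (by linarith) (norm_nonneg _)
    _ ≤ 8 * M := by rwa [one_mul]

/-- Splitting the difference of products gives `36 = 32 + 8 / 2`: a Lipschitz bound for the
derivative, plus its size times the bound `‖a‖ + ‖b‖ ≤ 1/2` for the squared norms. -/
theorem norm_critMap_sub_le {ψ : Circle → ℝ} (hψ : Continuous ψ) {M : ℝ}
    (hM : ∀ z, |ψ z| ≤ M) {a b : ℂ} (ha : ‖a‖ ≤ 1 / 4) (hb : ‖b‖ ≤ 1 / 4) :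
    ‖critMap ψ a - critMap ψ b‖ ≤ 36 * M * ‖a - b‖ := by
  have h1 := norm_deriv_schwarz_sub_le hψ hM ha hb
  have h2 := norm_deriv_schwarz_le_eight hψ hM (hb.trans (by norm_num))
  have hM0 : 0 ≤ M := (abs_nonneg _).trans (hM 1)
  set A := deriv (schwarz ψ) a
  set B := deriv (schwarz ψ) b
  have e : critMap ψ a - critMap ψ b = (starRingEnd ℂ) (Complex.I *
      ((1 - Complex.normSq a) • (A - B) + (Complex.normSq b - Complex.normSq a) • B)) := by
    rw [critMap, critMap, ← map_sub]
    congr 1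
    simp only [Complex.real_smul]
    push_cast
    ring
  have h3 : |1 - Complex.normSq a| ≤ 1 := by
    have h5 := one_sub_normSq_pos (b := a) (by rw [mem_ball_zero_iff]; linarith)
    rw [abs_of_pos h5]
    have := Complex.normSq_nonneg a
    linarith
  have h4 : |Complex.normSq b - Complex.normSq a| ≤ 1 / 2 * ‖a - b‖ := by
    rw [Complex.normSq_eq_norm_sq, Complex.normSq_eq_norm_sq, sq_sub_sq, abs_mul,
      abs_of_nonneg (by positivity)]
    apply mul_le_mul (by linarith) _ (abs_nonneg _) (by norm_num)
    rw [norm_sub_rev]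
    exact abs_norm_sub_norm_le b a
  rw [e, RCLike.norm_conj, norm_mul, Complex.norm_I, one_mul]
  refine (norm_add_le _ _).trans ?_
  rw [norm_smul, norm_smul, Real.norm_eq_abs, Real.norm_eq_abs]
  have h5 := mul_le_mul h3 h1 (norm_nonneg _) zero_le_one
  have h6 := mul_le_mul h4 h2 (norm_nonneg _) (by positivity)
  linarith

/-- Banach's fixed point theorem: `M ≤ 1/72` makes the Lipschitz constant `36 M` at most `1/2`, and
`8 M ≤ 1/9` keeps the ball of radius `1/4` invariant. -/
theorem exists_critMap_fixedPoint {ψ : Circle → ℝ} (hψ : Continuous ψ) {M : ℝ}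
    (hM : ∀ z, |ψ z| ≤ M) (hM1 : M ≤ 1 / 72) : ∃ b : ℂ, ‖b‖ ≤ 1 / 4 ∧ critMap ψ b = b := by
  have hmaps : MapsTo (critMap ψ) (closedBall 0 (1 / 4)) (closedBall 0 (1 / 4)) := by
    intro b hb
    rw [mem_closedBall_zero_iff] at hb ⊢
    have := norm_critMap_le hψ hM hb
    linarith
  have hcontr : ContractingWith (1 / 2) (hmaps.restrict (critMap ψ) _ _) := by
    refine ⟨by rw [← NNReal.coe_lt_coe]; norm_num, LipschitzWith.of_dist_le_mul fun a b => ?_⟩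
    rw [Subtype.dist_eq, Subtype.dist_eq, dist_eq_norm, dist_eq_norm]
    have h := norm_critMap_sub_le hψ hM (mem_closedBall_zero_iff.1 a.2)
      (mem_closedBall_zero_iff.1 b.2)
    refine h.trans (mul_le_mul_of_nonneg_right ?_ (norm_nonneg _))
    push_cast
    linarith
  obtain ⟨y, hy, hfix, -⟩ := ContractingWith.exists_fixedPoint' (x := 0)
    isClosed_closedBall.isComplete hmaps hcontr (mem_closedBall_self (by norm_num))
    (edist_ne_top _ _)
  exact ⟨y, mem_closedBall_zero_iff.1 hy, hfix⟩

theorem critMap_fixedPoint_unique {ψ : Circle → ℝ} (hψ : Continuous ψ) {M : ℝ}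
    (hM : ∀ z, |ψ z| ≤ M) (hM1 : M ≤ 1 / 72) {a b : ℂ} (ha : ‖a‖ ≤ 1 / 4) (hb : ‖b‖ ≤ 1 / 4)
    (ha' : critMap ψ a = a) (hb' : critMap ψ b = b) : a = b := by
  have h := norm_critMap_sub_le hψ hM ha hb
  rw [ha', hb'] at h
  have h2 : 36 * M * ‖a - b‖ ≤ 1 / 2 * ‖a - b‖ :=
    mul_le_mul_of_nonneg_right (by linarith) (norm_nonneg _)
  have h3 : ‖a - b‖ = 0 := le_antisymm (by linarith) (norm_nonneg _)
  exact sub_eq_zero.1 (norm_eq_zero.1 h3)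

open Classical in
/-- The critical point of the renormalized energy near the origin (`0` if there is none). -/
def critPt (ψ : Circle → ℝ) : ℂ :=
  if h : ∃ b : ℂ, ‖b‖ ≤ 1 / 4 ∧ critMap ψ b = b then h.choose else 0

theorem critPt_spec {ψ : C1Holder β} (hψ : ‖ψ‖ ≤ 1 / 72) :
    ‖critPt ψ‖ ≤ 1 / 4 ∧ critMap ψ (critPt ψ) = critPt ψ := by
  have h := exists_critMap_fixedPoint ψ.continuous ψ.abs_apply_le hψ
  rw [critPt, dif_pos h]
  exact h.choose_spec

theorem norm_critPt_le {ψ : C1Holder β} (hψ : ‖ψ‖ ≤ 1 / 72) : ‖critPt ψ‖ ≤ 8 * ‖ψ‖ := by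
  have h := critPt_spec hψ
  rw [← h.2]
  exact norm_critMap_le ψ.continuous ψ.abs_apply_le h.1

theorem isCriticalBranch_critPt (hβ0 : 0 < β) (hβ1 : β < 1) (c : Circle) :
    IsCriticalBranch β 0 (fun z => c * z) (fun ψ => critPt ψ) := by
  refine ⟨1 / 4, by norm_num, ?_⟩
  filter_upwards [closedBall_mem_nhds (0 : C1Holder β) (by norm_num : (0 : ℝ) < 1 / 72)] with ψ hψ
  rw [mem_closedBall_zero_iff] at hψ
  have h := critPt_spec hψ
  have h2 := norm_critPt_le hψ
  have hb : critPt ψ ∈ ball (0 : ℂ) 1 := by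
    rw [mem_ball_zero_iff]
    linarith
  refine ⟨by rw [mem_ball_zero_iff]; linarith, ?_, ?_⟩
  · exact isNondegenerateCriticalPoint hβ0 hβ1 h.1 c (by linarith)
      ((gradField_eq_zero_iff hb).2 h.2)
  · intro b hb1 hb2
    rw [mem_ball_zero_iff] at hb1
    have hb3 := (isCriticalPoint_iff hβ0 hβ1 hb2.1 c ψ).1 hb2
    exact critMap_fixedPoint_unique ψ.continuous ψ.abs_apply_le hψ hb1.le h.1
      ((gradField_eq_zero_iff hb2.1).1 hb3) h.2

theorem tendsto_critPt : Tendsto (fun ψ : C1Holder β => critPt ψ) (𝓝 0) (𝓝 0) := by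
  have h : Tendsto (fun ψ : C1Holder β => 8 * ‖ψ‖) (𝓝 0) (𝓝 0) := by
    have : Continuous fun ψ : C1Holder β => 8 * ‖ψ‖ := by fun_prop
    simpa using this.tendsto 0
  refine squeeze_zero_norm' ?_ h
  filter_upwards [closedBall_mem_nhds (0 : C1Holder β) (by norm_num : (0 : ℝ) < 1 / 72)] with ψ hψ
  exact norm_critPt_le (mem_closedBall_zero_iff.1 hψ)

/-- A given branch comes with its own radius, unrelated to `1/4`. As `critPt ψ` tends to `0`, it
eventually lies in that ball, where the critical point is unique. -/
theorem IsCriticalBranch.eventually_eq (hβ0 : 0 < β) (hβ1 : β < 1) {c : Circle}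
    {a : C1Holder β → ℂ} (ha : IsCriticalBranch β 0 (fun z => c * z) a) :
    ∀ᶠ ψ : C1Holder β in 𝓝 0, critPt ψ = a ψ := by
  obtain ⟨r, hr, h1⟩ := ha
  obtain ⟨r', hr', h2⟩ := isCriticalBranch_critPt (β := β) hβ0 hβ1 c
  filter_upwards [h1, h2, tendsto_critPt.eventually (ball_mem_nhds (0 : ℂ) hr)] with ψ h3 h4 h5
  exact h3.2.2 _ h5 h4.2.1.1

/-- The identity `mul_deriv_schwarz` carries a factor `w`, so it is differentiated at `0` to recover
the value there. -/
theorem I_mul_deriv_schwarz_zero (ψ : C1Holder β) :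
    Complex.I * deriv (schwarz ψ) 0 = derivZero (C1Holder.diff ψ) := by
  have h0 : (0 : ℂ) ∈ ball (0 : ℂ) 1 := by simp
  have h1 : HasDerivAt (fun w => w * deriv (schwarz ψ) w) (deriv (schwarz ψ) 0) 0 := by
    have h := (hasDerivAt_id' (0 : ℂ)).fun_mul
      (differentiableAt_deriv_schwarz ψ.continuous h0).hasDerivAt
    simpa using h
  have h2 : HasDerivAt (fun w => -Complex.I * schwarz (tangDeriv ψ) w)
      (-Complex.I * derivZero (C1Holder.diff ψ)) 0 :=
    ((hasDerivAt_schwarz ψ.isC1.2 h0).differentiableAt.hasDerivAt).const_mul _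
  have h3 : (fun w => w * deriv (schwarz ψ) w) =ᶠ[𝓝 0]
      fun w => -Complex.I * schwarz (tangDeriv ψ) w := by
    filter_upwards [isOpen_ball.mem_nhds h0] with w hw
    exact mul_deriv_schwarz ψ.continuous ψ.isC1 hw
  have h4 := (h2.congr_of_eventuallyEq h3).unique h1
  rw [← h4, ← mul_assoc]
  simp

/-- The linear approximation is the conjugate of the first iterate `critMap ψ 0`. The error is at
most the Lipschitz constant `36 ‖ψ‖` times `‖critPt ψ‖ ≤ 8 ‖ψ‖`, and `36 · 8 = 288`. -/
theorem norm_conj_critPt_sub_le {ψ : C1Holder β} (hψ : ‖ψ‖ ≤ 1 / 72) :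
    ‖(starRingEnd ℂ) (critPt ψ) - derivZero (C1Holder.diff ψ)‖ ≤ 288 * ‖ψ‖ ^ 2 := by
  have h := critPt_spec hψ
  have h2 := norm_critPt_le hψ
  have h3 := norm_critMap_sub_le ψ.continuous ψ.abs_apply_le h.1 (b := 0) (by norm_num)
  have h4 : critMap ψ 0 = (starRingEnd ℂ) (derivZero (C1Holder.diff ψ)) := by
    rw [critMap, ← I_mul_deriv_schwarz_zero]
    simp
  rw [h.2, h4, sub_zero] at h3
  rw [← RCLike.norm_conj, map_sub, Complex.conj_conj]
  calc _ ≤ 36 * ‖ψ‖ * ‖critPt ψ‖ := h3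
    _ ≤ 36 * ‖ψ‖ * (8 * ‖ψ‖) := mul_le_mul_of_nonneg_left h2 (by positivity)
    _ = _ := by ring

end Energy

/-! ## The normal current of the canonical harmonic map -/

theorem HasNormalDeriv.unique {E : Type*} [NormedAddCommGroup E] [NormedSpace ℝ E] {f g : ℂ → E}
    {v w : E} {z : Circle} (hf : HasNormalDeriv f v z) (hg : HasNormalDeriv g w z)
    (h : EqOn f g (closedBall 0 1)) : v = w := by
  have h1 : (fun r : ℝ => f ((r : ℂ) * z)) =ᶠ[𝓝[Iic 1] 1] fun r : ℝ => g ((r : ℂ) * z) := by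
    filter_upwards [self_mem_nhdsWithin,
      mem_nhdsWithin_of_mem_nhds (Ioi_mem_nhds (zero_lt_one (α := ℝ)))] with r hr1 hr0
    apply h
    rw [mem_closedBall_zero_iff, norm_mul, z.norm_coe, mul_one, Complex.norm_real,
      Real.norm_of_nonneg (le_of_lt hr0)]
    exact hr1
  have h2 := HasDerivWithinAt.congr_of_eventuallyEq hg h1 (h1.self_of_nhdsWithin self_mem_Iic)
  exact (uniqueDiffWithinAt_Iic 1).eq_deriv _ hf h2

/-- Writing `w / |w| = w e^{-log |w|}` shows that the real part of the logarithmic derivative `w' /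
w` cancels. -/
theorem hasDerivAt_div_norm {w : ℝ → ℂ} {w' : ℂ} {t : ℝ} (hw : HasDerivAt w w' t)
    (h0 : w t ≠ 0) : HasDerivAt (fun s => w s / (‖w s‖ : ℂ))
      (Complex.I * (w' / w t).im * (w t / (‖w t‖ : ℂ))) t := by
  have h1 := hw.fun_mul ((hasDerivAt_log_norm hw h0).ofReal_comp.fun_neg.cexp)
  have key : ∀ x : ℂ, x ≠ 0 → Complex.exp (-(Real.log ‖x‖ : ℂ)) = (‖x‖ : ℂ)⁻¹ := by
    intro x hx
    rw [Complex.exp_neg, ← Complex.ofReal_exp, Real.exp_log (norm_pos_iff.2 hx)]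
  have h2 : (fun s => w s / (‖w s‖ : ℂ)) =ᶠ[𝓝 t]
      fun s => w s * Complex.exp (-(Real.log ‖w s‖ : ℂ)) := by
    filter_upwards [hw.continuousAt.eventually_ne h0] with s hs
    rw [key _ hs, div_eq_mul_inv]
  refine (h1.congr_of_eventuallyEq h2).congr_deriv ?_
  rw [key _ h0]
  have h3 : w' = w t * (((w' / w t).re : ℂ) + (w' / w t).im * Complex.I) := by
    rw [Complex.re_add_im, mul_div_cancel₀ _ h0]
  conv_lhs => enter [1]; rw [h3]
  ring

/-! ### Uniqueness of the canonical harmonic map and of its normal current. -/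

section Unique

variable {a : ℂ} {g : Circle → Circle}

theorem exists_int_of_exp_eq {D : Circle → ℝ} (hD : Continuous D)
    (h : ∀ z, Circle.exp (D z) = 1) : ∃ n : ℤ, ∀ z, D z = n * (2 * Real.pi) := by
  have h1 : ∀ z, ∃ n : ℤ, D z = n * (2 * Real.pi) := by
    intro z
    obtain ⟨n, hn⟩ := Circle.exp_eq_exp.1 ((h z).trans Circle.exp_zero.symm)
    exact ⟨n, by rw [hn, zero_add]⟩
  choose n hn using h1
  have hpi : (2 * Real.pi) ≠ 0 := by positivity
  have h2 : Continuous n := by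
    rw [Int.isClosedEmbedding_coe_real.isEmbedding.continuous_iff]
    have e : ((fun k : ℤ => (k : ℝ)) ∘ n) = fun z => D z / (2 * Real.pi) := by
      funext z
      rw [hn z, mul_div_cancel_right₀ _ hpi]
      rfl
    rw [e]
    exact hD.div_const _
  refine ⟨n 1, fun z => ?_⟩
  obtain ⟨t, rfl⟩ := Circle.exp_surjective z
  have h3 := PreconnectedSpace.constant (inferInstance : PreconnectedSpace ℝ)
    (h2.comp Circle.exp.continuous) (x := t) (y := 0)
  simp only [Function.comp_apply, Circle.exp_zero] at h3
  rw [hn, h3]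

/-- Two phases need only agree modulo `2π` on the circle. By continuity their difference there is a
single multiple of `2π`, and harmonicity carries this constant into the disc. -/
theorem IsCanonicalHarmonicMap.eqOn (ha : a ∈ ball (0 : ℂ) 1) {u v : ℂ → ℂ}
    (hu : IsCanonicalHarmonicMap a g u) (hv : IsCanonicalHarmonicMap a g v) :
    EqOn u v (closedBall 0 1) := by
  obtain ⟨H, hH, hu1, hu2⟩ := hu
  obtain ⟨K, hK, hv1, hv2⟩ := hv
  have hcirc : ∀ {F : ℂ → ℝ}, HarmonicContOnCl F (ball 0 1) →
      Continuous fun z : Circle => F z := fun hF =>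
    (hF.continuousOn.mono (by rw [closure_unitBall])).comp_continuous continuous_subtype_val
      Circle_mem_closedBall
  have h1 : ∀ z : Circle, Circle.exp (H z - K z) = 1 := by
    intro z
    have h2 := (hu1 z (Circle_mem_closedBall z)).symm.trans
      ((hu2 z).trans ((hv2 z).symm.trans (hv1 z (Circle_mem_closedBall z))))
    have h3 := circle_sub_ne_zero ha z
    have h4 := mul_left_cancel₀
      (div_ne_zero h3 (Complex.ofReal_ne_zero.2 (norm_ne_zero_iff.2 h3))) h2
    rw [Circle.exp_sub, div_eq_one]
    apply Circle.ext
    rw [Circle.coe_exp, Circle.coe_exp, mul_comm, h4, mul_comm]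
  obtain ⟨n, hn⟩ := exists_int_of_exp_eq ((hcirc hH).sub (hcirc hK)) h1
  have h5 := eqOn_closedBall_of_eq_circle (hH.sub hK)
    (harmonicContOnCl_re (diffContOnCl_const (c := ((n * (2 * Real.pi) : ℝ) : ℂ)))) hn
  intro x hx
  have h6 : H x = K x + n * (2 * Real.pi) := by
    have := h5 hx
    simp only [Pi.sub_apply, Complex.ofReal_re] at this
    linarith
  rw [hu1 x hx, hv1 x hx, h6]
  congr 1
  rw [Complex.exp_eq_exp_iff_exists_int]
  refine ⟨n, ?_⟩
  push_cast
  ring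

theorem HasN.unique (ha : a ∈ ball (0 : ℂ) 1) {s t : Circle → ℝ} (hs : HasN a g s)
    (ht : HasN a g t) : s = t := by
  obtain ⟨u, hu, hu1⟩ := hs
  obtain ⟨v, hv, hv1⟩ := ht
  have h := hu.eqOn ha hv
  funext z
  obtain ⟨p, hp, hp1⟩ := hu1 z
  obtain ⟨q, hq, hq1⟩ := hv1 z
  rw [hp1, hq1, h (Circle_mem_closedBall z), hp.unique hq h]

end Unique

/-! ### The explicit canonical harmonic map. -/

section Existence

variable {β : ℝ≥0}

/-- The phase of the canonical harmonic map with boundary datum `z ↦ e^{iγ} z e^{iψ}`. -/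
def phase (a : ℂ) (γ : ℝ) (ψ : Circle → ℝ) (x : ℂ) : ℝ :=
  γ + (schwarzExt ψ x).re + (Complex.log (1 - (starRingEnd ℂ) a * x)).im

/-- On the circle `1 - ā z = z · conj (z - a)`, so the phase `arg (1 - ā x)` turns `(z - a) / |z -
a|` into `z`. This phase and the factor `(x - a) / |x - a|` each contribute `-Im (ā z / (1 - ā z))`
to the normal current, which explains the `2`; `Re F` contributes the conjugate function of `ψ'`. -/
theorem hasN_twist (hβ0 : 0 < β) (hβ1 : β < 1) {a : ℂ} (ha : a ∈ ball (0 : ℂ) 1) (c : Circle)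
    (ψ : C1Holder β) : HasN a (twist (fun z => c * z) ψ) (fun z =>
      (schwarzExt (C1Holder.tang ψ) z).im -
        2 * ((starRingEnd ℂ) a * z / (1 - (starRingEnd ℂ) a * z)).im) := by
  obtain ⟨γ, rfl⟩ := Circle.exp_surjective c
  have hcirc : ∀ z : Circle, (z - a) / (‖(z : ℂ) - a‖ : ℂ) *
      Complex.exp (Complex.I * (phase a γ ψ z : ℂ)) =
        twist (fun z => Circle.exp γ * z) ψ z := by
    intro z
    have h1 := one_sub_conj_mul_ne_zero ha (Circle_mem_closedBall z)
    have h2 := Complex.norm_mul_exp_arg_mul_I (1 - (starRingEnd ℂ) a * z)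
    have h3 : (‖(z : ℂ) - a‖ : ℂ) ≠ 0 :=
      Complex.ofReal_ne_zero.2 (norm_ne_zero_iff.2 (circle_sub_ne_zero ha z))
    have h4 : ((z : ℂ) - a) * (starRingEnd ℂ) (z - a) = (‖(z : ℂ) - a‖ : ℂ) ^ 2 :=
      Complex.mul_conj' _
    rw [norm_one_sub_conj_mul_circle] at h2
    have h5 : Complex.exp (Complex.I * (phase a γ ψ z : ℂ)) = Complex.exp (γ * Complex.I) *
        Complex.exp (ψ z * Complex.I) *
          Complex.exp ((1 - (starRingEnd ℂ) a * z).arg * Complex.I) := by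
      rw [← Complex.exp_add, ← Complex.exp_add, phase, ψ.re_schwarzExt hβ0 hβ1, Complex.log_im]
      congr 1
      push_cast
      ring
    rw [h5, twist, Circle.coe_mul, Circle.coe_mul, Circle.coe_exp, Circle.coe_exp]
    rw [one_sub_conj_mul_circle] at h2 ⊢
    set E := Complex.exp (((z : ℂ) * (starRingEnd ℂ) (z - a)).arg * Complex.I)
    have h6 : ((z : ℂ) - a) / (‖(z : ℂ) - a‖ : ℂ) * E = z := by
      rw [div_mul_eq_mul_div, div_eq_iff h3]
      apply mul_left_cancel₀ h3
      linear_combination ((z : ℂ) - a) * h2 + (z : ℂ) * h4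
    linear_combination (Complex.exp (γ * Complex.I) * Complex.exp (ψ z * Complex.I)) * h6
  refine ⟨fun x => (x - a) / (‖x - a‖ : ℂ) * Complex.exp (Complex.I * (phase a γ ψ x : ℂ)),
    ⟨phase a γ ψ, ?_, fun z _ => rfl, hcirc⟩, fun z => ?_⟩
  · exact ((harmonicContOnCl_re (diffContOnCl_const (c := (γ : ℂ)))).add
      (harmonicContOnCl_re (ψ.schwarzExt_diffContOnCl hβ0 hβ1))).add
        (harmonicContOnCl_im (diffContOnCl_log ha))
  · have h1 : HasDerivAt (fun r : ℝ => (r : ℂ) * (z : ℂ) - a) z 1 := by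
      simpa using (hasDerivAt_radial 1 z 1).sub_const a
    have h2 := hasDerivAt_div_norm h1 (by simpa using circle_sub_ne_zero ha z)
    have h3 : HasDerivAt (fun r : ℝ => 1 - (starRingEnd ℂ) a * ((r : ℂ) * (z : ℂ)))
        (-((starRingEnd ℂ) a * z)) 1 :=
      (hasDerivAt_radial ((starRingEnd ℂ) a) z 1).const_sub 1
    have h4 := h3.clog_real
      (by simpa using one_sub_conj_mul_mem_slitPlane ha (Circle_mem_closedBall z))
    have h5 := Complex.imCLM.hasFDerivAt.comp_hasDerivAt (1 : ℝ) h4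
    have h6 := (((hasNormalDeriv_re_schwarzExt hβ0 hβ1 ψ z).const_add γ).fun_add
      h5.hasDerivWithinAt).ofReal_comp.const_mul Complex.I |>.cexp
    have h7 := h2.hasDerivWithinAt.fun_mul h6
    have hu : ‖(z - a) / (‖(z : ℂ) - a‖ : ℂ) *
        Complex.exp (Complex.I * (phase a γ ψ z : ℂ))‖ = 1 := by
      rw [hcirc, Circle.norm_coe]
    set k := (schwarzExt (C1Holder.tang ψ) z).im -
      2 * ((starRingEnd ℂ) a * z / (1 - (starRingEnd ℂ) a * z)).im with hk
    set u := (z - a) / (‖(z : ℂ) - a‖ : ℂ) * Complex.exp (Complex.I * (phase a γ ψ z : ℂ))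
    refine ⟨Complex.I * k * u, h7.congr_deriv ?_, ?_⟩
    · rw [Complex.ofReal_one, one_mul, circle_div_sub ha]
      have h8 : (a / ((z : ℂ) - a)).im =
          -((starRingEnd ℂ) a * z / (1 - (starRingEnd ℂ) a * z)).im := by
        rw [conj_mul_div_circle, Complex.conj_im, neg_neg]
      rw [Complex.add_im, h8, neg_div, hk]
      simp [u, phase]
      ring
    · rw [wedge_I_mul, hu, one_pow, mul_one]

end Existence

/-! ## The operator `U_*` near the origin -/

section Tail

variable {β : ℝ≥0}

theorem norm_sq_div_one_sub_le {s : ℂ} {r : ℝ} (hr : r ≤ 1 / 4) (hs : ‖s‖ = r) :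
    ‖s ^ 2 / (1 - s)‖ ≤ 3 / 2 * r ^ 2 := by
  have h1 : 3 / 4 ≤ ‖1 - s‖ := by
    have := norm_sub_norm_le (1 : ℂ) s
    rw [norm_one] at this
    linarith
  rw [norm_div, norm_pow, hs, div_le_iff₀ (by linarith)]
  nlinarith [sq_nonneg r]

/-- The difference factors through `s - t` with a cofactor of size `r`. For `s = ā z` and `t = ā w`
the factor `s - t` carries a second power of `‖a‖`, so the Hölder seminorm of the tail is quadratic.
-/
theorem norm_sq_div_one_sub_sub_le {s t : ℂ} {r : ℝ} (hr : r ≤ 1 / 4) (hs : ‖s‖ = r)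
    (ht : ‖t‖ = r) : ‖s ^ 2 / (1 - s) - t ^ 2 / (1 - t)‖ ≤ 4 * r * ‖s - t‖ := by
  have hr0 : 0 ≤ r := hs ▸ norm_nonneg s
  have h1 : ∀ x : ℂ, ‖x‖ = r → 3 / 4 ≤ ‖1 - x‖ := by
    intro x hx
    have := norm_sub_norm_le (1 : ℂ) x
    rw [norm_one] at this
    linarith
  have h2 : ∀ x : ℂ, ‖x‖ = r → 1 - x ≠ 0 := fun x hx =>
    norm_pos_iff.1 (lt_of_lt_of_le (by norm_num) (h1 x hx))
  have hs1 := h2 s hs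
  have ht1 := h2 t ht
  have e : s ^ 2 / (1 - s) - t ^ 2 / (1 - t) = (s + t - s * t) * (s - t) / ((1 - s) * (1 - t)) := by
    field_simp
    ring
  have h3 : ‖s + t - s * t‖ ≤ 9 / 4 * r := by
    refine (norm_sub_le _ _).trans ?_
    have := norm_add_le s t
    rw [norm_mul, hs, ht]
    rw [hs, ht] at this
    nlinarith
  have h4 : 9 / 16 ≤ ‖1 - s‖ * ‖1 - t‖ := by
    have := mul_le_mul (h1 s hs) (h1 t ht) (by norm_num) (norm_nonneg _)
    linarith
  rw [e, norm_div, norm_mul, norm_mul, div_le_iff₀ (by linarith)]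
  calc ‖s + t - s * t‖ * ‖s - t‖ ≤ 9 / 4 * r * ‖s - t‖ :=
        mul_le_mul_of_nonneg_right h3 (norm_nonneg _)
    _ = 4 * r * ‖s - t‖ * (9 / 16) := by ring
    _ ≤ _ := mul_le_mul_of_nonneg_left h4 (by positivity)

/-- The constant is `19 = 3 + 16`: a supremum of `2 · 3/2` and a Hölder constant of `2 · 4 · 2`, the
last factor coming from `norm_circle_sub_le`. The mean is zero because the function is the real part
of a holomorphic function vanishing at `0`. -/
theorem exists_tail (hβ0 : 0 < β) (hβ1 : β < 1) {a : ℂ} (ha : ‖a‖ ≤ 1 / 4) :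
    ∃ f : CHolderDot β, (∀ z : Circle, f.1 z =
      -2 * (((starRingEnd ℂ) a * z) ^ 2 / (1 - (starRingEnd ℂ) a * z)).im) ∧
        ‖f‖ ≤ 19 * ‖a‖ ^ 2 := by
  have ha1 : a ∈ ball (0 : ℂ) 1 := by
    rw [mem_ball_zero_iff]
    linarith
  have hn : ∀ z : Circle, ‖(starRingEnd ℂ) a * z‖ = ‖a‖ := by
    intro z
    rw [norm_mul, RCLike.norm_conj, z.norm_coe, mul_one]
  have h1 : ∀ z w : Circle,
      |-2 * (((starRingEnd ℂ) a * z) ^ 2 / (1 - (starRingEnd ℂ) a * z)).im -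
        -2 * (((starRingEnd ℂ) a * w) ^ 2 / (1 - (starRingEnd ℂ) a * w)).im| ≤
          16 * ‖a‖ ^ 2 * ‖(z : ℂ) - w‖ ^ (β : ℝ) := by
    intro z w
    have h2 := norm_sq_div_one_sub_sub_le ha (hn z) (hn w)
    rw [← mul_sub, ← Complex.sub_im, abs_mul]
    have h3 := (Complex.abs_im_le_norm _).trans h2
    rw [← mul_sub, norm_mul, RCLike.norm_conj] at h3
    have h4 := mul_le_mul_of_nonneg_left (norm_circle_sub_le hβ0 hβ1 z w) (sq_nonneg ‖a‖)
    rw [abs_neg, abs_two]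
    linarith
  have h2 : DiffContOnCl ℂ (fun x : ℂ => (2 * Complex.I) *
      (((starRingEnd ℂ) a * x) ^ 2 / (1 - (starRingEnd ℂ) a * x))) (ball 0 1) := by
    apply DifferentiableOn.diffContOnCl
    rw [closure_unitBall]
    intro x hx
    apply DifferentiableAt.differentiableWithinAt
    have h3 := one_sub_conj_mul_ne_zero ha1 hx
    fun_prop (disch := assumption)
  have h5 : ∃ C : ℝ≥0, ∀ z w : Circle,
      |-2 * (((starRingEnd ℂ) a * z) ^ 2 / (1 - (starRingEnd ℂ) a * z)).im -
        -2 * (((starRingEnd ℂ) a * w) ^ 2 / (1 - (starRingEnd ℂ) a * w)).im| ≤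
          C * ‖(z : ℂ) - w‖ ^ (β : ℝ) := ⟨16 * ‖a‖₊ ^ 2, by simpa using h1⟩
  refine ⟨⟨CHolder.ofBound hβ0 _ h5, ?_⟩, fun z => rfl, ?_⟩
  · rw [mem_CHolderDot_iff, circleAverage_onPlane_eq_of_harmonic (harmonicContOnCl_re h2)]
    · simp
    · intro z
      rw [CHolder.ofBound_apply]
      simp
  · have h6 := CHolder.norm_le (f := CHolder.ofBound hβ0 _ h5) (A := 3 * ‖a‖ ^ 2)
      (B := 16 * ‖a‖ ^ 2) (by positivity) (fun z => ?_) h1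
    · change ‖CHolder.ofBound hβ0 _ h5‖ ≤ _
      linarith
    · rw [CHolder.ofBound_apply, abs_mul]
      have h7 := (Complex.abs_im_le_norm _).trans (norm_sq_div_one_sub_le ha (hn z))
      norm_num
      linarith

open Classical in
/-- The function `z ↦ -2 Im ((ā z)² / (1 - ā z))` on the circle (`0` if `‖a‖ > 1/4`). -/
def tail (hβ0 : 0 < β) (hβ1 : β < 1) (a : ℂ) : CHolderDot β :=
  if h : ‖a‖ ≤ 1 / 4 then (exists_tail hβ0 hβ1 h).choose else 0

theorem tail_apply (hβ0 : 0 < β) (hβ1 : β < 1) {a : ℂ} (ha : ‖a‖ ≤ 1 / 4) (z : Circle) :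
    (tail hβ0 hβ1 a).1 z =
      -2 * (((starRingEnd ℂ) a * z) ^ 2 / (1 - (starRingEnd ℂ) a * z)).im := by
  rw [tail, dif_pos ha]
  exact (exists_tail hβ0 hβ1 ha).choose_spec.1 z

theorem norm_tail_le (hβ0 : 0 < β) (hβ1 : β < 1) {a : ℂ} (ha : ‖a‖ ≤ 1 / 4) :
    ‖tail hβ0 hβ1 a‖ ≤ 19 * ‖a‖ ^ 2 := by
  rw [tail, dif_pos ha]
  exact (exists_tail hβ0 hβ1 ha).choose_spec.2

end Tail

section Operator

variable {β : ℝ≥0}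

/-- The normal current of the canonical harmonic map with singularity `critPt ψ`. -/
def normalCurrent (hβ0 : 0 < β) (hβ1 : β < 1) (ψ : C1Holder β) : CHolderDot β :=
  hilbert hβ0 hβ1 (C1Holder.diff ψ) +
    mode hβ0 hβ1 (2 * Complex.I * (starRingEnd ℂ) (critPt ψ)) + tail hβ0 hβ1 (critPt ψ)

/-- With `s = ā z`, the splitting `s / (1 - s) = s + s² / (1 - s)` separates the first mode from the
quadratic tail. -/
theorem hasN_normalCurrent (hβ0 : 0 < β) (hβ1 : β < 1) (c : Circle) {ψ : C1Holder β}
    (hψ : ‖ψ‖ ≤ 1 / 72) :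
    HasN (critPt ψ) (twist (fun z => c * z) ψ) (normalCurrent hβ0 hβ1 ψ).1 := by
  have ha := (critPt_spec hψ).1
  have ha1 : critPt ψ ∈ ball (0 : ℂ) 1 := by
    rw [mem_ball_zero_iff]
    linarith
  have h := hasN_twist hβ0 hβ1 ha1 c ψ
  convert h using 1
  funext z
  change (hilbert hβ0 hβ1 (C1Holder.diff ψ)).1 z +
    (mode hβ0 hβ1 (2 * Complex.I * (starRingEnd ℂ) (critPt ψ))).1 z +
      (tail hβ0 hβ1 (critPt ψ)).1 z = _
  rw [tail_apply hβ0 hβ1 ha, mode_apply, hilbert_apply, C1Holder.coe_diff]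
  have h1 := one_sub_conj_mul_ne_zero ha1 (Circle_mem_closedBall z)
  set s := (starRingEnd ℂ) (critPt ψ) * z with hs
  have h2 : s / (1 - s) = s + s ^ 2 / (1 - s) := by
    field_simp
    ring
  have h3 : (2 * Complex.I * (starRingEnd ℂ) (critPt ψ) * (z : ℂ)).re = -2 * s.im := by
    rw [mul_assoc, ← hs]
    simp
  rw [h3, h2, Complex.add_im]
  ring

theorem hasFDerivAt_normalCurrent (hβ0 : 0 < β) (hβ1 : β < 1) :
    HasFDerivAt (normalCurrent hβ0 hβ1)
      ((conjFlipEquiv hβ0 hβ1 : CHolderDot β →L[ℝ] CHolderDot β).comp C1Holder.diff) 0 := by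
  set L := (conjFlipEquiv hβ0 hβ1 : CHolderDot β →L[ℝ] CHolderDot β).comp C1Holder.diff
  have h1 : (fun ψ => normalCurrent hβ0 hβ1 ψ - L ψ) =O[𝓝 0]
      fun ψ : C1Holder β => ‖ψ - 0‖ ^ 2 := by
    -- The remainder consists of the error in the linearized position, `2 · 288` through the factor
    -- `2 i`, and of the tail, `19 · 8²` through `‖critPt ψ‖ ≤ 8 ‖ψ‖`.
    refine Asymptotics.IsBigO.of_bound (‖mode (β := β) hβ0 hβ1‖ * (2 * 288) + 19 * 64) ?_
    filter_upwards [closedBall_mem_nhds (0 : C1Holder β) (by norm_num : (0 : ℝ) < 1 / 72)]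
      with ψ hψ
    rw [mem_closedBall_zero_iff] at hψ
    have e : normalCurrent hβ0 hβ1 ψ - L ψ = mode hβ0 hβ1 (2 * Complex.I *
        ((starRingEnd ℂ) (critPt ψ) - derivZero (C1Holder.diff ψ))) +
          tail hβ0 hβ1 (critPt ψ) := by
      have e1 : L ψ = hilbert hβ0 hβ1 (C1Holder.diff ψ) +
          mode hβ0 hβ1 (2 * Complex.I * derivZero (C1Holder.diff ψ)) :=
        conjFlipEquiv_apply hβ0 hβ1 _
      rw [e1, normalCurrent, mul_sub, map_sub]
      abel
    rw [e, sub_zero, norm_pow, norm_norm, add_mul]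
    refine (norm_add_le _ _).trans (add_le_add ?_ ?_)
    · refine ((mode hβ0 hβ1).le_opNorm _).trans ?_
      rw [mul_assoc ‖mode (β := β) hβ0 hβ1‖]
      refine mul_le_mul_of_nonneg_left ?_ (norm_nonneg (mode (β := β) hβ0 hβ1))
      rw [norm_mul, norm_mul, Complex.norm_I, mul_one, Complex.norm_ofNat, mul_assoc]
      exact mul_le_mul_of_nonneg_left (norm_conj_critPt_sub_le hψ) zero_le_two
    · refine (norm_tail_le hβ0 hβ1 (critPt_spec hψ).1).trans ?_
      have h2 := pow_le_pow_left₀ (norm_nonneg _) (norm_critPt_le hψ) 2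
      nlinarith
  have h2 := (h1.hasFDerivAt one_lt_two).add L.hasFDerivAt
  rw [zero_add] at h2
  refine h2.congr_of_eventuallyEq (Eventually.of_forall fun ψ => ?_)
  simp

/-- By `mul_deriv_schwarz` the derivative of the Schwarz integral depends only on the tangential
derivative of the datum; the origin is covered by `I_mul_deriv_schwarz_zero`. This lets the
construction descend to the quotient by constants. -/
theorem deriv_schwarz_congr {ψ φ : C1Holder β} (h : C1Holder.diff ψ = C1Holder.diff φ) {w : ℂ}
    (hw : w ∈ ball (0 : ℂ) 1) : deriv (schwarz ψ) w = deriv (schwarz φ) w := by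
  by_cases h0 : w = 0
  · subst h0
    apply mul_left_cancel₀ Complex.I_ne_zero
    rw [I_mul_deriv_schwarz_zero, I_mul_deriv_schwarz_zero, h]
  · apply mul_left_cancel₀ h0
    have h1 : tangDeriv ψ = tangDeriv φ :=
      funext fun z => congrArg (fun f : CHolderDot β => f.1 z) h
    rw [mul_deriv_schwarz ψ.continuous ψ.isC1 hw, mul_deriv_schwarz φ.continuous φ.isC1 hw, h1]

theorem critPt_congr {ψ φ : C1Holder β} (h : C1Holder.diff ψ = C1Holder.diff φ) :
    critPt ψ = critPt φ := by
  have h1 : (fun b : ℂ => ‖b‖ ≤ 1 / 4 ∧ critMap ψ b = b) =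
      fun b : ℂ => ‖b‖ ≤ 1 / 4 ∧ critMap φ b = b := by
    funext b
    refine propext (and_congr_right fun hb => ?_)
    rw [critMap, critMap, deriv_schwarz_congr h (by rw [mem_ball_zero_iff]; linarith)]
  -- The chosen witnesses coincide because the two predicates are equal, not just satisfiable
  -- together; no smallness of `ψ` is needed.
  have key : ∀ p q : ℂ → Prop, p = q → (open Classical in
      if h : ∃ b, p b then h.choose else 0) = open Classical in
        if h : ∃ b, q b then h.choose else 0 := by
    rintro p _ rfl
    rfl
  exact key _ _ h1

theorem normalCurrent_congr (hβ0 : 0 < β) (hβ1 : β < 1) {ψ φ : C1Holder β}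
    (h : C1Holder.diff ψ = C1Holder.diff φ) :
    normalCurrent hβ0 hβ1 ψ = normalCurrent hβ0 hβ1 φ := by
  rw [normalCurrent, normalCurrent, h, critPt_congr h]

theorem exists_isUStar (hβ0 : 0 < β) (hβ1 : β < 1) (c : Circle) :
    ∃ U : C1HolderModConst β → CHolderDot β, IsUStar β 0 (fun z => c * z) U := by
  refine ⟨fun q => normalCurrent hβ0 hβ1 (primitiveL (diffEquiv q)), fun ψ => critPt ψ,
    isCriticalBranch_critPt hβ0 hβ1 c, ?_⟩
  filter_upwards [closedBall_mem_nhds (0 : C1Holder β) (by norm_num : (0 : ℝ) < 1 / 72)] with ψ hψ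
  rw [mem_closedBall_zero_iff] at hψ
  have h : normalCurrent hβ0 hβ1 (primitiveL (diffEquiv (Submodule.Quotient.mk ψ))) =
      normalCurrent hβ0 hβ1 ψ :=
    normalCurrent_congr hβ0 hβ1 (by rw [diff_primitiveL, diffEquiv_mk])
  rw [h]
  exact hasN_normalCurrent hβ0 hβ1 c hψ

/-- The constants are the kernel of a continuous operator; closedness makes the quotient seminorm a
norm. -/
theorem isClosed_constants : IsClosed (constants β : Set (C1Holder β)) := by
  have h : constants β = (C1Holder.diff (β := β)).ker := by
    refine le_antisymm constants_le_ker fun ψ hψ => ?_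
    have h1 := primitiveL_diff_sub_mem ψ
    have h2 : C1Holder.diff ψ = 0 := hψ
    rwa [h2, map_zero, zero_sub, neg_mem_iff] at h1
  rw [h]
  exact C1Holder.diff.isClosed_ker

/-- Uniqueness of the branch and of the normal current forces `U` to agree near the origin with
`normalCurrent` on representatives. A continuous linear section of the quotient map then reduces the
claim to the chain rule. -/
theorem IsUStar.hasFDerivAt (hβ0 : 0 < β) (hβ1 : β < 1) {c : Circle}
    {U : C1HolderModConst β → CHolderDot β} (hU : IsUStar β 0 (fun z => c * z) U) :
    HasFDerivAt U (diffEquiv.trans (conjFlipEquiv hβ0 hβ1) :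
      C1HolderModConst β →L[ℝ] CHolderDot β) 0 := by
  obtain ⟨a, ha, hN⟩ := hU
  have h1 : ∀ᶠ ψ : C1Holder β in 𝓝 0,
      U (Submodule.Quotient.mk ψ) = normalCurrent hβ0 hβ1 ψ := by
    filter_upwards [ha.eventually_eq hβ0 hβ1, hN,
      closedBall_mem_nhds (0 : C1Holder β) (by norm_num : (0 : ℝ) < 1 / 72)] with ψ h1 h2 h3
    rw [mem_closedBall_zero_iff] at h3
    have h4 : critPt ψ ∈ ball (0 : ℂ) 1 := by
      have := (critPt_spec h3).1
      rw [mem_ball_zero_iff]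
      linarith
    rw [← h1] at h2
    exact CHolderDot.ext fun z =>
      congrFun (h2.unique h4 (hasN_normalCurrent hβ0 hβ1 c h3)) z
  set σ : C1HolderModConst β →L[ℝ] C1Holder β :=
    primitiveL.comp diffEquiv.toContinuousLinearMap
  have hσ : Tendsto σ (𝓝 0) (𝓝 0) := by
    have := σ.continuous.tendsto 0
    rwa [map_zero] at this
  have h2 : U =ᶠ[𝓝 0] fun q => normalCurrent hβ0 hβ1 (σ q) := by
    filter_upwards [hσ.eventually h1] with q hq
    rw [← hq]
    congr 1
    exact (mk_primitiveL_diffEquiv q).symm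
  have h3 := hasFDerivAt_normalCurrent (β := β) hβ0 hβ1
  rw [← map_zero σ] at h3
  have : IsClosed (constants β : Set (C1Holder β)) := isClosed_constants
  refine ((h3.comp 0 σ.hasFDerivAt).congr_of_eventuallyEq h2).congr_fderiv ?_
  apply ContinuousLinearMap.ext
  intro q
  change conjFlipEquiv hβ0 hβ1 (C1Holder.diff (primitiveL (diffEquiv q))) =
    conjFlipEquiv hβ0 hβ1 (diffEquiv q)
  rw [diff_primitiveL]

end Operator

/-! ## Canonical boundary data associated with the origin -/

theorem isCanonicalDatum_mul (c : Circle) : IsCanonicalDatum 0 fun z => c * z := by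
  have h0 : IsC1 (fun _ : Circle => (0 : ℝ)) :=
    isC1_of_hasDerivAt (d := fun _ => 0) continuous_const fun t => hasDerivAt_const t 0
  have e : (fun z => c * z) = twist (fun z => c * z) fun _ => 0 := by
    funext z
    simp [twist]
  have htang : ∀ z : Circle, tangDeriv (fun _ : Circle => (0 : ℝ)) z = 0 := fun z =>
    deriv_const 0 (0 : ℝ)
  have hcur : current (fun z => c * z) = fun _ => 1 := by
    funext z
    rw [e, current_twist c h0, htang, add_zero]
  have h1 : IsC1 (fun z : Circle => ((c * z : Circle) : ℂ)) := by
    refine isC1_of_hasDerivAt (d := fun z : Circle => (c : ℂ) * (Complex.I * z)) (by fun_prop) ?_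
    intro t
    simpa only [Circle.coe_mul] using (hasDerivAt_coe_exp t).const_mul (c : ℂ)
  refine ⟨h1, ?_, fun _ => 0, ⟨?_, fun z => ?_⟩, fun z => ?_⟩
  · rw [hcur, circleInt]
    simp
  · simpa using harmonicContOnCl_re (diffContOnCl_const (c := (0 : ℂ)) (s := ball (0 : ℂ) 1))
  · simp [z.norm_coe]
  · have h2 := hasNormalDeriv_log_norm_sub (a := 0) (by simp) z
    rw [hcur]
    rw [sub_zero, div_self z.coe_ne_zero, Complex.one_re] at h2
    simpa using h2

/-- Uniqueness for the Dirichlet problem gives `R = 0`, hence current `1`. Together with `|g| = 1`,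
which makes the derivative orthogonal to `g`, this forces the derivative to be `i g`; then
`g(e^{it}) / e^{it}` is constant. -/
theorem IsCanonicalDatum.exists_eq_mul {g : Circle → Circle} (hg : IsCanonicalDatum 0 g) :
    ∃ c : Circle, ∀ z : Circle, g z = c * z := by
  obtain ⟨hC1, -, R, ⟨hR, hR0⟩, hR1⟩ := hg
  have h1 : EqOn (fun x => Real.log ‖x - 0‖ + R x) (fun x => Real.log ‖x - 0‖)
      (closedBall 0 1) := by
    have h2 := eqOn_closedBall_of_eq_circle hR
      (harmonicContOnCl_re (diffContOnCl_const (c := (0 : ℂ)))) (fun z => by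
        have := hR0 z
        simpa [z.norm_coe] using this)
    intro x hx
    have := h2 hx
    simp only [Complex.zero_re] at this
    simp [this]
  have hcur : ∀ z, current g z = 1 := by
    intro z
    have h2 := (hR1 z).unique (hasNormalDeriv_log_norm_sub (a := 0) (by simp) z) h1
    rwa [sub_zero, div_self z.coe_ne_zero, Complex.one_re] at h2
  have hd : ∀ t : ℝ, HasDerivAt (fun s : ℝ => (g (Circle.exp s) : ℂ))
      (Complex.I * g (Circle.exp t)) t := by
    intro t
    have h3 := hC1.hasDerivAt_exp t
    refine h3.congr_deriv ?_
    set D := tangDeriv (fun z => (g z : ℂ)) (Circle.exp t)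
    have h4 : wedge (g (Circle.exp t)) D = 1 := hcur (Circle.exp t)
    have h5 := Complex.reCLM.hasFDerivAt.comp_hasDerivAt t h3
    have h6 := Complex.imCLM.hasFDerivAt.comp_hasDerivAt t h3
    have h7 := (h5.fun_mul h5).fun_add (h6.fun_mul h6)
    have h8 : ∀ s : ℝ, (g (Circle.exp s) : ℂ).re * (g (Circle.exp s) : ℂ).re +
        (g (Circle.exp s) : ℂ).im * (g (Circle.exp s) : ℂ).im = 1 := fun s => by
      rw [← Complex.normSq_apply, Circle.normSq_coe]
    have h9 := h7.unique ((hasDerivAt_const t (1 : ℝ)).congr_of_eventuallyEq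
      (Eventually.of_forall h8))
    have h10 := h8 t
    simp only [Function.comp_apply, Complex.reCLM_apply, Complex.imCLM_apply] at h9
    rw [wedge] at h4
    apply Complex.ext
    · simp only [Complex.mul_re, Complex.I_re, Complex.I_im]
      linear_combination (-D.re) * h10 + (g (Circle.exp t) : ℂ).re / 2 * h9 -
        (g (Circle.exp t) : ℂ).im * h4
    · simp only [Complex.mul_im, Complex.I_re, Complex.I_im]
      linear_combination (-D.im) * h10 + (g (Circle.exp t) : ℂ).im / 2 * h9 +
        (g (Circle.exp t) : ℂ).re * h4
  have hd2 : ∀ t : ℝ, HasDerivAt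
      (fun s : ℝ => (g (Circle.exp s) : ℂ) / (Circle.exp s : ℂ)) 0 t := by
    intro t
    refine ((hd t).fun_div (hasDerivAt_coe_exp t) (Circle.coe_ne_zero _)).congr_deriv ?_
    ring
  refine ⟨g 1, fun z => ?_⟩
  obtain ⟨t, rfl⟩ := Circle.exp_surjective z
  have h3 := is_const_of_deriv_eq_zero (fun t => (hd2 t).differentiableAt)
    (fun t => (hd2 t).deriv) t 0
  simp only [Circle.exp_zero, Circle.coe_one, div_one] at h3
  rw [div_eq_iff (Circle.coe_ne_zero _)] at h3
  apply Circle.ext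
  rw [h3, Circle.coe_mul]

end GLDisc

end

open GLDisc
theorem mainTheorem5 (β : ℝ≥0) (hβ0 : 0 < β) (hβ1 : β < 1) :
    (∀ g : Circle → Circle, IsCanonicalDatum 0 g ↔ ∃ c : Circle, ∀ z : Circle, g z = c * z) ∧
    ∀ g₀ : Circle → Circle, IsCanonicalDatum 0 g₀ →
      IsNondegenerateCriticalPoint g₀ 0 ∧
      (∀ v w : ℂ, hessW g₀ 0 v w = 2 * Real.pi * inner ℝ v w) ∧
      (∃ U : C1HolderModConst β → CHolderDot β, IsUStar β 0 g₀ U) ∧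
      ∀ U : C1HolderModConst β → CHolderDot β, IsUStar β 0 g₀ U →
        ∃ L : C1HolderModConst β ≃L[ℝ] CHolderDot β,
          HasFDerivAt U (L : C1HolderModConst β →L[ℝ] CHolderDot β) 0 := by
  refine ⟨fun g => ⟨IsCanonicalDatum.exists_eq_mul, ?_⟩, ?_⟩
  · rintro ⟨c, hc⟩
    rw [funext hc]
    exact isCanonicalDatum_mul c
  · intro g₀ hg
    obtain ⟨c, hc⟩ := hg.exists_eq_mul
    obtain rfl : g₀ = fun z => c * z := funext hc
    -- The unperturbed datum is the twist by `ψ = 0`, so the formulas for twisted data apply to it.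
    have e : twist (fun z => c * z) (0 : C1Holder β) = fun z => c * z := by
      funext z
      change c * z * Circle.exp 0 = c * z
      rw [Circle.exp_zero, mul_one]
    have h1 := isNondegenerateCriticalPoint hβ0 hβ1 (b := 0) (by norm_num) c
      (ψ := (0 : C1Holder β)) (by norm_num) gradField_zero
    have h2 := hessW_zero hβ0 hβ1 c
    rw [e] at h1 h2
    exact ⟨h1, h2, exists_isUStar hβ0 hβ1 c, fun U hU => ⟨_, hU.hasFDerivAt hβ0 hβ1⟩⟩
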